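/- **Theorem (Restriction Theorem in weight 0).** Let $k$ be a field of characteristic $0$, $R$ a semisimple finite-dimensional $k$-algebra, and $B$ an associative $R$-algebra, i.e. a $k$-algebra with a (not necessarily central) unital $k$-algebra map $R\to B$. Assume that $B$ is smooth over $R$: it is finitely generated over $R$, and the bimodule $\Omega^1_RB$ of noncommutative relative $1$-forms is a projective $B\otimes_k B^{\mathrm{op}}$-module. Let $N>0$, let $E_1,\dots,E_N$ be finitely generated projective $B$-bimodules, let $M_i=E_i[-i]$ be $E_i$ placed in weight $i$, and let $A=T_BM$ be the tensor algebra of $M=M_1\oplus\cdots\oplus M_N$, graded by weight. Let $\Omega_R^\bullet A=T_A\Omega^1_RA$ and $\mathrm{DR}^\bullet_R A=\Omega^\bullet_RA/[\Omega^\bullet_RA,\Omega^\bullet_RA]$ (commutators with the Koszul sign $(-1)^{|x||y|+\|x\|\|y\|}$, $|\cdot|$ the weight, $\|\cdot\|$ the form degree). Let $\mathbb{D}\mathrm{er}_RA=\bigoplus_{d\in\mathbb Z}\mathrm{Der}^d_R(A,A\otimes A)$ be the graded $R$-linear double derivations, for the outer bimodule structure $a(u\otimes v)b=au\otimes vb$;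 its $A$-bimodule structure comes from the inner one, $a*(u\otimes v)*b=\pm\, ub\otimes av$ with the Koszul sign. For $\Theta\in\mathbb{D}\mathrm{er}_RA$, let $i_\Theta$ be the double derivation of $\Omega^\bullet_RA$ of form degree $-1$ with $i_\Theta a=0$, $i_\Theta(\mathrm{d}a)=\Theta(a)$, and let $\iota_\Theta={}^\circ(i_\Theta)\colon\mathrm{DR}_R^\bullet A\to\Omega_R^{\bullet-1}A$, where ${}^\circ(x\otimes y)=(-1)^{|x||y|+\|x\|\|y\|}yx$. Let $\omega\in\mathrm{DR}^2_R A$ be a bi-symplectic form of weight $N$: $\omega$ has weight $N$, $\mathrm{d}\omega=0$, and $\iota(\omega)\colon\mathbb{D}\mathrm{er}_RA\to\Omega^1_RA$, $\Theta\mapsto\iota_\Theta\omega$, is an isomorphism (of graded $A$-bimodules, after shifting the weights of the target by $N$). Restriction of double derivations to $B$, together with the canonical isomorphism $A\otimes_B\mathbb{D}\mathrm{er}_RB\otimes_BA\cong\mathrm{Der}_R(B,A\otimes A)$, $a\otimes\theta\otimes a'\mapsto a*\theta*a'$, gives a surjection $\varepsilon^\vee\colon\mathbb{D}\mathrm{er}_RA\to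 A\otimes_B\mathbb{D}\mathrm{er}_RB\otimes_BA$. Let $\nu_N\colon\Omega^1_RA\to A\otimes_BM_N\otimes_BA$ be the map of $A$-bimodules with $\nu_N(\mathrm{d}b)=0$ for $b\in B$, $\nu_N(\mathrm{d}m)=1\otimes m\otimes1$ for $m\in M_N$, and $\nu_N(\mathrm{d}m)=0$ for $m\in M_i$, $i<N$. Then $\iota(\omega)$ induces an isomorphism $$\tilde\iota(\omega)\colon A\otimes_B\mathbb{D}\mathrm{er}_RB\otimes_BA\xrightarrow{\ \cong\ }A\otimes_BM_N\otimes_BA ,\qquad \tilde\iota(\omega)\circ\varepsilon^\vee=\nu_N\circ\iota(\omega),$$ which raises weights by $N$ and is an isomorphism of graded $A$-bimodules after shifting the target by $N$, that is, $\tilde\iota(\omega)(a\,t\,b)=(-1)^{N|b|}\,a\,\tilde\iota(\omega)(t)\,b$ for homogeneous $b$. In weight zero it restricts to an isomorphism of $B$-bimodules $$\tilde\iota(\omega)_{(0)}\colon\mathbb{D}\mathrm{er}_RB\xrightarrow{\ \cong\ }E_N,\qquad \tilde\iota(\omega)(1\otimes\theta\otimes1)=1\otimes\tilde\iota(\omega)_{(0)}(\theta)\otimes1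 .$$ -/

import Mathlib

open TensorProduct MulOpposite DirectSum

namespace NCG


section Bimodules

variable (k : Type*) [Field k]

/-- The enveloping algebra `A ⊗ Aᵒᵖ`. An `A`-bimodule (with the same action of `k` on both sides) is
a module over it, with `env k a b • m = a m b`. -/
def Env (A : Type*) [Ring A] [Algebra k A] := A ⊗[k] Aᵐᵒᵖ

noncomputable instance (A : Type*) [Ring A] [Algebra k A] : Ring (Env k A) :=
  inferInstanceAs (Ring (A ⊗[k] Aᵐᵒᵖ))

noncomputable instance (A : Type*) [Ring A] [Algebra k A] : Algebra k (Env k A) :=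
  inferInstanceAs (Algebra k (A ⊗[k] Aᵐᵒᵖ))

/-- The element `a ⊗ b` of the enveloping algebra, acting on bimodules by `m ↦ a m b`. -/
def env {A : Type*} [Ring A] [Algebra k A] (a b : A) : Env k A := a ⊗ₜ[k] op b

theorem env_mul {A : Type*} [Ring A] [Algebra k A] (a b a' b' : A) :
    env k a b * env k a' b' = env k (a * a') (b' * b) :=
  (Algebra.TensorProduct.tmul_mul_tmul a a' (op b) (op b')).trans rfl

theorem env_one {A : Type*} [Ring A] [Algebra k A] : env k (1 : A) 1 = 1 := rfl

variable {k} {A C : Type*} [Ring A] [Algebra k A] [Ring C] [Algebra k C]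

/-- The `A`-bimodule structure on an `A`-algebra `f : A → C`: `(a ⊗ b) · c = f a * c * f b`. -/
noncomputable def sandwich (f : A →ₐ[k] C) : Env k A →ₐ[k] Module.End k C :=
  Algebra.TensorProduct.lift (A := A) (B := Aᵐᵒᵖ) ((Algebra.lmul k C).comp f)
    (AlgHom.ofLinearMap ((LinearMap.mul k C).flip ∘ₗ f.toLinearMap ∘ₗ (opLinearEquiv k).symm.toLinearMap)
      (by ext; simp) (by intro x y; ext; simp [mul_assoc]))
    (by intro x y; ext; simp [mul_assoc])

@[simp] theorem sandwich_apply (f : A →ₐ[k] C) (a b : A) (c : C) :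
    sandwich f (env k a b) c = f a * c * f b := by
  refine (DFunLike.congr_fun (Algebra.TensorProduct.lift_tmul _ _ _ a (op b)) c).trans ?_
  simp [mul_assoc]

theorem env_induction {P : Env k A → Prop} (x : Env k A) (h : ∀ a b, P (env k a b))
    (hadd : ∀ x y, P x → P y → P (x + y)) : P x := by
  induction x using TensorProduct.induction_on with
  | zero => simpa [env] using h 0 0
  | tmul a b => exact h a b.unop
  | add x y hx hy => exact hadd x y hx hy

end Bimodules

section TensorAlg
variable (k : Type*) [Field k] (B : Type*) [Ring B] [Algebra k B]
  (M : Type*) [AddCommGroup M] [Module k M] [Module (Env k B) M]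

/-- The relations presenting the tensor algebra of a bimodule: `B` is a subalgebra and the generators
from `M` are linear with `b · m · b' = b m b'`. -/
inductive TensorAlg.Rel : FreeAlgebra k (B ⊕ M) → FreeAlgebra k (B ⊕ M) → Prop
  | base_add (b b' : B) : Rel (FreeAlgebra.ι k (.inl (b + b')))
      (FreeAlgebra.ι k (.inl b) + FreeAlgebra.ι k (.inl b'))
  | base_mul (b b' : B) : Rel (FreeAlgebra.ι k (.inl (b * b')))
      (FreeAlgebra.ι k (.inl b) * FreeAlgebra.ι k (.inl b'))
  | base_scalar (c : k) : Rel (FreeAlgebra.ι k (.inl (algebraMap k B c))) (algebraMap k _ c)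
  | gen_add (m m' : M) : Rel (FreeAlgebra.ι k (.inr (m + m')))
      (FreeAlgebra.ι k (.inr m) + FreeAlgebra.ι k (.inr m'))
  | gen_smul (c : k) (m : M) : Rel (FreeAlgebra.ι k (.inr (c • m)))
      (c • FreeAlgebra.ι k (.inr m))
  | gen_bimod (b b' : B) (m : M) : Rel (FreeAlgebra.ι k (.inr (env k b b' • m)))
      (FreeAlgebra.ι k (.inl b) * FreeAlgebra.ι k (.inr m) * FreeAlgebra.ι k (.inl b'))

/-- The tensor algebra `T_B M` of the `B`-bimodule `M`, for a not necessarily commutative `B`. -/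
def TensorAlg := RingQuot (TensorAlg.Rel k B M)

namespace TensorAlg

noncomputable instance : Ring (TensorAlg k B M) := inferInstanceAs (Ring (RingQuot _))
noncomputable instance : Algebra k (TensorAlg k B M) := inferInstanceAs (Algebra k (RingQuot _))

variable {B}
/-- The inclusion of `B` in `T_B M`. -/
noncomputable def base : B →ₐ[k] TensorAlg k B M :=
  AlgHom.ofLinearMap
    { toFun := fun b => RingQuot.mkAlgHom k (Rel k B M) (FreeAlgebra.ι k (.inl b))
      map_add' := fun b b' => by
        rw [RingQuot.mkAlgHom_rel k (Rel.base_add b b'), map_add]; rfl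
      map_smul' := fun c b => by
        rw [Algebra.smul_def, RingQuot.mkAlgHom_rel k (Rel.base_mul _ b), map_mul,
          RingQuot.mkAlgHom_rel k (Rel.base_scalar c), AlgHom.commutes, RingHom.id_apply]
        exact (Algebra.smul_def (A := RingQuot (Rel k B M)) _ _).symm }
    (by
      have := RingQuot.mkAlgHom_rel k (Rel.base_scalar (k := k) (B := B) (M := M) 1)
      simp only [map_one] at this
      exact this)
    (fun b b' => by
      have := RingQuot.mkAlgHom_rel k (Rel.base_mul (k := k) (B := B) (M := M) b b')
      rw [map_mul] at this
      exact this)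

variable {M}
/-- The inclusion of `M` in `T_B M`. -/
noncomputable def gen : M →ₗ[k] TensorAlg k B M where
  toFun m := RingQuot.mkAlgHom k (Rel k B M) (FreeAlgebra.ι k (.inr m))
  map_add' m m' := by rw [RingQuot.mkAlgHom_rel k (Rel.gen_add m m'), map_add]; rfl
  map_smul' c m := by
    rw [RingQuot.mkAlgHom_rel k (Rel.gen_smul c m), map_smul]; rfl

theorem gen_env_smul (b b' : B) (m : M) :
    gen k (env k b b' • m) = base k M b * gen k m * base k M b' := by
  have := RingQuot.mkAlgHom_rel k (Rel.gen_bimod (k := k) b b' m)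
  rw [map_mul, map_mul] at this
  exact this

variable {k}

/-- The universal property of `T_B M`. -/
noncomputable def lift {C : Type*} [Semiring C] [Algebra k C] (f : B →ₐ[k] C) (g : M →ₗ[k] C)
    (h : ∀ b b' m, g (env k b b' • m) = f b * g m * f b') : TensorAlg k B M →ₐ[k] C :=
  RingQuot.liftAlgHom k ⟨FreeAlgebra.lift k (Sum.elim f g), by
    intro x y r
    induction r <;> simp [h]⟩

section
variable {C : Type*} [Semiring C] [Algebra k C] (f : B →ₐ[k] C) (g : M →ₗ[k] C)
    (h : ∀ b b' m, g (env k b b' • m) = f b * g m * f b')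

@[simp] theorem lift_base (b : B) : lift f g h (base k M b) = f b := by
  refine (RingQuot.liftAlgHom_mkAlgHom_apply k _ (s := Rel k B M) _ _).trans ?_
  simp

@[simp] theorem lift_gen (m : M) : lift f g h (gen k m) = g m := by
  refine (RingQuot.liftAlgHom_mkAlgHom_apply k _ (s := Rel k B M) _ _).trans ?_
  simp
end

theorem induction {P : TensorAlg k B M → Prop} (hb : ∀ b, P (base k M b)) (hg : ∀ m, P (gen k m))
    (hadd : ∀ x y, P x → P y → P (x + y)) (hmul : ∀ x y, P x → P y → P (x * y))
    (x : TensorAlg k B M) : P x := by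
  obtain ⟨y, rfl⟩ := RingQuot.mkAlgHom_surjective k (Rel k B M) x
  induction y with
  | grade0 c =>
    have := hb (algebraMap k B c)
    rw [AlgHom.commutes] at this
    rw [AlgHom.commutes]; exact this
  | grade1 z => cases z with
    | inl b => exact hb b
    | inr m => exact hg m
  | mul a b ha hb => rw [map_mul]; exact hmul _ _ ha hb
  | add a b ha hb => rw [map_add]; exact hadd _ _ ha hb

end TensorAlg
end TensorAlg

section Omega1
variable {k : Type*} [Field k] {R A : Type*} [Ring R] [Algebra k R] [Ring A] [Algebra k A]
  (ρ : R →ₐ[k] A)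

/-- The relations between the symbols `d a`: additivity, `k`-linearity, the Leibniz rule, and
`d r = 0` for `r` in `R`. -/
noncomputable def Omega1.rel : Submodule (Env k A) (A →₀ Env k A) :=
  Submodule.span (Env k A)
    ({x | ∃ a b : A, x = .single (a + b) 1 - .single a 1 - .single b 1} ∪
     {x | ∃ (c : k) (a : A), x = .single (c • a) 1 - c • .single a 1} ∪
     {x | ∃ a b : A, x = .single (a * b) 1 - .single a (env k 1 b) - .single b (env k a 1)} ∪
     {x | ∃ r : R, x = .single (ρ r) 1})

/-- The bimodule `Ω¹_R A` of noncommutative differential 1-forms relative to `ρ : R → A`, the target of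
the universal `R`-linear derivation of `A` (see `Omega1.lift`). -/
abbrev Omega1 := (A →₀ Env k A) ⧸ Omega1.rel ρ

namespace Omega1

/-- The universal derivation. -/
noncomputable def D : A →ₗ[k] Omega1 ρ where
  toFun a := Submodule.Quotient.mk (.single a 1)
  map_add' a b := by
    rw [← Submodule.Quotient.mk_add, Submodule.Quotient.eq, ← sub_sub]
    exact Submodule.subset_span (.inl (.inl (.inl ⟨a, b, rfl⟩)))
  map_smul' c a := by
    rw [RingHom.id_apply, ← Submodule.Quotient.mk_smul, Submodule.Quotient.eq]
    exact Submodule.subset_span (.inl (.inl (.inr ⟨c, a, rfl⟩)))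

theorem D_mul (a b : A) : D ρ (a * b) = env k 1 b • D ρ a + env k a 1 • D ρ b := by
  simp only [D, LinearMap.coe_mk, AddHom.coe_mk]
  rw [← Submodule.Quotient.mk_smul, ← Submodule.Quotient.mk_smul, ← Submodule.Quotient.mk_add,
    Submodule.Quotient.eq, ← sub_sub]
  refine Submodule.subset_span (.inl (.inr ⟨a, b, ?_⟩))
  simp

theorem D_base (r : R) : D ρ (ρ r) = 0 :=
  (Submodule.Quotient.mk_eq_zero _).2 (Submodule.subset_span (.inr ⟨r, rfl⟩))

theorem span_D : Submodule.span (Env k A) (Set.range (D ρ)) = ⊤ := by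
  rw [eq_top_iff]
  rintro x -
  obtain ⟨x, rfl⟩ := Submodule.Quotient.mk_surjective _ x
  induction x using Finsupp.induction_linear with
  | zero => exact Submodule.zero_mem _
  | add f g hf hg => exact Submodule.add_mem _ hf hg
  | single a e =>
    have : (Finsupp.single a e : A →₀ Env k A) = e • .single a 1 := by simp
    rw [this, Submodule.Quotient.mk_smul]
    exact Submodule.smul_mem _ _ (Submodule.subset_span ⟨a, rfl⟩)

variable {X : Type*} [AddCommGroup X] [Module k X]

/-- The universal property of `Ω¹_R A`, for a bimodule `X` with action `Φ`. -/
noncomputable def lift (Φ : Env k A →ₐ[k] Module.End k X) (δ : A →ₗ[k] X)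
    (hmul : ∀ a b, δ (a * b) = Φ (env k 1 b) (δ a) + Φ (env k a 1) (δ b))
    (hR : ∀ r, δ (ρ r) = 0) : Omega1 ρ →ₗ[k] X :=
  letI : Module (Env k A) X := Module.compHom X Φ.toRingHom
  haveI : IsScalarTower k (Env k A) X := ⟨fun c e x => by
    change Φ (c • e) x = c • Φ e x
    rw [map_smul]; rfl⟩
  ((Omega1.rel ρ).liftQ (Finsupp.linearCombination (Env k A) (fun a => δ a)) (by
    have hs : ∀ (e : Env k A) (x : X), e • x = Φ e x := fun _ _ => rfl
    refine Submodule.span_le.2 ?_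
    rintro x (((⟨a, b, rfl⟩ | ⟨c, a, rfl⟩) | ⟨a, b, rfl⟩) | ⟨r, rfl⟩)
    · simp
    · simp [Finsupp.linearCombination_single, -Finsupp.smul_single, LinearMap.map_smul_of_tower]
    · simp [hs, hmul]
    · simp [hR])).restrictScalars k

section
variable (Φ : Env k A →ₐ[k] Module.End k X) (δ : A →ₗ[k] X)
    (hmul : ∀ a b, δ (a * b) = Φ (env k 1 b) (δ a) + Φ (env k a 1) (δ b))
    (hR : ∀ r, δ (ρ r) = 0)

@[simp] theorem lift_D (a : A) : lift ρ Φ δ hmul hR (D ρ a) = δ a := by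
  let _ : Module (Env k A) X := Module.compHom X Φ.toRingHom
  change Finsupp.linearCombination (Env k A) (fun a => δ a) (.single a 1) = δ a
  simp

theorem lift_smul (e : Env k A) (x : Omega1 ρ) :
    lift ρ Φ δ hmul hR (e • x) = Φ e (lift ρ Φ δ hmul hR x) := by
  let _ : Module (Env k A) X := Module.compHom X Φ.toRingHom
  unfold lift
  simp only [LinearMap.restrictScalars_apply, map_smul]
  rfl
end
end Omega1
end Omega1


section Signs
variable (k : Type*) [Field k]

/-- The sign `(-1) ^ n`. -/
def sgn (n : ℤ) : k := (-1) ^ n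

theorem sgn_add (m n : ℤ) : sgn k (m + n) = sgn k m * sgn k n := by
  simp [sgn, zpow_add₀]

@[simp] theorem sgn_zero : sgn k 0 = 1 := by simp [sgn]

theorem sgn_eq_of_even {m n : ℤ} (h : Even (m - n)) : sgn k m = sgn k n := by
  have : sgn k (m - n) = 1 := h.neg_one_zpow
  calc sgn k m = sgn k (m - n + n) := by ring_nf
    _ = sgn k n := by rw [sgn_add, this, one_mul]

theorem sgn_cases (n : ℤ) : sgn k n = 1 ∨ sgn k n = -1 := by
  rcases Int.even_or_odd n with h | h
  · exact .inl h.neg_one_zpow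
  · exact .inr h.neg_one_zpow

theorem sgn_sq (n : ℤ) : sgn k n * sgn k n = 1 := by
  rw [← sgn_add, sgn_eq_of_even k (n := 0) ⟨n, by ring⟩, sgn_zero]

variable {k} {C : Type*} [Ring C] [Algebra k C]

/-- For an involution `s` acting on homogeneous elements by `s x = (-1)^|x| x`, this is the map
`x ⊗ y ↦ (-1)^(|x||y|) x ⊗ y`; see `koszul_tmul`. -/
noncomputable def koszul (s : C →ₐ[k] C) : C ⊗[k] C →ₗ[k] C ⊗[k] C :=
  (2 : k)⁻¹ • (LinearMap.id + TensorProduct.map s.toLinearMap LinearMap.id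
    + TensorProduct.map LinearMap.id s.toLinearMap
    - TensorProduct.map s.toLinearMap s.toLinearMap)

theorem koszul_tmul [CharZero k] (s : C →ₐ[k] C) {i j : ℤ} {x y : C}
    (hx : s x = sgn k i • x) (hy : s y = sgn k j • y) :
    koszul s (x ⊗ₜ y) = sgn k (i * j) • (x ⊗ₜ[k] y) := by
  have h2 : (2 : k) ≠ 0 := two_ne_zero
  have e : koszul s (x ⊗ₜ y)
      = ((2 : k)⁻¹ * (1 + sgn k i + sgn k j - sgn k i * sgn k j)) • (x ⊗ₜ[k] y) := by
    simp only [koszul, LinearMap.smul_apply, LinearMap.sub_apply, LinearMap.add_apply,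
      TensorProduct.map_tmul, LinearMap.id_apply, AlgHom.toLinearMap_apply, hx, hy,
      ← TensorProduct.smul_tmul', TensorProduct.tmul_smul, mul_smul, sub_smul, add_smul,
      one_smul]
    rw [smul_comm (sgn k j)]
  rw [e]
  congr 1
  rcases Int.even_or_odd i with hi | hi <;> rcases Int.even_or_odd j with hj | hj
  · rw [show sgn k i = 1 from hi.neg_one_zpow, show sgn k j = 1 from hj.neg_one_zpow,
      show sgn k (i * j) = 1 from (hi.mul_right j).neg_one_zpow]
    field_simp; norm_num
  · rw [show sgn k i = 1 from hi.neg_one_zpow, show sgn k j = -1 from hj.neg_one_zpow,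
      show sgn k (i * j) = 1 from (hi.mul_right j).neg_one_zpow]
    field_simp; norm_num
  · rw [show sgn k i = -1 from hi.neg_one_zpow, show sgn k j = 1 from hj.neg_one_zpow,
      show sgn k (i * j) = 1 from (hj.mul_left i).neg_one_zpow]
    field_simp; norm_num
  · rw [show sgn k i = -1 from hi.neg_one_zpow, show sgn k j = -1 from hj.neg_one_zpow,
      show sgn k (i * j) = -1 from (hi.mul hj).neg_one_zpow]
    field_simp; norm_num

end Signs

section Graded
variable {k : Type*} [Field k] {A : Type*} [Ring A] [Algebra k A]
  (𝒜 : ℕ → Submodule k A) [GradedAlgebra 𝒜]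

/-- The automorphism of a graded algebra with `a ↦ (-1)^(d|a|) a`. -/
noncomputable def signAut (d : ℤ) : A →ₐ[k] A :=
  (DirectSum.toAlgebra k (fun i => 𝒜 i) (fun i => sgn k (d * i) • (𝒜 i).subtype)
    (by simp [sgn])
    (fun {i j} x y => by
      simp only [LinearMap.smul_apply, Submodule.subtype_apply,
        Nat.cast_add, mul_add, sgn_add, smul_mul_smul_comm]
      rfl)).comp (DirectSum.decomposeAlgEquiv 𝒜).toAlgHom

theorem signAut_of_mem (d : ℤ) {i : ℕ} {a : A} (h : a ∈ 𝒜 i) :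
    signAut 𝒜 d a = sgn k (d * i) • a := by
  have := DirectSum.decompose_of_mem 𝒜 h
  have h2 : signAut 𝒜 d a = DirectSum.toAddMonoid
    (fun i : ℕ => (sgn k (d * i) • (𝒜 i).subtype).toAddMonoidHom) (decompose 𝒜 a) := rfl
  rw [h2, this, DirectSum.toAddMonoid_of]
  rfl

theorem graded_induction {P : A → Prop} (a : A) (h : ∀ i, ∀ a ∈ 𝒜 i, P a)
    (hadd : ∀ x y, P x → P y → P (x + y)) : P a :=
  DirectSum.Decomposition.inductionOn 𝒜 (h 0 0 (Submodule.zero_mem _)) (fun a => h _ a a.2)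
    hadd a

/-- Weight `n` part of `A ⊗ A`. -/
def tensorPart (n : ℤ) : Submodule k (A ⊗[k] A) :=
  Submodule.span k {z | ∃ (p q : ℕ) (x y : A), x ∈ 𝒜 p ∧ y ∈ 𝒜 q ∧ (p + q : ℤ) = n ∧ z = x ⊗ₜ y}

variable {R : Type*} [Ring R] [Algebra k R] (ρ : R →ₐ[k] A)

/-- The structure map of the `R`-algebra `A` has image in weight `0`. -/
class IsGradedOver : Prop where
  map_mem : ∀ r, ρ r ∈ 𝒜 0

/-- The `R`-linear double derivations `A → A ⊗ A` of weight `d`, for the outer bimodule structure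
`a · (u ⊗ v) · b = au ⊗ vb`: they satisfy `Θ(ab) = Θ(a) b + (-1)^(d|a|) a Θ(b)`.
The graded bimodule of all double derivations is `⨁ d : ℤ, DDerGr 𝒜 ρ d`. -/
def DDerGr (d : ℤ) : Submodule k (A →ₗ[k] A ⊗[k] A) where
  carrier := {Θ | (∀ r, Θ (ρ r) = 0) ∧
    (∀ (i : ℕ), ∀ a ∈ 𝒜 i, Θ a ∈ tensorPart 𝒜 (i + d)) ∧
    ∀ (i : ℕ), ∀ a ∈ 𝒜 i, ∀ b, Θ (a * b) =
      Θ a * (1 ⊗ₜ b) + sgn k (d * i) • ((a ⊗ₜ 1) * Θ b)}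
  zero_mem' := ⟨by simp, by simp, by simp⟩
  add_mem' := by
    rintro Θ Δ ⟨h1, h2, h3⟩ ⟨g1, g2, g3⟩
    refine ⟨fun r => by simp [h1, g1], fun i a ha => Submodule.add_mem _ (h2 i a ha) (g2 i a ha),
      fun i a ha b => ?_⟩
    simp only [LinearMap.add_apply, h3 i a ha, g3 i a ha, add_mul, mul_add, smul_add]
    abel
  smul_mem' := by
    rintro c Θ ⟨h1, h2, h3⟩
    refine ⟨fun r => by simp [h1], fun i a ha => Submodule.smul_mem _ _ (h2 i a ha),
      fun i a ha b => ?_⟩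
    simp only [LinearMap.smul_apply, h3 i a ha, smul_add, smul_mul_assoc, mul_smul_comm]
    rw [smul_comm c]

theorem DDerGr.map_mul {d : ℤ} {Θ : A →ₗ[k] A ⊗[k] A} (h : Θ ∈ DDerGr 𝒜 ρ d) (a b : A) :
    Θ (a * b) = (signAut 𝒜 d a ⊗ₜ 1) * Θ b + Θ a * (1 ⊗ₜ b) := by
  induction a using graded_induction 𝒜 with
  | h i a ha =>
    rw [h.2.2 i a ha, signAut_of_mem 𝒜 d ha, ← TensorProduct.smul_tmul', smul_mul_assoc, add_comm]
  | hadd x y hx hy => simp only [add_mul, map_add, hx, hy, TensorProduct.add_tmul]; abel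

end Graded

section Forms
variable {k : Type*} [Field k] {R A : Type*} [Ring R] [Algebra k R] [Ring A] [Algebra k A]
  (ρ : R →ₐ[k] A)

/-- The algebra `Ω_R A = T_A (Ω¹_R A)` of noncommutative differential forms. -/
abbrev Forms := TensorAlg k A (Omega1 ρ)

namespace Forms

/-- Functions as forms of degree `0`. -/
noncomputable abbrev base : A →ₐ[k] Forms ρ := TensorAlg.base k (Omega1 ρ)

/-- The exact form `d a` of degree `1`. -/
noncomputable def D : A →ₗ[k] Forms ρ := TensorAlg.gen k ∘ₗ Omega1.D ρ

theorem gen_env (a b : A) (x : Omega1 ρ) :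
    TensorAlg.gen k (env k a b • x) = base ρ a * TensorAlg.gen k x * base ρ b :=
  TensorAlg.gen_env_smul k a b x

theorem D_mul (a b : A) : D ρ (a * b) = base ρ a * D ρ b + D ρ a * base ρ b := by
  simp [D, Omega1.D_mul, gen_env, add_comm]

@[simp] theorem D_base (r : R) : D ρ (ρ r) = 0 := by simp [D, Omega1.D_base]

theorem induction {P : Forms ρ → Prop} (hb : ∀ a, P (base ρ a)) (hD : ∀ a, P (D ρ a))
    (hadd : ∀ x y, P x → P y → P (x + y)) (hmul : ∀ x y, P x → P y → P (x * y))
    (x : Forms ρ) : P x := by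
  refine TensorAlg.induction hb (fun m => ?_) hadd hmul x
  have hm : m ∈ Submodule.span (Env k A) (Set.range (Omega1.D ρ)) := by
    rw [Omega1.span_D]; trivial
  induction hm using Submodule.span_induction with
  | mem x hx => obtain ⟨a, rfl⟩ := hx; exact hD a
  | zero => simpa using hb 0
  | add x y _ _ hx hy => rw [map_add]; exact hadd _ _ hx hy
  | smul e x _ hx =>
    induction e using env_induction with
    | h a b => rw [gen_env]; exact hmul _ _ (hmul _ _ (hb a) hx) (hb b)
    | hadd e e' h h' => rw [add_smul, map_add]; exact hadd _ _ h h'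

section lift
variable {ρ} {C : Type*} [Ring C] [Algebra k C] (f : A →ₐ[k] C) (δ : A →ₗ[k] C)
  (hmul : ∀ a b, δ (a * b) = f a * δ b + δ a * f b) (hR : ∀ r, δ (ρ r) = 0)

/-- The universal property of `Ω_R A`: an algebra map `f` on `A` and an `f`-derivation `δ` that vanishes
on `R`. -/
noncomputable def lift : Forms ρ →ₐ[k] C :=
  TensorAlg.lift f
    (Omega1.lift ρ (sandwich f) δ (fun a b => by simp [hmul, add_comm]) hR)
    (fun a b x => by rw [Omega1.lift_smul, sandwich_apply])

@[simp] theorem lift_base (a : A) : lift f δ hmul hR (base ρ a) = f a := by simp [lift]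
@[simp] theorem lift_D (a : A) : lift f δ hmul hR (D ρ a) = δ a := by simp [lift, D]
end lift

theorem algHom_ext {C : Type*} [Ring C] [Algebra k C] {f g : Forms ρ →ₐ[k] C}
    (hb : ∀ a, f (base ρ a) = g (base ρ a)) (hD : ∀ a, f (D ρ a) = g (D ρ a)) : f = g := by
  ext x
  induction x using induction ρ with
  | hb a => exact hb a
  | hD a => exact hD a
  | hadd x y hx hy => rw [map_add, map_add, hx, hy]
  | hmul x y hx hy => rw [map_mul, map_mul, hx, hy]

section deriv
variable {ρ} {C : Type*} [Ring C] [Algebra k C] (p q : Forms ρ →ₐ[k] C) (δ₀ δ₁ : A →ₗ[k] C)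
  (h₀ : ∀ a b, δ₀ (a * b) = p (base ρ a) * δ₀ b + δ₀ a * q (base ρ b))
  (h₁ : ∀ a b, δ₁ (a * b) = p (base ρ a) * δ₁ b + δ₀ a * q (D ρ b)
    + (p (D ρ a) * δ₀ b + δ₁ a * q (base ρ b)))
  (hR : ∀ r, δ₁ (ρ r) = 0)

/-- Upper triangular matrices, which turn derivations into algebra maps. -/
noncomputable def tri (x y z : C) : Matrix (Fin 2) (Fin 2) C := !![x, y; 0, z]

theorem tri_mul (x y z x' y' z' : C) :
    tri x y z * tri x' y' z' = tri (x * x') (x * y' + y * z') (z * z') := by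
  simp [tri]

theorem tri_add (x y z x' y' z' : C) :
    tri x y z + tri x' y' z' = tri (x + x') (y + y') (z + z') := by
  ext i j; fin_cases i <;> fin_cases j <;> simp [tri]

noncomputable def triLin {X : Type*} [AddCommGroup X] [Module k X] (x y z : X →ₗ[k] C) :
    X →ₗ[k] Matrix (Fin 2) (Fin 2) C where
  toFun a := tri (x a) (y a) (z a)
  map_add' a b := by ext i j; fin_cases i <;> fin_cases j <;> simp [tri]
  map_smul' c a := by ext i j; fin_cases i <;> fin_cases j <;> simp [tri]

theorem δ₀_one (h₀ : ∀ a b, δ₀ (a * b) = p (base ρ a) * δ₀ b + δ₀ a * q (base ρ b)) :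
    δ₀ 1 = 0 := by
  have := h₀ 1 1
  simpa using this

noncomputable def derivAux : Forms ρ →ₐ[k] Matrix (Fin 2) (Fin 2) C :=
  lift
    (AlgHom.ofLinearMap (triLin (p.comp (base ρ)).toLinearMap δ₀ (q.comp (base ρ)).toLinearMap)
      (by
        have := δ₀_one p q δ₀ h₀
        simp [triLin, tri, this, Matrix.one_fin_two])
      (fun a b => by simp [triLin, tri_mul, h₀]))
    (triLin (p.toLinearMap ∘ₗ D ρ) δ₁ (q.toLinearMap ∘ₗ D ρ))
    (fun a b => by simp [triLin, tri_mul, tri_add, h₁, D_mul])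
    (fun r => by simp [triLin, hR, tri, ← Matrix.ext_iff])

theorem derivAux_eq (x : Forms ρ) : derivAux p q δ₀ δ₁ h₀ h₁ hR x
    = tri (p x) (derivAux p q δ₀ δ₁ h₀ h₁ hR x 0 1) (q x) := by
  induction x using induction ρ with
  | hb a => simp [derivAux, triLin, tri]
  | hD a => simp [derivAux, triLin, tri]
  | hadd x y hx hy => rw [map_add, hx, hy, tri_add]; simp [tri]
  | hmul x y hx hy => rw [map_mul, hx, hy, tri_mul]; simp [tri]

/-- The unique linear map `D` with `D (x * y) = p x * D y + D x * q y` and prescribed values on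
functions `a` and on exact forms `d a`. -/
noncomputable def deriv : Forms ρ →ₗ[k] C where
  toFun x := derivAux p q δ₀ δ₁ h₀ h₁ hR x 0 1
  map_add' x y := by simp
  map_smul' c x := by simp

@[simp] theorem deriv_base (a : A) : deriv p q δ₀ δ₁ h₀ h₁ hR (base ρ a) = δ₀ a := by
  simp [deriv, derivAux, triLin, tri]

@[simp] theorem deriv_D (a : A) : deriv p q δ₀ δ₁ h₀ h₁ hR (D ρ a) = δ₁ a := by
  simp [deriv, derivAux, triLin, tri]

theorem deriv_mul (x y : Forms ρ) : deriv p q δ₀ δ₁ h₀ h₁ hR (x * y) =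
    p x * deriv p q δ₀ δ₁ h₀ h₁ hR y + deriv p q δ₀ δ₁ h₀ h₁ hR x * q y := by
  change derivAux p q δ₀ δ₁ h₀ h₁ hR (x * y) 0 1 = _
  rw [map_mul, derivAux_eq, derivAux_eq (x := y), tri_mul]
  rfl

end deriv

end Forms
end Forms

section Calculus
variable {k : Type*} [Field k] {R A : Type*} [Ring R] [Algebra k R] [Ring A] [Algebra k A]
  (ρ : R →ₐ[k] A) (𝒜 : ℕ → Submodule k A)

namespace Forms

/-- The differential of `Ω_R A`: `d (x y) = (-1)^‖x‖ x dy + dx y`, with `d (d a) = 0`. -/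
noncomputable def diff : Forms ρ →ₗ[k] Forms ρ :=
  deriv (lift (base ρ) (-D ρ) (fun a b => by simp [D_mul]; abel) (by simp)) (AlgHom.id k _)
    (D ρ) 0 (fun a b => by simp [D_mul]) (fun a b => by simp) (by simp)

/-- The automorphism `x ↦ (-1)^‖x‖ x`, where `‖x‖` is the form degree. -/
noncomputable def formAut : Forms ρ →ₐ[k] Forms ρ :=
  lift (base ρ) (-D ρ) (fun a b => by simp [D_mul]; abel) (by simp)

/-- Products of functions `a` and exact forms `d a`, with `a` homogeneous, with their weight and their
form degree. -/
inductive IsHom : Forms ρ → ℕ → ℕ → Prop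
  | base {w : ℕ} {a : A} (h : a ∈ 𝒜 w) : IsHom (base ρ a) w 0
  | D {w : ℕ} {a : A} (h : a ∈ 𝒜 w) : IsHom (D ρ a) w 1
  | mul {x y : Forms ρ} {w p w' p' : ℕ} (hx : IsHom x w p) (hy : IsHom y w' p') :
      IsHom (x * y) (w + w') (p + p')

/-- The forms of weight `w` and form degree `p`. -/
noncomputable def part (w p : ℕ) : Submodule k (Forms ρ) := Submodule.span k {x | IsHom ρ 𝒜 x w p}

/-- The span of the bigraded commutators `xy - (-1)^(|x||y| + ‖x‖‖y‖) yx`. -/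
noncomputable def commutators : Submodule k (Forms ρ) :=
  Submodule.span k {z | ∃ (w p w' p' : ℕ) (x y : Forms ρ), x ∈ part ρ 𝒜 w p ∧ y ∈ part ρ 𝒜 w' p' ∧
    z = x * y - sgn k (w * w' + p * p') • (y * x)}

variable {ρ 𝒜}

theorem part_mul {w p w' p' : ℕ} {x y : Forms ρ} (hx : x ∈ part ρ 𝒜 w p)
    (hy : y ∈ part ρ 𝒜 w' p') : x * y ∈ part ρ 𝒜 (w + w') (p + p') := by
  have := Submodule.mul_mem_mul hx hy
  rw [part, part, Submodule.span_mul_span] at this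
  refine Submodule.span_mono ?_ this
  rintro _ ⟨x, hx, y, hy, rfl⟩
  exact IsHom.mul hx hy

theorem formAut_of_mem {w p : ℕ} {x : Forms ρ} (h : x ∈ part ρ 𝒜 w p) :
    formAut ρ x = sgn k p • x := by
  induction h using Submodule.span_induction with
  | zero => simp
  | add x y _ _ hx hy => rw [map_add, hx, hy, smul_add]
  | smul c x _ hx => rw [map_smul, hx, smul_comm]
  | mem x h =>
    induction h with
    | base h => simp [formAut, sgn]
    | D h => simp [formAut, sgn]
    | mul _ _ hx hy => rw [map_mul, hx, hy, smul_mul_smul_comm, Nat.cast_add, sgn_add]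

variable (ρ) in
theorem diff_mul (x y : Forms ρ) : diff ρ (x * y) = formAut ρ x * diff ρ y + diff ρ x * y :=
  deriv_mul ..

variable (ρ) in
@[simp] theorem diff_base (a : A) : diff ρ (base ρ a) = D ρ a := deriv_base ..

variable (ρ) in
@[simp] theorem diff_D (a : A) : diff ρ (D ρ a) = 0 := deriv_D ..

theorem diff_mem {w p : ℕ} {x : Forms ρ} (h : x ∈ part ρ 𝒜 w p) :
    diff ρ x ∈ part ρ 𝒜 w (p + 1) := by
  induction h using Submodule.span_induction with
  | zero => simp
  | add x y _ _ hx hy => rw [map_add]; exact Submodule.add_mem _ hx hy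
  | smul c x _ hx => rw [map_smul]; exact Submodule.smul_mem _ _ hx
  | mem x h =>
    induction h with
    | base h => rw [diff_base]; exact Submodule.subset_span (.D h)
    | D h => simp
    | @mul x y w p w' p' hx hy ix iy =>
      rw [diff_mul, formAut_of_mem (Submodule.subset_span hx), smul_mul_assoc]
      refine Submodule.add_mem _ (Submodule.smul_mem _ _ ?_) ?_
      · have := part_mul (Submodule.subset_span hx : x ∈ part ρ 𝒜 w p) iy
        exact this
      · have := part_mul ix (Submodule.subset_span hy : y ∈ part ρ 𝒜 w' p')
        rwa [add_right_comm] at this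

variable (ρ 𝒜) in
theorem diff_commutators : commutators ρ 𝒜 ≤ (commutators ρ 𝒜).comap (diff ρ) := by
  refine Submodule.span_le.2 ?_
  rintro _ ⟨w, p, w', p', x, y, hx, hy, rfl⟩
  have e1 : diff ρ x * y - sgn k (w * w' + (p + 1 : ℕ) * p') • (y * diff ρ x) ∈ commutators ρ 𝒜 :=
    Submodule.subset_span ⟨_, _, _, _, _, _, diff_mem hx, hy, rfl⟩
  have e2 : x * diff ρ y - sgn k (w * w' + p * (p' + 1 : ℕ)) • (diff ρ y * x) ∈ commutators ρ 𝒜 :=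
    Submodule.subset_span ⟨_, _, _, _, _, _, hx, diff_mem hy, rfl⟩
  have := Submodule.add_mem _ e1 (Submodule.smul_mem _ (sgn k p) e2)
  change diff ρ _ ∈ commutators ρ 𝒜
  convert this using 1
  rw [map_sub, map_smul, diff_mul, diff_mul, formAut_of_mem hx, formAut_of_mem hy]
  have s1 : sgn k (w * w' + (p + 1 : ℕ) * p') = sgn k (w * w' + p * p') * sgn k p' := by
    rw [← sgn_add]; congr 1; push_cast; ring
  have s2 : sgn k p * sgn k (w * w' + p * (p' + 1 : ℕ)) = sgn k (w * w' + p * p') := by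
    rw [← sgn_add]; apply sgn_eq_of_even; exact ⟨p, by push_cast; ring⟩
  rw [s1, smul_sub, smul_smul, s2, smul_add, smul_mul_assoc, smul_mul_assoc, smul_smul]
  abel

variable (ρ 𝒜) in
/-- Elements of `Ω ⊗ Ω` of given total weight and total form degree. -/
noncomputable def tpart (w p : ℤ) : Submodule k (Forms ρ ⊗[k] Forms ρ) :=
  Submodule.span k {z | ∃ (w₁ p₁ w₂ p₂ : ℕ) (x y : Forms ρ), x ∈ part ρ 𝒜 w₁ p₁ ∧
    y ∈ part ρ 𝒜 w₂ p₂ ∧ (w₁ + w₂ : ℤ) = w ∧ (p₁ + p₂ : ℤ) = p ∧ z = x ⊗ₜ y}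

theorem tpart_mul_right {w p : ℤ} {w' p' : ℕ} {z : Forms ρ ⊗[k] Forms ρ} {y : Forms ρ}
    (hz : z ∈ tpart ρ 𝒜 w p) (hy : y ∈ part ρ 𝒜 w' p') :
    z * (1 ⊗ₜ y) ∈ tpart ρ 𝒜 (w + w') (p + p') := by
  induction hz using Submodule.span_induction with
  | zero => simp
  | add x y _ _ hx hy => rw [add_mul]; exact Submodule.add_mem _ hx hy
  | smul c x _ hx => rw [smul_mul_assoc]; exact Submodule.smul_mem _ _ hx
  | mem z h =>
    obtain ⟨w₁, p₁, w₂, p₂, u, v, hu, hv, rfl, rfl, rfl⟩ := h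
    exact Submodule.subset_span ⟨w₁, p₁, _, _, u, v * y, hu, part_mul hv hy, by push_cast; ring,
      by push_cast; ring, by simp⟩

theorem tpart_mul_left {w p : ℤ} {w' p' : ℕ} {z : Forms ρ ⊗[k] Forms ρ} {y : Forms ρ}
    (hz : z ∈ tpart ρ 𝒜 w p) (hy : y ∈ part ρ 𝒜 w' p') :
    (y ⊗ₜ 1) * z ∈ tpart ρ 𝒜 (w + w') (p + p') := by
  induction hz using Submodule.span_induction with
  | zero => simp
  | add x y _ _ hx hy => rw [mul_add]; exact Submodule.add_mem _ hx hy
  | smul c x _ hx => rw [mul_smul_comm]; exact Submodule.smul_mem _ _ hx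
  | mem z h =>
    obtain ⟨w₁, p₁, w₂, p₂, u, v, hu, hv, rfl, rfl, rfl⟩ := h
    exact Submodule.subset_span ⟨_, _, w₂, p₂, y * u, v, part_mul hy hu, hv, by push_cast; ring,
      by push_cast; ring, by simp⟩

end Forms

variable [GradedAlgebra 𝒜]

namespace Forms
section
variable [IsGradedOver 𝒜 ρ]

/-- The automorphism `x ↦ (-1)^(d|x|) x`, where `|x|` is the weight. -/
noncomputable def weightAut (d : ℤ) : Forms ρ →ₐ[k] Forms ρ :=
  lift ((base ρ).comp (signAut 𝒜 d)) (D ρ ∘ₗ (signAut 𝒜 d).toLinearMap)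
    (fun a b => by simp [D_mul])
    (fun r => by
      have h := signAut_of_mem 𝒜 d (IsGradedOver.map_mem (𝒜 := 𝒜) (ρ := ρ) r)
      simp at h
      simp [h])

theorem weightAut_base (d : ℤ) (a : A) :
    weightAut ρ 𝒜 d (base ρ a) = base ρ (signAut 𝒜 d a) := lift_base ..

theorem weightAut_D (d : ℤ) (a : A) : weightAut ρ 𝒜 d (D ρ a) = D ρ (signAut 𝒜 d a) := lift_D ..

variable {ρ 𝒜}

theorem weightAut_of_mem (d : ℤ) {w p : ℕ} {x : Forms ρ} (h : x ∈ part ρ 𝒜 w p) :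
    weightAut ρ 𝒜 d x = sgn k (d * w) • x := by
  induction h using Submodule.span_induction with
  | zero => simp
  | add x y _ _ hx hy => rw [map_add, hx, hy, smul_add]
  | smul c x _ hx => rw [map_smul, hx, smul_comm]
  | mem x h =>
    induction h with
    | base h => simp [weightAut_base, signAut_of_mem 𝒜 d h]
    | D h => simp [weightAut_D, signAut_of_mem 𝒜 d h]
    | mul _ _ hx hy => rw [map_mul, hx, hy, smul_mul_smul_comm, Nat.cast_add, mul_add, sgn_add]

variable (ρ 𝒜)

/-- The map `x ⊗ y ↦ (-1)^(|x||y| + ‖x‖‖y‖) y x`; see `circ_tmul`. -/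
noncomputable def circ : Forms ρ ⊗[k] Forms ρ →ₗ[k] Forms ρ :=
  LinearMap.mul' k (Forms ρ) ∘ₗ (TensorProduct.comm k (Forms ρ) (Forms ρ)).toLinearMap ∘ₗ
    koszul (weightAut ρ 𝒜 1) ∘ₗ koszul (formAut ρ)

variable {ρ 𝒜} in
theorem circ_tmul [CharZero k] {w p w' p' : ℕ} {x y : Forms ρ} (hx : x ∈ part ρ 𝒜 w p)
    (hy : y ∈ part ρ 𝒜 w' p') : circ ρ 𝒜 (x ⊗ₜ y) = sgn k (w * w' + p * p') • (y * x) := by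
  rw [circ, LinearMap.comp_apply, LinearMap.comp_apply, LinearMap.comp_apply,
    koszul_tmul _ (formAut_of_mem hx) (formAut_of_mem hy), map_smul,
    koszul_tmul _ (i := w) (j := w') (by simpa using weightAut_of_mem 1 hx)
      (by simpa using weightAut_of_mem 1 hy), smul_smul, ← sgn_add, add_comm]
  simp

/-- The contraction `i_Θ` with a double derivation of weight `d`: the double derivation of `Ω_R A` of
bidegree `(d, -1)` with `i_Θ a = 0` and `i_Θ (d a) = Θ a`; see `contract_mul_of_mem`. -/
noncomputable def contract (d : ℤ) (Θ : DDerGr 𝒜 ρ d) : Forms ρ →ₗ[k] Forms ρ ⊗[k] Forms ρ :=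
  deriv (C := Forms ρ ⊗[k] Forms ρ)
    (Algebra.TensorProduct.includeLeft.comp ((formAut ρ).comp (weightAut ρ 𝒜 d)))
    Algebra.TensorProduct.includeRight 0
    (TensorProduct.map (base ρ).toLinearMap (base ρ).toLinearMap ∘ₗ (Θ : A →ₗ[k] A ⊗[k] A))
    (fun a b => by simp)
    (fun a b => by
      have hm : ∀ z z' : A ⊗[k] A, TensorProduct.map (base ρ).toLinearMap (base ρ).toLinearMap
          (z * z') = TensorProduct.map (base ρ).toLinearMap (base ρ).toLinearMap z *
            TensorProduct.map (base ρ).toLinearMap (base ρ).toLinearMap z' :=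
        fun z z' => (Algebra.TensorProduct.map (base ρ) (base ρ)).map_mul z z'
      simp [DDerGr.map_mul 𝒜 ρ Θ.2, hm, weightAut_base, weightAut_D, formAut])
    (fun r => by simp [Θ.2.1 r])

variable {ρ 𝒜}

theorem contract_base (d : ℤ) (Θ : DDerGr 𝒜 ρ d) (a : A) : contract ρ 𝒜 d Θ (base ρ a) = 0 :=
  deriv_base ..

theorem contract_D (d : ℤ) (Θ : DDerGr 𝒜 ρ d) (a : A) : contract ρ 𝒜 d Θ (D ρ a) =
    TensorProduct.map (base ρ).toLinearMap (base ρ).toLinearMap (Θ.1 a) :=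
  deriv_D ..

theorem contract_mul (d : ℤ) (Θ : DDerGr 𝒜 ρ d) (x y : Forms ρ) : contract ρ 𝒜 d Θ (x * y) =
    (formAut ρ (weightAut ρ 𝒜 d x) ⊗ₜ 1) * contract ρ 𝒜 d Θ y + contract ρ 𝒜 d Θ x * (1 ⊗ₜ y) :=
  deriv_mul ..

theorem contract_mul_of_mem (d : ℤ) (Θ : DDerGr 𝒜 ρ d) {w p : ℕ} {x : Forms ρ}
    (hx : x ∈ part ρ 𝒜 w p) (y : Forms ρ) : contract ρ 𝒜 d Θ (x * y) =
    contract ρ 𝒜 d Θ x * (1 ⊗ₜ y) + sgn k (d * w + p) • ((x ⊗ₜ 1) * contract ρ 𝒜 d Θ y) := by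
  rw [contract_mul, weightAut_of_mem d hx, map_smul, formAut_of_mem hx, smul_smul,
    ← TensorProduct.smul_tmul', smul_mul_assoc, ← sgn_add, add_comm]

theorem contract_add (d : ℤ) (Θ Δ : DDerGr 𝒜 ρ d) :
    contract ρ 𝒜 d (Θ + Δ) = contract ρ 𝒜 d Θ + contract ρ 𝒜 d Δ := by
  ext x
  induction x using induction ρ with
  | hb a => simp [contract_base]
  | hD a => simp [contract_D]
  | hadd x y hx hy => rw [map_add, map_add, hx, hy]
  | hmul x y hx hy =>
    simp only [LinearMap.add_apply] at *
    simp only [contract_mul, hx, hy, mul_add, add_mul]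
    abel

theorem contract_smul (d : ℤ) (c : k) (Θ : DDerGr 𝒜 ρ d) :
    contract ρ 𝒜 d (c • Θ) = c • contract ρ 𝒜 d Θ := by
  ext x
  induction x using induction ρ with
  | hb a => simp [contract_base]
  | hD a => simp [contract_D]
  | hadd x y hx hy => rw [map_add, map_add, hx, hy]
  | hmul x y hx hy =>
    simp only [LinearMap.smul_apply] at *
    simp only [contract_mul, hx, hy, mul_smul_comm, smul_mul_assoc, smul_add]

theorem contract_mem (d : ℤ) (Θ : DDerGr 𝒜 ρ d) {w p : ℕ} {x : Forms ρ}
    (h : x ∈ part ρ 𝒜 w p) : contract ρ 𝒜 d Θ x ∈ tpart ρ 𝒜 (w + d) (p - 1) := by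
  induction h using Submodule.span_induction with
  | zero => simp
  | add x y _ _ hx hy => rw [map_add]; exact Submodule.add_mem _ hx hy
  | smul c x _ hx => rw [map_smul]; exact Submodule.smul_mem _ _ hx
  | mem x h =>
    induction h with
    | base h => simp [contract_base]
    | @D w a h =>
      rw [contract_D]
      have := Θ.2.2.1 w a h
      generalize Θ.1 a = t at this
      induction this using Submodule.span_induction with
      | zero => simp
      | add x y _ _ hx hy => rw [map_add]; exact Submodule.add_mem _ hx hy
      | smul c x _ hx => rw [map_smul]; exact Submodule.smul_mem _ _ hx
      | mem x h =>
        obtain ⟨p, q, u, v, hu, hv, e, rfl⟩ := h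
        exact Submodule.subset_span ⟨p, 0, q, 0, base ρ u, base ρ v,
          Submodule.subset_span (.base hu), Submodule.subset_span (.base hv), e, by simp, by simp⟩
    | @mul x y w p w' p' hx hy ix iy =>
      rw [contract_mul_of_mem d Θ (Submodule.subset_span hx)]
      refine Submodule.add_mem _ ?_ (Submodule.smul_mem _ _ ?_)
      · have := tpart_mul_right ix (Submodule.subset_span hy : y ∈ part ρ 𝒜 w' p')
        rwa [show ((w + w' : ℕ) : ℤ) + d = w + d + w' by push_cast; ring,
          show ((p + p' : ℕ) : ℤ) - 1 = p - 1 + p' by push_cast; ring]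
      · have := tpart_mul_left iy (Submodule.subset_span hx : x ∈ part ρ 𝒜 w p)
        rwa [show ((w + w' : ℕ) : ℤ) + d = w' + d + w by push_cast; ring,
          show ((p + p' : ℕ) : ℤ) - 1 = p' - 1 + p by push_cast; ring]

theorem circ_mul_comm [CharZero k] {w p : ℤ} {w' p' : ℕ} {z : Forms ρ ⊗[k] Forms ρ} {y : Forms ρ}
    (hz : z ∈ tpart ρ 𝒜 w p) (hy : y ∈ part ρ 𝒜 w' p') :
    circ ρ 𝒜 (z * (1 ⊗ₜ y)) = sgn k (w * w' + p * p') • circ ρ 𝒜 ((y ⊗ₜ 1) * z) := by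
  induction hz using Submodule.span_induction with
  | zero => simp
  | add x y _ _ hx hy => rw [mul_add, add_mul, map_add, map_add, hx, hy, smul_add]
  | smul c x _ hx => rw [smul_mul_assoc, mul_smul_comm, map_smul, map_smul, hx, smul_comm]
  | mem z h =>
    obtain ⟨w₁, p₁, w₂, p₂, u, v, hu, hv, rfl, rfl, rfl⟩ := h
    rw [Algebra.TensorProduct.tmul_mul_tmul, Algebra.TensorProduct.tmul_mul_tmul, mul_one, one_mul,
      circ_tmul hu (part_mul hv hy), circ_tmul (part_mul hy hu) hv, smul_smul, ← sgn_add, mul_assoc]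
    congr 1
    apply sgn_eq_of_even
    exact ⟨-(w₂ * w') - (p₂ * p'), by push_cast; ring⟩

theorem circ_contract_commutators [CharZero k] (d : ℤ) (Θ : DDerGr 𝒜 ρ d) :
    commutators ρ 𝒜 ≤ LinearMap.ker (circ ρ 𝒜 ∘ₗ contract ρ 𝒜 d Θ) := by
  refine Submodule.span_le.2 ?_
  rintro _ ⟨w, p, w', p', x, y, hx, hy, rfl⟩
  rw [SetLike.mem_coe, LinearMap.mem_ker, LinearMap.comp_apply, map_sub, map_smul,
    contract_mul_of_mem d Θ hx, contract_mul_of_mem d Θ hy, map_sub, map_smul, map_add, map_add,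
    map_smul, map_smul, circ_mul_comm (contract_mem d Θ hx) hy,
    circ_mul_comm (contract_mem d Θ hy) hx, smul_add, smul_smul, smul_smul, ← sgn_add, ← sgn_add]
  have s1 : sgn k ((w + d) * w' + (p - 1) * p') = sgn k (w * w' + p * p' + (d * w' + p')) :=
    sgn_eq_of_even k ⟨-p', by ring⟩
  have s2 : sgn k (w * w' + p * p' + ((w' + d) * w + (p' - 1) * p)) = sgn k (d * w + p) :=
    sgn_eq_of_even k ⟨w * w' + p * p' - p, by ring⟩
  rw [s1, s2]
  abel

end
end Forms

variable (𝒜' : ℕ → Submodule k A)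
/-- The Karoubi-de Rham complex `Ω_R A / [Ω_R A, Ω_R A]`. -/
abbrev DR := Forms ρ ⧸ Forms.commutators ρ 𝒜'

namespace DR

/-- The part of `DR` of weight `w` and form degree `p`. -/
noncomputable def part (w p : ℕ) : Submodule k (DR ρ 𝒜') := (Forms.part ρ 𝒜' w p).map (Submodule.mkQ _)

/-- The differential of `DR`. -/
noncomputable def diff : DR ρ 𝒜' →ₗ[k] DR ρ 𝒜' :=
  Submodule.mapQ _ _ (Forms.diff ρ) (Forms.diff_commutators ρ 𝒜')

variable [CharZero k] [IsGradedOver 𝒜 ρ]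

/-- The reduced contraction `ω ↦ °(i_Θ ω)`, as a map `DR → Ω_R A`. -/
noncomputable def contract (d : ℤ) (Θ : DDerGr 𝒜 ρ d) : DR ρ 𝒜 →ₗ[k] Forms ρ :=
  Submodule.liftQ _ (Forms.circ ρ 𝒜 ∘ₗ Forms.contract ρ 𝒜 d Θ)
    (Forms.circ_contract_commutators d Θ)

end DR
end Calculus


section ToGen
variable {k : Type*} [Field k] {B : Type*} [Ring B] [Algebra k B]
  {M : Type*} [AddCommGroup M] [Module k M] [Module (Env k B) M] [IsScalarTower k (Env k B) M]

variable (k B) in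
noncomputable def envLeft : B →ₗ[k] Env k B :=
  (Algebra.TensorProduct.includeLeft (R := k) (S := k) (A := B) (B := Bᵐᵒᵖ)).toLinearMap

variable (k B) in
noncomputable def envRight : B →ₗ[k] Env k B :=
  (Algebra.TensorProduct.includeRight (R := k) (A := B) (B := Bᵐᵒᵖ)).toLinearMap ∘ₗ
    (opLinearEquiv k).toLinearMap

theorem envLeft_apply (b : B) : envLeft k B b = env k b 1 := rfl
theorem envRight_apply (b : B) : envRight k B b = env k 1 b := rfl

namespace TensorAlg

noncomputable def truncBase : B →ₐ[k] Module.End k (B × M) :=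
  AlgHom.ofLinearMap
    { toFun := fun b => LinearMap.prodMap (LinearMap.mulLeft k b) (Algebra.lsmul k k M (env k b 1))
      map_add' := fun b b' => by
        ext x <;> simp [← envLeft_apply, add_mul]
      map_smul' := fun c b => by
        ext x <;> simp [← envLeft_apply] }
    (by ext x <;> simp [env_one])
    (fun b b' => by ext x <;> simp [← mul_smul, env_mul])

noncomputable def truncGen : M →ₗ[k] Module.End k (B × M) where
  toFun m := LinearMap.inr k B M ∘ₗ (Algebra.lsmul k k M).toLinearMap.flip m ∘ₗ envRight k B ∘ₗ
    LinearMap.fst k B M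
  map_add' m m' := by ext x <;> simp
  map_smul' c m := by ext x <;> simp

/-- The action of the tensor algebra by left multiplication on its truncation `B ⊕ M`. -/
noncomputable def trunc : TensorAlg k B M →ₐ[k] Module.End k (B × M) :=
  lift truncBase truncGen (fun b b' m => by
    ext x <;> simp [truncBase, truncGen, ← mul_smul, env_mul, envRight_apply])

/-- The component in `M` of an element of the tensor algebra. -/
noncomputable def toGen : TensorAlg k B M →ₗ[k] M where
  toFun t := (trunc t (1, 0)).2
  map_add' x y := by simp
  map_smul' c x := by simp

@[simp] theorem toGen_gen (m : M) : toGen (gen k m : TensorAlg k B M) = m := by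
  simp [toGen, trunc, truncGen, envRight_apply, env_one]

end TensorAlg
end ToGen

section BiSymplectic
variable {k : Type*} [Field k] [CharZero k] {R A : Type*} [Ring R] [Algebra k R] [Ring A]
  [Algebra k A] (ρ : R →ₐ[k] A) (𝒜 : ℕ → Submodule k A) [GradedAlgebra 𝒜] [IsGradedOver 𝒜 ρ]

/-- The map `ι(ω) : Θ ↦ ι_Θ ω` from double derivations to 1-forms, for `ω` in `DR` of form degree `2`.
(The reduced contraction then has form degree `1`, and `toGen` reads it as an element of `Ω¹_R A`.)
When `ω` has weight `N`, it raises weights by `N` and satisfies `ι_(aΘb) ω = (-1)^(N|b|) a (ι_Θ ω) b`: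
it is a morphism of graded bimodules once the target is shifted by `N`. -/
noncomputable def iota (ω : DR ρ 𝒜) : (⨁ d : ℤ, DDerGr 𝒜 ρ d) →ₗ[k] Omega1 ρ :=
  DirectSum.toModule k ℤ _ fun d =>
    { toFun := fun Θ => TensorAlg.toGen (DR.contract ρ 𝒜 d Θ ω)
      map_add' := fun Θ Δ => by
        obtain ⟨η, rfl⟩ := Submodule.Quotient.mk_surjective _ ω
        change TensorAlg.toGen (Forms.circ ρ 𝒜 (Forms.contract ρ 𝒜 d _ η)) =
          TensorAlg.toGen (Forms.circ ρ 𝒜 (Forms.contract ρ 𝒜 d _ η)) +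
          TensorAlg.toGen (Forms.circ ρ 𝒜 (Forms.contract ρ 𝒜 d _ η))
        rw [Forms.contract_add, LinearMap.add_apply, map_add, map_add]
      map_smul' := fun c Θ => by
        obtain ⟨η, rfl⟩ := Submodule.Quotient.mk_surjective _ ω
        change TensorAlg.toGen (Forms.circ ρ 𝒜 (Forms.contract ρ 𝒜 d _ η)) =
          c • TensorAlg.toGen (Forms.circ ρ 𝒜 (Forms.contract ρ 𝒜 d _ η))
        rw [Forms.contract_smul, LinearMap.smul_apply, map_smul, map_smul] }

/-- `ω` is a bi-symplectic form of weight `N`: a closed element of `DR` of form degree `2` and weight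
`N` for which `ι(ω)` is an isomorphism. -/
structure IsBiSymplectic (N : ℕ) (ω : DR ρ 𝒜) : Prop where
  mem_part : ω ∈ DR.part ρ 𝒜 N 2
  closed : DR.diff ρ 𝒜 ω = 0
  bijective : Function.Bijective (iota ρ 𝒜 ω)

end BiSymplectic

section Smooth
variable {k : Type*} [Field k] {R B : Type*} [Ring R] [Algebra k R] [Ring B] [Algebra k B]
  (ρ : R →ₐ[k] B)

/-- `B` is smooth over `R`: it is finitely generated over `R` and `Ω¹_R B` is a projective bimodule. -/
structure IsSmooth : Prop where
  finite : ∃ s : Finset B, Algebra.adjoin k (Set.range ρ ∪ s) = ⊤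
  projective : Module.Projective (Env k B) (Omega1 ρ)

/-- The `R`-linear double derivations of an ungraded algebra `B`. -/
def dderSubmodule : Submodule k (B →ₗ[k] B ⊗[k] B) where
  carrier := {θ | (∀ r, θ (ρ r) = 0) ∧ ∀ a b, θ (a * b) = θ a * (1 ⊗ₜ b) + (a ⊗ₜ 1) * θ b}
  zero_mem' := ⟨by simp, by simp⟩
  add_mem' := by
    rintro θ η ⟨h1, h2⟩ ⟨g1, g2⟩
    refine ⟨fun r => by simp [h1, g1], fun a b => ?_⟩
    simp only [LinearMap.add_apply, h2, g2, add_mul, mul_add]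
    abel
  smul_mem' := by
    rintro c θ ⟨h1, h2⟩
    refine ⟨fun r => by simp [h1], fun a b => ?_⟩
    simp only [LinearMap.smul_apply, h2, smul_add, smul_mul_assoc, mul_smul_comm]

/-- The space of `R`-linear double derivations `B → B ⊗ B`. Its `B`-bimodule structure is induced by the
inner one on `B ⊗ B`, `b · (u ⊗ v) · b' = u b' ⊗ b v`. -/
def DDer : Type _ := dderSubmodule ρ

namespace DDer

instance : AddCommGroup (DDer ρ) := inferInstanceAs (AddCommGroup (dderSubmodule ρ))
instance : Module k (DDer ρ) := inferInstanceAs (Module k (dderSubmodule ρ))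

variable {ρ} in
def toLin : DDer ρ →ₗ[k] (B →ₗ[k] B ⊗[k] B) := (dderSubmodule ρ).subtype

theorem toLin_injective : Function.Injective (toLin (ρ := ρ)) := Subtype.val_injective

variable (k B) in
noncomputable def innerAct : Env k B →ₐ[k] Module.End k (B ⊗[k] B) :=
  Algebra.TensorProduct.lift (A := B) (B := Bᵐᵒᵖ)
    ((Algebra.lmul k (B ⊗[k] B)).comp Algebra.TensorProduct.includeRight)
    (AlgHom.ofLinearMap ((LinearMap.mul k (B ⊗[k] B)).flip ∘ₗ
      (Algebra.TensorProduct.includeLeft (R := k) (S := k) (A := B) (B := B)).toLinearMap ∘ₗ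
        (opLinearEquiv k).symm.toLinearMap)
      (by ext; simp) (by intro x y; ext; simp [mul_assoc]))
    (by intro x y; ext; simp)

theorem innerAct_env (a b : B) (z : B ⊗[k] B) :
    innerAct k B (env k a b) z = (1 ⊗ₜ a) * z * (b ⊗ₜ 1) := by
  refine (DFunLike.congr_fun (Algebra.TensorProduct.lift_tmul _ _ _ a (op b)) z).trans ?_
  simp [mul_assoc]

theorem innerAct_tmul (a b u v : B) :
    innerAct k B (env k a b) (u ⊗ₜ v) = (u * b) ⊗ₜ (a * v) := by
  simp [innerAct_env]

noncomputable instance : SMul (Env k B) (DDer ρ) where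
  smul e θ := ⟨innerAct k B e ∘ₗ θ.1, by
    obtain ⟨θ, h1, h2⟩ := θ
    refine ⟨fun r => by simp [h1], fun a b => ?_⟩
    have key : ∀ z z', innerAct k B e (z * (1 ⊗ₜ b) + (a ⊗ₜ 1) * z') =
        innerAct k B e z * (1 ⊗ₜ b) + (a ⊗ₜ 1) * innerAct k B e z' := by
      intro z z'
      induction e using env_induction with
      | h x y =>
        have c₁ : (1 ⊗ₜ[k] b : B ⊗[k] B) * (y ⊗ₜ 1) = (y ⊗ₜ 1) * (1 ⊗ₜ b) := by simp
        have c₂ : (1 ⊗ₜ[k] x : B ⊗[k] B) * (a ⊗ₜ 1) = (a ⊗ₜ 1) * (1 ⊗ₜ x) := by simp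
        rw [innerAct_env, innerAct_env, innerAct_env, mul_add, add_mul]
        congr 1
        · simp only [mul_assoc, c₁]
        · simp only [← mul_assoc, c₂]
      | hadd x y hx hy =>
        have e (t : B ⊗[k] B) : innerAct k B (x + y) t = innerAct k B x t + innerAct k B y t := by
          rw [map_add]; rfl
        rw [e, hx, hy, e, e, add_mul, mul_add]
        abel
    simp [h2, key]⟩

theorem toLin_smul (e : Env k B) (θ : DDer ρ) (c : B) :
    toLin (e • θ) c = innerAct k B e (toLin θ c) := rfl

noncomputable instance : Module (Env k B) (DDer ρ) where
  one_smul θ := toLin_injective ρ (by ext; simp [toLin_smul])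
  mul_smul x y θ := toLin_injective ρ (by ext; simp [toLin_smul])
  smul_zero e := toLin_injective ρ (by ext; simp [toLin_smul])
  smul_add e θ η := toLin_injective ρ (by ext; simp [toLin_smul])
  add_smul x y θ := toLin_injective ρ (by ext; simp [toLin_smul])
  zero_smul θ := toLin_injective ρ (by ext; simp [toLin_smul])

instance : IsScalarTower k (Env k B) (DDer ρ) :=
  ⟨fun c e θ => toLin_injective ρ (by ext; simp [toLin_smul])⟩

end DDer
end Smooth

section BiTensor
variable {k : Type*} [Field k] {B A : Type*} [Ring B] [Algebra k B] [Ring A] [Algebra k A]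
  (φ : B →ₐ[k] A) (X : Type*) [AddCommGroup X] [Module k X] [Module (Env k B) X]

noncomputable def BiTensor.rel : Submodule (Env k A) (Env k A ⊗[k] X) :=
  Submodule.span (Env k A) {z | ∃ (b b' : B) (x : X),
    z = env k (φ b) (φ b') ⊗ₜ x - 1 ⊗ₜ (env k b b' • x)}

/-- The `A`-bimodule `A ⊗_B X ⊗_B A`, for an algebra map `φ : B → A` and a `B`-bimodule `X`. -/
abbrev BiTensor := (Env k A ⊗[k] X) ⧸ BiTensor.rel φ X

namespace BiTensor
variable {X}

/-- The element `a ⊗ x ⊗ a'`. -/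
noncomputable def tmul (a : A) (x : X) (a' : A) : BiTensor φ X := Submodule.Quotient.mk (env k a a' ⊗ₜ x)

/-- The span of the `a ⊗ x ⊗ a'` with `|a| + |a'| = n`. -/
noncomputable def part (X : Type*) [AddCommGroup X] [Module k X] [Module (Env k B) X]
    (𝒜 : ℕ → Submodule k A) (n : ℕ) : Submodule k (BiTensor φ X) :=
  Submodule.span k {t | ∃ (i j : ℕ) (a a' : A) (x : X), a ∈ 𝒜 i ∧ a' ∈ 𝒜 j ∧ i + j = n ∧
    t = tmul φ a x a'}

theorem tmul_bal (a : A) (b b' : B) (x : X) (a' : A) :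
    tmul φ (a * φ b) x (φ b' * a') = tmul φ a (env k b b' • x) a' := by
  refine (Submodule.Quotient.eq _).2 ?_
  have : env k (φ b) (φ b') ⊗ₜ x - 1 ⊗ₜ (env k b b' • x) ∈ BiTensor.rel φ X :=
    Submodule.subset_span ⟨b, b', x, rfl⟩
  have := Submodule.smul_mem _ (env k a a') this
  rw [smul_sub, TensorProduct.smul_tmul', TensorProduct.smul_tmul', smul_eq_mul, smul_eq_mul,
    env_mul, mul_one] at this
  exact this

end BiTensor
end BiTensor


section GenDer
variable {k : Type*} [Field k] {B : Type*} [Ring B] [Algebra k B]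

namespace BiTensor
variable {X : Type*} [AddCommGroup X] [Module k X] [Module (Env k B) X]
  {A : Type*} [Ring A] [Algebra k A] (φ : B →ₐ[k] A)

/-- The map `x ↦ 1 ⊗ x ⊗ 1`. -/
noncomputable def incl : X →ₗ[k] BiTensor φ X :=
  ((BiTensor.rel φ X).mkQ.restrictScalars k) ∘ₗ TensorProduct.mk k (Env k A) X 1

theorem incl_apply (x : X) : incl φ x = tmul φ 1 x 1 := rfl

theorem incl_env (b b' : B) (x : X) :
    incl φ (env k b b' • x) = env k (φ b) (φ b') • incl φ x := by
  have := BiTensor.tmul_bal φ 1 b b' x 1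
  rw [one_mul, mul_one] at this
  refine this.symm.trans ?_
  change _ = env k (φ b) (φ b') • Submodule.Quotient.mk (1 ⊗ₜ x)
  rw [← Submodule.Quotient.mk_smul, TensorProduct.smul_tmul', smul_eq_mul, mul_one]
  rfl

end BiTensor

namespace TensorAlg
variable {M : Type*} [AddCommGroup M] [Module k M] [Module (Env k B) M]
  {Y : Type*} [AddCommGroup Y] [Module k Y] [Module (Env k (TensorAlg k B M)) Y]
  [IsScalarTower k (Env k (TensorAlg k B M)) Y]

/-- The operator `(t, y) ↦ (s * t, s • y)`. -/
noncomputable def leftOp : TensorAlg k B M →ₗ[k] Module.End k (TensorAlg k B M × Y) where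
  toFun s := LinearMap.prodMap (LinearMap.mulLeft k s) (Algebra.lsmul k k Y (env k s 1))
  map_add' s t := by
    refine LinearMap.ext fun ⟨_, _⟩ => ?_
    simp [← envLeft_apply, add_mul]
  map_smul' c s := by
    refine LinearMap.ext fun ⟨_, _⟩ => ?_
    simp [← envLeft_apply]

theorem leftOp_apply (s t : TensorAlg k B M) (y : Y) :
    leftOp s (t, y) = (s * t, env k s 1 • y) := rfl

/-- The operator `(t, y) ↦ (0, y₀ • t)`. -/
noncomputable def rightOp : Y →ₗ[k] Module.End k (TensorAlg k B M × Y) where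
  toFun y₀ := LinearMap.inr k _ _ ∘ₗ (Algebra.lsmul k k Y).toLinearMap.flip y₀ ∘ₗ envRight k _ ∘ₗ
    LinearMap.fst k _ _
  map_add' s t := by
    refine LinearMap.ext fun ⟨_, _⟩ => ?_
    simp
  map_smul' c s := by
    refine LinearMap.ext fun ⟨_, _⟩ => ?_
    simp

theorem rightOp_apply (y₀ : Y) (t : TensorAlg k B M) (y : Y) :
    rightOp y₀ (t, y) = (0, env k 1 t • y₀) := rfl

variable (g : M →ₗ[k] Y)
  (hg : ∀ (b b' : B) m, g (env k b b' • m) = env k (base k M b) (base k M b') • g m)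

noncomputable def genDerHom : TensorAlg k B M →ₐ[k] Module.End k (TensorAlg k B M × Y) :=
  lift
    (AlgHom.ofLinearMap (leftOp ∘ₗ (base (B := B) k M).toLinearMap)
      (by
        refine LinearMap.ext fun ⟨_, _⟩ => ?_
        simp [leftOp_apply, env_one])
      (fun b b' => by
        refine LinearMap.ext fun ⟨_, _⟩ => ?_
        simp [leftOp_apply, ← mul_smul, env_mul, mul_assoc]))
    (leftOp ∘ₗ gen k + rightOp ∘ₗ g)
    (fun b b' m => by
      refine LinearMap.ext fun ⟨_, _⟩ => ?_
      simp [leftOp_apply, rightOp_apply, gen_env_smul, hg, mul_assoc, ← mul_smul, env_mul])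

/-- The derivation of the tensor algebra `T = T_B M` into a `T`-bimodule which vanishes on `B` and
is equal to a given map of `B`-bimodules on `M`. -/
noncomputable def genDer : TensorAlg k B M →ₗ[k] Y where
  toFun t := (genDerHom g hg t (1, 0)).2
  map_add' x y := by simp
  map_smul' c x := by simp

theorem genDer_base (b : B) : genDer g hg (base k M b) = 0 := by
  simp [genDer, genDerHom, leftOp_apply]

theorem genDer_gen (m : M) : genDer g hg (gen k m) = g m := by
  simp [genDer, genDerHom, leftOp_apply, rightOp_apply, env_one]

theorem genDerHom_apply (t s : TensorAlg k B M) (y : Y) :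
    genDerHom g hg t (s, y) = (t * s, env k t 1 • y + env k 1 s • genDer g hg t) := by
  induction t using induction generalizing s y with
  | hb b => rw [genDer_base]; simp [genDerHom, leftOp_apply]
  | hg m => rw [genDer_gen]; simp [genDerHom, leftOp_apply, rightOp_apply]
  | hadd u t hs ht =>
    rw [map_add, LinearMap.add_apply, hs, ht, map_add]
    simp only [Prod.mk_add_mk, add_mul, smul_add, ← envLeft_apply, map_add, add_smul]
    congr 1
    abel
  | hmul u t hs ht =>
    have e : genDer g hg (u * t) = env k u 1 • genDer g hg t + env k 1 t • genDer g hg u := by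
      change (genDerHom g hg (u * t) (1, 0)).2 = _
      rw [map_mul, Module.End.mul_apply, ht, hs]
      simp [env_one]
    rw [map_mul, Module.End.mul_apply, ht, hs, e]
    simp [mul_assoc, ← mul_smul, env_mul, add_assoc]

theorem genDer_mul (s t : TensorAlg k B M) :
    genDer g hg (s * t) = env k 1 t • genDer g hg s + env k s 1 • genDer g hg t := by
  change (genDerHom g hg (s * t) (1, 0)).2 = _
  rw [map_mul, Module.End.mul_apply, genDerHom_apply, genDerHom_apply]
  simp [env_one, add_comm]

end TensorAlg
end GenDer

section Tangent
variable {k : Type*} [Field k] {R B A : Type*} [Ring R] [Algebra k R] [Ring B] [Algebra k B]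
  [Ring A] [Algebra k A] (ρ : R →ₐ[k] B) (φ : B →ₐ[k] A)
  (𝒜 : ℕ → Submodule k A) [GradedAlgebra 𝒜]

/-- The restriction to `B` of a double derivation of `A`. -/
noncomputable def restrict : (⨁ d : ℤ, DDerGr 𝒜 (φ.comp ρ) d) →ₗ[k] (B →ₗ[k] A ⊗[k] A) :=
  DirectSum.toModule k ℤ _ fun d =>
    LinearMap.lcomp k (A ⊗[k] A) φ.toLinearMap ∘ₗ (DDerGr 𝒜 (φ.comp ρ) d).subtype

/-- `u ⊗ v ↦ φ u · z · φ v`, for the outer bimodule structure on `A ⊗ A`. -/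
noncomputable def outer (z : A ⊗[k] A) : B ⊗[k] B →ₗ[k] A ⊗[k] A :=
  TensorProduct.lift (LinearMap.mk₂ k (fun u v => (φ u ⊗ₜ 1) * z * (1 ⊗ₜ φ v))
    (by intros; simp [TensorProduct.add_tmul, add_mul])
    (by intros; simp [← TensorProduct.smul_tmul'])
    (by intros; simp [TensorProduct.tmul_add, mul_add])
    (by intros; simp))

theorem outer_tmul (z : A ⊗[k] A) (u v : B) :
    outer φ z (u ⊗ₜ v) = (φ u ⊗ₜ 1) * z * (1 ⊗ₜ φ v) := by simp [outer]

/-- The map `a ⊗ a' ↦ (-1)^(|a||a'|) a' ⊗ a`. -/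
noncomputable def revKoszul : Env k A →ₗ[k] A ⊗[k] A :=
  koszul (signAut 𝒜 1) ∘ₗ (TensorProduct.comm k A A).toLinearMap ∘ₗ
    (TensorProduct.map (LinearMap.id (R := k) (M := A)) (opLinearEquiv k (M := A)).symm.toLinearMap : _)

theorem revKoszul_env (a b : A) :
    revKoszul 𝒜 (env k a b) = koszul (signAut 𝒜 1) (b ⊗ₜ a) := rfl

noncomputable def canAux : Env k A ⊗[k] DDer ρ →ₗ[k] (B →ₗ[k] A ⊗[k] A) :=
  TensorProduct.lift (LinearMap.mk₂ k
    (fun e θ => outer φ (revKoszul 𝒜 e) ∘ₗ DDer.toLin θ)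
    (fun e e' θ => by
      ext b
      simp only [LinearMap.comp_apply, LinearMap.add_apply, map_add]
      generalize DDer.toLin θ b = z
      induction z with
      | zero => simp
      | tmul u v => simp [outer_tmul, mul_add, add_mul]
      | add x y hx hy => rw [map_add, map_add, map_add, hx, hy]; abel)
    (fun c e θ => by
      ext b
      simp only [LinearMap.comp_apply, LinearMap.smul_apply, map_smul]
      generalize DDer.toLin θ b = z
      induction z with
      | zero => simp
      | tmul u v => simp [outer_tmul]
      | add x y hx hy => rw [map_add, map_add, smul_add, hx, hy])
    (fun e θ η => by ext b; simp)
    (fun c e θ => by ext b; simp))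

theorem canAux_tmul (e : Env k A) (θ : DDer ρ) (b : B) :
    canAux ρ φ 𝒜 (e ⊗ₜ θ) b = outer φ (revKoszul 𝒜 e) (DDer.toLin θ b) := by simp [canAux]

variable [IsGradedOver 𝒜 φ]

theorem canAux_rel : (BiTensor.rel φ (DDer ρ)).restrictScalars k ≤ LinearMap.ker (canAux ρ φ 𝒜) := by
  intro z hz
  replace hz : z ∈ BiTensor.rel φ (DDer ρ) := hz
  rw [LinearMap.mem_ker]
  suffices ∀ e : Env k A, canAux ρ φ 𝒜 (e • z) = 0 by simpa using this 1
  unfold BiTensor.rel at hz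
  induction hz using Submodule.span_induction with
  | zero => simp
  | add x y _ _ hx hy => intro e; rw [smul_add, map_add, hx, hy, add_zero]
  | smul e' x _ hx => intro e; rw [smul_smul]; exact hx _
  | mem z hz =>
    obtain ⟨b, b', θ, rfl⟩ := hz
    intro e
    induction e using env_induction with
    | hadd x y hx hy => rw [add_smul, map_add, hx, hy, add_zero]
    | h a a' =>
      rw [smul_sub, TensorProduct.smul_tmul', TensorProduct.smul_tmul', smul_eq_mul, smul_eq_mul,
        env_mul, mul_one, map_sub, sub_eq_zero]
      ext c
      rw [canAux_tmul, canAux_tmul, DDer.toLin_smul, revKoszul_env, revKoszul_env]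
      have hs : ∀ b, signAut 𝒜 1 (φ b) = φ b := fun b => by
        simpa using signAut_of_mem 𝒜 1 (IsGradedOver.map_mem (𝒜 := 𝒜) (ρ := φ) b)
      have hk : koszul (signAut 𝒜 1) ((φ b' * a') ⊗ₜ (a * φ b)) =
          (φ b' ⊗ₜ 1) * koszul (signAut 𝒜 1) (a' ⊗ₜ a) * (1 ⊗ₜ[k] φ b) := by
        simp [koszul, hs, mul_add, add_mul, mul_sub, sub_mul]
      rw [hk]
      generalize DDer.toLin θ c = z
      induction z with
      | zero => simp
      | tmul u v =>
        rw [DDer.innerAct_tmul, outer_tmul, outer_tmul]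
        generalize koszul (signAut 𝒜 1) (a' ⊗ₜ a) = w
        rw [← mul_assoc, ← mul_assoc, Algebra.TensorProduct.tmul_mul_tmul, mul_assoc,
          Algebra.TensorProduct.tmul_mul_tmul]
        simp
      | add x y hx hy => rw [map_add, map_add, map_add, hx, hy]

/-- The canonical map `A ⊗_B 𝔻er_R B ⊗_B A → Der_R (B, A ⊗ A)`, `a ⊗ θ ⊗ a' ↦ a * θ * a'`, for the
inner graded bimodule structure of `A ⊗ A`; see `can_tmul`. -/
noncomputable def can : BiTensor φ (DDer ρ) →ₗ[k] (B →ₗ[k] A ⊗[k] A) :=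
  Submodule.liftQ _ (canAux ρ φ 𝒜) (canAux_rel ρ φ 𝒜) ∘ₗ
    (Submodule.Quotient.restrictScalarsEquiv k (BiTensor.rel φ (DDer ρ))).symm.toLinearMap

theorem can_tmul [CharZero k] {i j : ℕ} {a a' : A} (ha : a ∈ 𝒜 i) (ha' : a' ∈ 𝒜 j) (θ : DDer ρ)
    {b : B} {u v : B} (h : DDer.toLin θ b = u ⊗ₜ v) :
    can ρ φ 𝒜 (BiTensor.tmul φ a θ a') b =
      sgn k (i * j) • ((φ u * a') ⊗ₜ (a * φ v)) := by
  have e : can ρ φ 𝒜 (BiTensor.tmul φ a θ a') b = canAux ρ φ 𝒜 (env k a a' ⊗ₜ θ) b := rfl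
  rw [e, canAux_tmul, h, outer_tmul, revKoszul_env,
    koszul_tmul _ (i := j) (j := i) (by simpa using signAut_of_mem 𝒜 1 ha')
      (by simpa using signAut_of_mem 𝒜 1 ha), mul_comm (j : ℤ)]
  simp

end Tangent

section TensorN
variable {k : Type*} [Field k] {B : Type*} [Ring B] [Algebra k B] {N : ℕ} (E : Fin N → Type*)
  [∀ i, AddCommGroup (E i)] [∀ i, Module k (E i)] [∀ i, Module (Env k B) (E i)]

variable (k B) in
/-- The algebra `A = T_B M`, where `M` is the sum of the bimodules `E i`. -/
abbrev TAlg := TensorAlg k B (∀ i, E i)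

variable (k B) in
/-- The inclusion of `B` in `A = T_B M`. -/
noncomputable abbrev TAlg.base : B →ₐ[k] TAlg k B E := TensorAlg.base k (∀ i, E i)

/-- Products of elements of `B`, of weight `0`, and of the bimodules `E i`, of weight `i + 1`. -/
inductive TAlg.IsHom : TAlg k B E → ℕ → Prop
  | base (b : B) : IsHom (TAlg.base k B E b) 0
  | gen (i : Fin N) (e : E i) : IsHom (TensorAlg.gen k (Pi.single i e)) (i + 1)
  | mul {x y : TAlg k B E} {m n : ℕ} (hx : IsHom x m) (hy : IsHom y n) : IsHom (x * y) (m + n)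

variable (k B) in
/-- The weight grading of `A = T_B M` for which `E i` has weight `i + 1`. -/
noncomputable def TAlg.weight (n : ℕ) : Submodule k (TAlg k B E) :=
  Submodule.span k {x | TAlg.IsHom E x n}

namespace TAlg

theorem base_mem (b : B) : TAlg.base k B E b ∈ weight k B E 0 := Submodule.subset_span (.base b)

theorem gen_mem (i : Fin N) (e : E i) :
    (TensorAlg.gen k (Pi.single i e) : TAlg k B E) ∈ weight k B E (i + 1) :=
  Submodule.subset_span (.gen i e)

instance : SetLike.GradedMonoid (weight k B E) where
  one_mem := by
    have := base_mem (k := k) (B := B) E 1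
    rwa [map_one] at this
  mul_mem := fun {i j} x y hx hy => by
    have := Submodule.mul_mem_mul hx hy
    rw [weight, weight, Submodule.span_mul_span] at this
    refine Submodule.span_mono ?_ this
    rintro _ ⟨x, hx, y, hy, rfl⟩
    exact .mul hx hy

noncomputable def decompBase : B →ₐ[k] ⨁ n, weight k B E n :=
  AlgHom.ofLinearMap
    (DirectSum.lof k ℕ (fun n => weight k B E n) 0 ∘ₗ
      (TAlg.base k B E).toLinearMap.codRestrict (weight k B E 0) (base_mem E))
    (by
      rw [DirectSum.one_def]
      exact congrArg (DirectSum.of (fun n => weight k B E n) 0)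
        (Subtype.ext (map_one (TAlg.base k B E))))
    (fun b b' => by
      refine Eq.trans ?_ (DirectSum.of_mul_of _ _).symm
      exact congrArg (DirectSum.of (fun n => weight k B E n) 0)
        (Subtype.ext (map_mul (TAlg.base k B E) b b')))

noncomputable def decompGen : (∀ i, E i) →ₗ[k] ⨁ n, weight k B E n :=
  ∑ i : Fin N, DirectSum.lof k ℕ (fun n => weight k B E n) (i + 1) ∘ₗ
    (TensorAlg.gen k ∘ₗ LinearMap.single k E i).codRestrict (weight k B E (i + 1)) (gen_mem E i) ∘ₗ
      LinearMap.proj i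

noncomputable def decomp : TAlg k B E →ₐ[k] ⨁ n, weight k B E n :=
  TensorAlg.lift (decompBase E) (decompGen E) (fun b b' m => by
    simp only [decompGen, LinearMap.sum_apply, Finset.mul_sum, Finset.sum_mul]
    refine Finset.sum_congr rfl fun i _ => ?_
    refine Eq.trans ?_ (congrArg₂ (· * ·) (DirectSum.of_mul_of _ _).symm rfl)
    refine Eq.trans ?_ (DirectSum.of_mul_of _ _).symm
    refine DirectSum.of_eq_of_gradedMonoid_eq (Sigma.subtype_ext ?_ ?_)
    · exact (Nat.zero_add _).symm
    · change (TensorAlg.gen k (Pi.single i (env k b b' • m i)) : TAlg k B E) = _ * _ * _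
      rw [Pi.single_smul, TensorAlg.gen_env_smul]
      rfl)

theorem decomp_of_mem (n : ℕ) (x : weight k B E n) :
    decomp E (x : TAlg k B E) = DirectSum.of (fun n => weight k B E n) n x := by
  obtain ⟨x, hx⟩ := x
  change decomp E x = _
  induction hx using Submodule.span_induction with
  | zero => rw [map_zero]; exact (map_zero _).symm
  | add x y hx hy ix iy =>
    rw [map_add, ix, iy]; exact (map_add _ _ _).symm
  | smul c x hx ix =>
    rw [map_smul, ix]
    exact (map_smul (DirectSum.lof k ℕ (fun n => weight k B E n) n) c ⟨x, hx⟩).symm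
  | mem x h =>
    induction h with
    | base b => exact TensorAlg.lift_base ..
    | gen i e =>
      refine (TensorAlg.lift_gen ..).trans ?_
      rw [decompGen, LinearMap.sum_apply, Finset.sum_eq_single i]
      · simp only [LinearMap.comp_apply, LinearMap.proj_apply, Pi.single_eq_same]
        rfl
      · intro j _ hj
        simp [Pi.single_eq_of_ne hj]
      · simp
    | @mul x y m n hx hy ix iy =>
      rw [map_mul, ix, iy,
        DirectSum.of_mul_of]
      rfl

noncomputable instance : GradedAlgebra (weight k B E) :=
  GradedAlgebra.ofAlgHom _ (decomp E)
    (by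
      refine AlgHom.ext fun x => ?_
      induction x using TensorAlg.induction with
      | hb b =>
        change DirectSum.coeAlgHom _ (decomp E (TAlg.base k B E b)) = _
        rw [decomp_of_mem E 0 ⟨_, base_mem E b⟩]
        simp
      | hg m =>
        change DirectSum.coeAlgHom _ (decomp E (TensorAlg.gen k m)) = TensorAlg.gen k m
        have : m = ∑ i, Pi.single i (m i) := (Finset.univ_sum_single m).symm
        rw [this, map_sum, map_sum, map_sum]
        refine Finset.sum_congr rfl fun i _ => ?_
        rw [decomp_of_mem E (i + 1) ⟨_, gen_mem E i (m i)⟩]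
        simp
      | hadd x y hx hy => rw [map_add, hx, hy, map_add]
      | hmul x y hx hy => rw [map_mul, hx, hy, map_mul])
    (decomp_of_mem E)

instance : IsGradedOver (weight k B E) (TAlg.base k B E) := ⟨base_mem E⟩

variable {R : Type*} [Ring R] [Algebra k R] (ρ : R →ₐ[k] B)

instance : IsGradedOver (weight k B E) ((TAlg.base k B E).comp ρ) :=
  ⟨fun r => base_mem E (ρ r)⟩

/-- The map `Ω¹_R A → A ⊗_B M ⊗_B A → A ⊗_B E_i ⊗_B A` of `A`-bimodules with `d b ↦ 0` for `b` in `B`,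
`d e ↦ 1 ⊗ e ⊗ 1` for `e` in `E i`, and `d e ↦ 0` for `e` in `E j`, `j ≠ i`. -/
noncomputable def nu (i : Fin N) :
    Omega1 ((TAlg.base k B E).comp ρ) →ₗ[k] BiTensor (TAlg.base k B E) (E i) :=
  Omega1.lift _ (Algebra.lsmul k k _)
    (TensorAlg.genDer (BiTensor.incl (TAlg.base k B E) ∘ₗ LinearMap.proj i)
      (fun b b' m => BiTensor.incl_env (TAlg.base k B E) b b' (m i)))
    (fun s t => TensorAlg.genDer_mul _ _ s t)
    (fun r => TensorAlg.genDer_base _ _ (ρ r))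

end TAlg
end TensorN

end NCG

/-!
# The restriction theorem in weight zero

Let `ε` be the restriction of double derivations from `A = T_B M` to `B`, followed by the inverse of the
canonical map `can : A ⊗_B 𝔻er_R B ⊗_B A → Der_R(B, A ⊗ A)`. Both `ε` and `ν_N ∘ ι(ω)` are surjective
maps out of the double derivations of `A`, so `ν_N ∘ ι(ω)` factors through `ε` as an isomorphism if and
only if the two kernels agree. They do, for reasons of weight.

The inverse `canInv` of `can` is explicit. Smoothness gives a finite dual basis of `Ω¹_R B` made of exact
forms `d b` (`IsSmooth.exists_dual_basis`), and a derivation `T : B → A ⊗ A` is determined by its values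
on these finitely many `b` (`derivation_eq_sum`, `canInv_can`, `can_canInv`). Restriction to `B` is onto
because `M` is projective, so that every such `T` extends to `A` (`TAlg.exists_extension`).

* `ker ε ⊆ ker (ν_N ∘ ι(ω))`. Double derivations vanishing on `B` are generated, as a graded bimodule, by
  the ones dual to the dual bases of the `E_i`, which have negative weight
  (`TAlg.lof_mem_of_vanishing`). As `ι(ω)` raises weights by `N`, their images are of weight less than
  `N`, where `ν_N` vanishes (`TAlg.nu_iota_eq_zero`).
* `ker (ν_N ∘ ι(ω)) ⊆ ker ε`. The kernel of `ν_N` is generated by the forms `d c` with `|c| < N`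
  (`TAlg.mem_span_of_nu_eq_zero`). As `ι(ω)` is bijective, each is the image of a double derivation of
  weight `|c| - N < 0` (`TAlg.exists_iota_eq_D`), which sends `B` to the part of negative weight of
  `A ⊗ A`, that is, to zero. As `ι(ω)` is injective, `ker (ν_N ∘ ι(ω))` is generated by these
  (`TAlg.restrict_eq_zero`).

Compatibility with the bimodule structures follows from the formula `ι(aΘb) = (-1)^(N|b|) a ι(Θ) b`
(`iota_act`), where `aΘb` is `DDerGr.act`. Preservation of weights follows from the generators: `ε`
preserves weights, `ι(ω)` raises them by `N`, and `ν_N` lowers them by `N`. Finally, the part of weight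
zero of `A ⊗_B X ⊗_B A` is `X`, since the part of weight zero of `A` is `B` and `B` is a retract of `A`,
which gives the isomorphism of `B`-bimodules `𝔻er_R B ≅ E_N` (`TAlg.exists_linearEquiv_of_map_part_zero`).

Components of a given weight are separated with the endomorphism `a ↦ 2^|a| a` and the maps that it
induces on tensors and 1-forms: in characteristic zero the powers of `2` are distinct, so the weight
spaces lie in eigenspaces for distinct eigenvalues (`map_component_of_mem_eigenspace`).
-/

namespace NCG

/-! ### The graded bimodule of double derivations -/

section GradedTensors
variable {k : Type*} [Field k] {A : Type*} [Ring A] [Algebra k A]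
  (𝒜 : ℕ → Submodule k A) [GradedAlgebra 𝒜]

theorem signAut_signAut (d e : ℤ) (a : A) : signAut 𝒜 d (signAut 𝒜 e a) = signAut 𝒜 (d + e) a := by
  induction a using graded_induction 𝒜 with
  | h i a ha =>
    rw [signAut_of_mem 𝒜 e ha, map_smul, signAut_of_mem 𝒜 d ha, signAut_of_mem 𝒜 (d + e) ha,
      smul_smul, ← sgn_add]
    congr 2; ring
  | hadd x y hx hy => rw [map_add, map_add, map_add, hx, hy]

theorem signAut_of_mem_zero (d : ℤ) {a : A} (h : a ∈ 𝒜 0) : signAut 𝒜 d a = a := by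
  simpa using signAut_of_mem 𝒜 d h

theorem signAut_self (d : ℤ) (a : A) : signAut 𝒜 d (signAut 𝒜 d a) = a := by
  induction a using graded_induction 𝒜 with
  | h i a ha =>
    rw [signAut_of_mem 𝒜 d ha, map_smul, signAut_of_mem 𝒜 d ha, smul_smul, sgn_sq, one_smul]
  | hadd x y hx hy => rw [map_add, map_add, hx, hy]

theorem signAut_mem (d : ℤ) {i : ℕ} {a : A} (h : a ∈ 𝒜 i) : signAut 𝒜 d a ∈ 𝒜 i := by
  rw [signAut_of_mem 𝒜 d h]; exact Submodule.smul_mem _ _ h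

theorem homogeneous_tensor_induction {P : A ⊗[k] A → Prop} (z : A ⊗[k] A)
    (h : ∀ i j, ∀ u ∈ 𝒜 i, ∀ v ∈ 𝒜 j, P (u ⊗ₜ v)) (hadd : ∀ x y, P x → P y → P (x + y)) : P z := by
  induction z with
  | zero => simpa using h 0 0 0 (Submodule.zero_mem _) 0 (Submodule.zero_mem _)
  | add x y hx hy => exact hadd x y hx hy
  | tmul u v =>
    induction u using graded_induction 𝒜 with
    | hadd x y hx hy => rw [TensorProduct.add_tmul]; exact hadd _ _ hx hy
    | h i u hu =>
      induction v using graded_induction 𝒜 with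
      | hadd x y hx hy => rw [TensorProduct.tmul_add]; exact hadd _ _ hx hy
      | h j v hv => exact h i j u hu v hv

variable {𝒜} in
omit [GradedAlgebra 𝒜] in
theorem tmul_mem_tensorPart {p q : ℕ} {n : ℤ} {u v : A} (hu : u ∈ 𝒜 p) (hv : v ∈ 𝒜 q)
    (h : (p + q : ℤ) = n) : u ⊗ₜ v ∈ tensorPart 𝒜 n :=
  Submodule.subset_span ⟨p, q, u, v, hu, hv, h, rfl⟩

variable {𝒜} in
theorem tensorPart_mul {n : ℤ} {p q : ℕ} {u v : A} {z : A ⊗[k] A} (hu : u ∈ 𝒜 p) (hv : v ∈ 𝒜 q)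
    (hz : z ∈ tensorPart 𝒜 n) : (u ⊗ₜ 1) * z * (1 ⊗ₜ v) ∈ tensorPart 𝒜 (p + n + q) := by
  induction hz using Submodule.span_induction with
  | zero => simp
  | add x y _ _ hx hy => rw [mul_add, add_mul]; exact Submodule.add_mem _ hx hy
  | smul c x _ hx => rw [mul_smul_comm, smul_mul_assoc]; exact Submodule.smul_mem _ _ hx
  | mem z h =>
    obtain ⟨p', q', x, y, hx, hy, rfl, rfl⟩ := h
    simp only [Algebra.TensorProduct.tmul_mul_tmul, one_mul, mul_one]
    exact tmul_mem_tensorPart (SetLike.mul_mem_graded hu hx) (SetLike.mul_mem_graded hy hv)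
      (by push_cast; ring)

theorem one_mem_weight_zero : (1 : A) ∈ 𝒜 0 := SetLike.GradedOne.one_mem

variable {𝒜} in
theorem tensorPart_mul_left {n : ℤ} {p : ℕ} {u : A} {z : A ⊗[k] A} (hu : u ∈ 𝒜 p)
    (hz : z ∈ tensorPart 𝒜 n) : (u ⊗ₜ 1) * z ∈ tensorPart 𝒜 (p + n) := by
  have := tensorPart_mul hu (one_mem_weight_zero 𝒜) hz
  rwa [← Algebra.TensorProduct.one_def, mul_one, Nat.cast_zero, add_zero] at this

variable {𝒜} in
theorem tensorPart_mul_right {n : ℤ} {q : ℕ} {v : A} {z : A ⊗[k] A} (hv : v ∈ 𝒜 q)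
    (hz : z ∈ tensorPart 𝒜 n) : z * (1 ⊗ₜ v) ∈ tensorPart 𝒜 (n + q) := by
  have := tensorPart_mul (one_mem_weight_zero 𝒜) hv hz
  rwa [← Algebra.TensorProduct.one_def, one_mul, Nat.cast_zero, zero_add] at this

variable {𝒜} in
omit [GradedAlgebra 𝒜] in
/-- A tensor has no component of negative weight, as the weights of `A` are natural numbers. -/
theorem eq_zero_of_mem_tensorPart_neg {n : ℤ} (hn : n < 0) {z : A ⊗[k] A}
    (hz : z ∈ tensorPart 𝒜 n) : z = 0 := by
  have : tensorPart 𝒜 n = ⊥ := by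
    rw [tensorPart, Submodule.span_eq_bot]
    rintro z ⟨p, q, x, y, -, -, e, -⟩
    omega
  rw [this] at hz
  exact hz

/-- For `a` and `b` of weights `i` and `j`, the inner graded bimodule action
`u ⊗ v ↦ (-1)^(|a||u| + |a||b| + |b||v|) ub ⊗ av` on `A ⊗ A`. -/
noncomputable def innerGr (i j : ℤ) (a b : A) : A ⊗[k] A →ₗ[k] A ⊗[k] A :=
  sgn k (i * j) • (LinearMap.mulLeft k (1 ⊗ₜ a) ∘ₗ LinearMap.mulRight k (b ⊗ₜ 1) ∘ₗ
    TensorProduct.map (signAut 𝒜 i).toLinearMap (signAut 𝒜 j).toLinearMap)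

theorem innerGr_tmul (i j : ℤ) (a b u v : A) : innerGr 𝒜 i j a b (u ⊗ₜ v) =
    sgn k (i * j) • ((signAut 𝒜 i u * b) ⊗ₜ (a * signAut 𝒜 j v)) := by
  simp [innerGr]

theorem innerGr_mul_right (i j : ℤ) (a b c : A) (z : A ⊗[k] A) :
    innerGr 𝒜 i j a b (z * (1 ⊗ₜ c)) = innerGr 𝒜 i j a b z * (1 ⊗ₜ signAut 𝒜 j c) := by
  induction z with
  | zero => simp
  | add x y hx hy => rw [add_mul, map_add, map_add, hx, hy, add_mul]
  | tmul u v => simp [innerGr_tmul, mul_assoc]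

theorem innerGr_mul_left (i j : ℤ) (a b c : A) (z : A ⊗[k] A) :
    innerGr 𝒜 i j a b ((c ⊗ₜ 1) * z) = (signAut 𝒜 i c ⊗ₜ 1) * innerGr 𝒜 i j a b z := by
  induction z with
  | zero => simp
  | add x y hx hy => rw [mul_add, map_add, map_add, hx, hy, mul_add]
  | tmul u v => simp [innerGr_tmul, mul_assoc]

theorem innerGr_mem {i j : ℕ} {a b : A} (ha : a ∈ 𝒜 i) (hb : b ∈ 𝒜 j) {n : ℤ} {z : A ⊗[k] A}
    (hz : z ∈ tensorPart 𝒜 n) : innerGr 𝒜 i j a b z ∈ tensorPart 𝒜 (n + i + j) := by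
  induction hz using Submodule.span_induction with
  | zero => simp
  | add x y _ _ hx hy => rw [map_add]; exact Submodule.add_mem _ hx hy
  | smul c x _ hx => rw [map_smul]; exact Submodule.smul_mem _ _ hx
  | mem z h =>
    obtain ⟨p, q, x, y, hx, hy, rfl, rfl⟩ := h
    rw [innerGr_tmul]
    exact Submodule.smul_mem _ _ (tmul_mem_tensorPart
      (SetLike.mul_mem_graded (signAut_mem 𝒜 _ hx) hb)
      (SetLike.mul_mem_graded ha (signAut_mem 𝒜 _ hy)) (by push_cast; ring))

end GradedTensors

section GradedAction
variable {k : Type*} [Field k] {R A : Type*} [Ring R] [Algebra k R] [Ring A] [Algebra k A]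
  (ρ : R →ₐ[k] A) (𝒜 : ℕ → Submodule k A) [GradedAlgebra 𝒜]

variable {ρ 𝒜} in
/-- A criterion for double derivations of weight `d` whose Leibniz rule has no homogeneity condition. -/
theorem mem_DDerGr {d : ℤ} {Θ : A →ₗ[k] A ⊗[k] A} (h0 : ∀ r, Θ (ρ r) = 0)
    (h1 : ∀ (i : ℕ), ∀ a ∈ 𝒜 i, Θ a ∈ tensorPart 𝒜 (i + d))
    (h2 : ∀ a b, Θ (a * b) = (signAut 𝒜 d a ⊗ₜ 1) * Θ b + Θ a * (1 ⊗ₜ b)) : Θ ∈ DDerGr 𝒜 ρ d :=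
  ⟨h0, h1, fun i a ha b => by
    rw [h2, signAut_of_mem 𝒜 d ha, ← TensorProduct.smul_tmul', smul_mul_assoc, add_comm]⟩

variable [IsGradedOver 𝒜 ρ]

theorem signAut_base (d : ℤ) (r : R) : signAut 𝒜 d (ρ r) = ρ r :=
  signAut_of_mem_zero 𝒜 d (IsGradedOver.map_mem (𝒜 := 𝒜) (ρ := ρ) r)

variable {ρ 𝒜} in
/-- The double derivation `a Θ b`, for `a` and `b` of weights `i` and `j`: its value at `c` is
`(-1)^(|b||c|) a * Θ(c) * b`, for the inner graded bimodule structure of `A ⊗ A`. -/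
noncomputable def DDerGr.act {i j : ℕ} {a b : A} (ha : a ∈ 𝒜 i) (hb : b ∈ 𝒜 j) {d : ℤ}
    (Θ : DDerGr 𝒜 ρ d) : DDerGr 𝒜 ρ (d + i + j) :=
  ⟨innerGr 𝒜 i j a b ∘ₗ Θ.1 ∘ₗ (signAut 𝒜 j).toLinearMap, mem_DDerGr
    (fun r => by simp [signAut_base ρ 𝒜, Θ.2.1 r])
    (fun n c hc => by
      rw [show (n : ℤ) + (d + i + j) = n + d + i + j by ring]
      exact innerGr_mem 𝒜 ha hb (Θ.2.2.1 n _ (signAut_mem 𝒜 j hc)))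
    (fun c e => by
      simp only [LinearMap.comp_apply, AlgHom.toLinearMap_apply, _root_.map_mul]
      rw [DDerGr.map_mul 𝒜 ρ Θ.2, map_add, innerGr_mul_left, innerGr_mul_right, signAut_self,
        signAut_signAut, signAut_signAut]
      congr 4
      ring_nf)⟩

variable {ρ 𝒜} in
theorem DDerGr.act_apply {i j : ℕ} {a b : A} (ha : a ∈ 𝒜 i) (hb : b ∈ 𝒜 j) {d : ℤ}
    (Θ : DDerGr 𝒜 ρ d) (c : A) :
    (DDerGr.act ha hb Θ).1 c = innerGr 𝒜 i j a b (Θ.1 (signAut 𝒜 j c)) := rfl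

namespace Forms

/-- The inner graded bimodule action of `A` on `Ω ⊗ Ω`. -/
noncomputable def innerGr (i j : ℤ) (a b : A) : Forms ρ ⊗[k] Forms ρ →ₗ[k] Forms ρ ⊗[k] Forms ρ :=
  sgn k (i * j) • (LinearMap.mulLeft k (1 ⊗ₜ base ρ a) ∘ₗ LinearMap.mulRight k (base ρ b ⊗ₜ 1) ∘ₗ
    TensorProduct.map (weightAut ρ 𝒜 i).toLinearMap (weightAut ρ 𝒜 j).toLinearMap)

theorem innerGr_tmul (i j : ℤ) (a b : A) (x y : Forms ρ) : innerGr ρ 𝒜 i j a b (x ⊗ₜ y) =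
    sgn k (i * j) • ((weightAut ρ 𝒜 i x * base ρ b) ⊗ₜ (base ρ a * weightAut ρ 𝒜 j y)) := by
  simp [innerGr]

theorem innerGr_mul_right (i j : ℤ) (a b : A) (c : Forms ρ) (z : Forms ρ ⊗[k] Forms ρ) :
    innerGr ρ 𝒜 i j a b (z * (1 ⊗ₜ c)) = innerGr ρ 𝒜 i j a b z * (1 ⊗ₜ weightAut ρ 𝒜 j c) := by
  induction z with
  | zero => simp
  | add x y hx hy => rw [add_mul, map_add, map_add, hx, hy, add_mul]
  | tmul u v => simp [innerGr_tmul, mul_assoc]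

theorem innerGr_mul_left (i j : ℤ) (a b : A) (c : Forms ρ) (z : Forms ρ ⊗[k] Forms ρ) :
    innerGr ρ 𝒜 i j a b ((c ⊗ₜ 1) * z) = (weightAut ρ 𝒜 i c ⊗ₜ 1) * innerGr ρ 𝒜 i j a b z := by
  induction z with
  | zero => simp
  | add x y hx hy => rw [mul_add, map_add, map_add, hx, hy, mul_add]
  | tmul u v => simp [innerGr_tmul, mul_assoc]

theorem weightAut_weightAut (d e : ℤ) (x : Forms ρ) :
    weightAut ρ 𝒜 d (weightAut ρ 𝒜 e x) = weightAut ρ 𝒜 (d + e) x := by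
  induction x using induction ρ with
  | hb a => simp only [weightAut_base, signAut_signAut]
  | hD a => simp only [weightAut_D, signAut_signAut]
  | hadd x y hx hy => rw [map_add, map_add, map_add, hx, hy]
  | hmul x y hx hy => rw [map_mul, map_mul, map_mul, hx, hy]

theorem weightAut_self (d : ℤ) (x : Forms ρ) :
    weightAut ρ 𝒜 d (weightAut ρ 𝒜 d x) = x := by
  induction x using induction ρ with
  | hb a => simp only [weightAut_base, signAut_self]
  | hD a => simp only [weightAut_D, signAut_self]
  | hadd x y hx hy => rw [map_add, map_add, hx, hy]
  | hmul x y hx hy => rw [map_mul, map_mul, hx, hy]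

theorem formAut_weightAut (d : ℤ) (x : Forms ρ) :
    formAut ρ (weightAut ρ 𝒜 d x) = weightAut ρ 𝒜 d (formAut ρ x) := by
  induction x using induction ρ with
  | hb a => simp [formAut, weightAut_base]
  | hD a => simp [formAut, weightAut_D]
  | hadd x y hx hy => simp only [map_add, hx, hy]
  | hmul x y hx hy => simp only [map_mul, hx, hy]

theorem map_base_innerGr (i j : ℤ) (a b : A) (z : A ⊗[k] A) :
    TensorProduct.map (base ρ).toLinearMap (base ρ).toLinearMap (NCG.innerGr 𝒜 i j a b z) =
    innerGr ρ 𝒜 i j a b (TensorProduct.map (base ρ).toLinearMap (base ρ).toLinearMap z) := by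
  induction z with
  | zero => simp
  | add x y hx hy => simp only [map_add, hx, hy]
  | tmul u v => simp [innerGr_tmul, NCG.innerGr_tmul, weightAut_base]

variable {ρ 𝒜} in
/-- The contraction with `a Θ b` is `x ↦ (-1)^(|b||x|) a * (i_Θ x) * b`: both sides are double
derivations with the same values on the generators `c` and `d c`. -/
theorem contract_act {i j : ℕ} {a b : A} (ha : a ∈ 𝒜 i) (hb : b ∈ 𝒜 j) {d : ℤ}
    (Θ : DDerGr 𝒜 ρ d) (x : Forms ρ) : contract ρ 𝒜 _ (DDerGr.act ha hb Θ) x =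
      innerGr ρ 𝒜 i j a b (contract ρ 𝒜 d Θ (weightAut ρ 𝒜 j x)) := by
  induction x using induction ρ with
  | hb c => simp [contract_base, weightAut_base]
  | hD c => rw [contract_D, weightAut_D, contract_D, DDerGr.act_apply, map_base_innerGr]
  | hadd x y hx hy => simp only [map_add, hx, hy]
  | hmul x y hx hy =>
    rw [contract_mul, hx, hy, map_mul, contract_mul, map_add, innerGr_mul_left, innerGr_mul_right,
      weightAut_self]
    simp only [formAut_weightAut, weightAut_weightAut]
    congr 4
    ring_nf

variable {ρ 𝒜} in
/-- On `Ω ⊗ Ω` the map `x ⊗ y ↦ ± y x` intertwines the inner bimodule structure with the one on `Ω`: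
the Koszul signs cancel. -/
theorem circ_innerGr [CharZero k] {i j : ℕ} {a b : A} (ha : a ∈ 𝒜 i) (hb : b ∈ 𝒜 j) {w p : ℤ}
    {z : Forms ρ ⊗[k] Forms ρ} (hz : z ∈ tpart ρ 𝒜 w p) :
    circ ρ 𝒜 (innerGr ρ 𝒜 i j a b z) = base ρ a * circ ρ 𝒜 z * base ρ b := by
  induction hz using Submodule.span_induction with
  | zero => simp
  | add x y _ _ hx hy => simp only [map_add, hx, hy, mul_add, add_mul]
  | smul c x _ hx => simp only [map_smul, hx, mul_smul_comm, smul_mul_assoc]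
  | mem z h =>
    obtain ⟨w₁, p₁, w₂, p₂, u, v, hu, hv, rfl, rfl, rfl⟩ := h
    have ha' : base ρ a ∈ part ρ 𝒜 i 0 := Submodule.subset_span (.base ha)
    have hb' : base ρ b ∈ part ρ 𝒜 j 0 := Submodule.subset_span (.base hb)
    rw [innerGr_tmul, weightAut_of_mem _ hu, weightAut_of_mem _ hv, smul_mul_assoc, mul_smul_comm,
      ← TensorProduct.smul_tmul', TensorProduct.tmul_smul, map_smul, map_smul, map_smul,
      circ_tmul (part_mul hu hb') (part_mul ha' hv), circ_tmul hu hv, smul_smul, smul_smul,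
      smul_smul, ← sgn_add, ← sgn_add, ← sgn_add, mul_smul_comm, smul_mul_assoc]
    congr 1
    · apply sgn_eq_of_even
      exact ⟨i * j + i * w₁ + j * w₂, by push_cast; ring⟩
    · simp only [mul_assoc]

end Forms
end GradedAction

/-! ### Weights of 1-forms and the contraction map -/

section Independence
variable {k : Type*} [Field k] {V : Type*} [AddCommGroup V] [Module k V]
  {X : ℤ → Type*} [∀ d, AddCommGroup (X d)] [∀ d, Module k (X d)]

/-- If a linear map out of a direct sum carries the summands to eigenspaces for distinct eigenvalues,
and a value lies in one of these eigenspaces, then it is the value at a single component. -/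
theorem map_component_of_mem_eigenspace (S : Module.End k V) {μ : ℤ → k} (hμ : Function.Injective μ)
    (f : (⨁ d, X d) →ₗ[k] V)
    (hf : ∀ d x, f (DirectSum.lof k ℤ X d x) ∈ Module.End.eigenspace S (μ d))
    (Θ : ⨁ d, X d) (n : ℤ) (h : f Θ ∈ Module.End.eigenspace S (μ n)) :
    f (DirectSum.lof k ℤ X n (Θ n)) = f Θ := by
  classical
  have hind : iSupIndep fun d : ℤ => Module.End.eigenspace S (μ d) :=
    (Module.End.eigenspaces_iSupIndep S).comp hμ
  have inj := hind.dfinsupp_lsum_injective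
  -- `f` is lifted to the direct sum of the eigenspaces, which embeds into `V`.
  let g : (⨁ d, X d) →ₗ[k] ⨁ d, Module.End.eigenspace S (μ d) := DirectSum.lmap fun d =>
    (f ∘ₗ DirectSum.lof k ℤ X d).codRestrict _ (hf d)
  have hg : ∀ Θ, DFinsupp.lsum ℕ (fun d => (Module.End.eigenspace S (μ d)).subtype) (g Θ) = f Θ := by
    intro Θ
    induction Θ using DirectSum.induction_on with
    | zero => simp
    | add x y hx hy => rw [map_add, map_add, map_add, hx, hy]
    | of d x =>
      have : g (DirectSum.lof k ℤ X d x) =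
          DirectSum.lof k ℤ _ d ((f ∘ₗ DirectSum.lof k ℤ X d).codRestrict _ (hf d) x) :=
        DirectSum.lmap_lof _ _ _
      change DFinsupp.lsum ℕ _ (g (DirectSum.lof k ℤ X d x)) = _
      rw [this]
      exact DFinsupp.lsum_single ..
  have e : g Θ = DirectSum.lof k ℤ (fun d => Module.End.eigenspace S (μ d)) n ⟨f Θ, h⟩ := by
    apply inj
    rw [hg]
    symm
    exact DFinsupp.lsum_single ..
  have := congrArg (fun t : ⨁ d, Module.End.eigenspace S (μ d) => (t n : V)) e
  simpa [g] using this

theorem two_zpow_injective [CharZero k] : Function.Injective fun n : ℤ => (2 : k) ^ n := by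
  intro m n h
  have h' : ((2 : ℚ) ^ m : ℚ) = 2 ^ n := by
    have : (((2 : ℚ) ^ m : ℚ) : k) = ((2 ^ n : ℚ) : k) := by push_cast; exact h
    exact_mod_cast this
  exact zpow_right_injective₀ (by norm_num) (by norm_num) h'

end Independence

section Scaling
variable {k : Type*} [Field k] {A : Type*} [Ring A] [Algebra k A]
  (𝒜 : ℕ → Submodule k A) [GradedAlgebra 𝒜]

/-- The endomorphism `a ↦ 2^|a| a` of a graded algebra, which makes weight spaces eigenspaces. -/
noncomputable def weightScale : A →ₐ[k] A :=
  (DirectSum.toAlgebra k (fun i => 𝒜 i) (fun i => (2 : k) ^ i • (𝒜 i).subtype)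
    (by simp)
    (fun {i j} x y => by
      simp only [LinearMap.smul_apply, Submodule.subtype_apply, pow_add, smul_mul_smul_comm]
      rfl)).comp (DirectSum.decomposeAlgEquiv 𝒜).toAlgHom

theorem weightScale_of_mem {i : ℕ} {a : A} (h : a ∈ 𝒜 i) : weightScale 𝒜 a = (2 : k) ^ i • a := by
  have := DirectSum.decompose_of_mem 𝒜 h
  have h2 : weightScale 𝒜 a = DirectSum.toAddMonoid
    (fun i : ℕ => ((2 : k) ^ i • (𝒜 i).subtype).toAddMonoidHom) (decompose 𝒜 a) := rfl
  rw [h2, this, DirectSum.toAddMonoid_of]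
  rfl

theorem tensorPart_le_eigenspace [CharZero k] (n : ℤ) : tensorPart 𝒜 n ≤ Module.End.eigenspace
    (TensorProduct.map (weightScale 𝒜).toLinearMap (weightScale 𝒜).toLinearMap) ((2 : k) ^ n) := by
  refine Submodule.span_le.2 ?_
  rintro _ ⟨p, q, x, y, hx, hy, rfl, rfl⟩
  rw [SetLike.mem_coe, Module.End.mem_eigenspace_iff, TensorProduct.map_tmul,
    AlgHom.toLinearMap_apply, AlgHom.toLinearMap_apply, weightScale_of_mem 𝒜 hx,
    weightScale_of_mem 𝒜 hy, ← TensorProduct.smul_tmul', TensorProduct.tmul_smul, smul_smul,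
    zpow_add₀ two_ne_zero, zpow_natCast, zpow_natCast]

end Scaling

section FormWeights
variable {k : Type*} [Field k] {R A : Type*} [Ring R] [Algebra k R] [Ring A] [Algebra k A]
  (ρ : R →ₐ[k] A) (𝒜 : ℕ → Submodule k A)

/-- The 1-forms of weight `n`. -/
noncomputable def Omega1.part (n : ℤ) : Submodule k (Omega1 ρ) :=
  Submodule.span k {x | ∃ (p q r : ℕ) (a b c : A), a ∈ 𝒜 p ∧ b ∈ 𝒜 q ∧ c ∈ 𝒜 r ∧
    (p + q + r : ℤ) = n ∧ x = env k a b • Omega1.D ρ c}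

variable [GradedAlgebra 𝒜]

namespace Omega1
variable {ρ 𝒜}

theorem D_mem_part {r : ℕ} {c : A} (hc : c ∈ 𝒜 r) : D ρ c ∈ part ρ 𝒜 r :=
  Submodule.subset_span ⟨0, 0, r, 1, 1, c, one_mem_weight_zero 𝒜, one_mem_weight_zero 𝒜, hc,
    by simp, by rw [env_one, one_smul]⟩

theorem env_smul_mem_part {p q : ℕ} {n : ℤ} {a b : A} {ξ : Omega1 ρ} (ha : a ∈ 𝒜 p) (hb : b ∈ 𝒜 q)
    (hξ : ξ ∈ part ρ 𝒜 n) : env k a b • ξ ∈ part ρ 𝒜 (p + n + q) := by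
  induction hξ using Submodule.span_induction with
  | zero => simp
  | add x y _ _ hx hy => rw [smul_add]; exact Submodule.add_mem _ hx hy
  | smul c x _ hx => rw [smul_comm]; exact Submodule.smul_mem _ _ hx
  | mem z h =>
    obtain ⟨p', q', r, x, y, c, hx, hy, hc, rfl, rfl⟩ := h
    rw [smul_smul, env_mul]
    exact Submodule.subset_span ⟨_, _, r, _, _, c, SetLike.mul_mem_graded ha hx,
      SetLike.mul_mem_graded hy hb, hc, by push_cast; ring, rfl⟩

variable (ρ 𝒜) in
/-- The bimodule structure of `Ω¹` twisted by the endomorphism `a ↦ 2^|a| a` of `A`. -/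
noncomputable def scaleAct : Env k A →ₐ[k] Module.End k (Omega1 ρ) :=
  (Algebra.lsmul k k (Omega1 ρ)).comp
    (show Env k A →ₐ[k] Env k A from
      Algebra.TensorProduct.map (weightScale 𝒜) (weightScale 𝒜).op)

theorem scaleAct_env (a b : A) (ξ : Omega1 ρ) :
    scaleAct ρ 𝒜 (env k a b) ξ = env k (weightScale 𝒜 a) (weightScale 𝒜 b) • ξ := rfl

variable (ρ 𝒜) in
/-- The endomorphism of 1-forms induced by the endomorphism `a ↦ 2^|a| a` of `A`. -/
noncomputable def scale [IsGradedOver 𝒜 ρ] : Module.End k (Omega1 ρ) :=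
  lift ρ (scaleAct ρ 𝒜) (D ρ ∘ₗ (weightScale 𝒜).toLinearMap)
    (fun a b => by simp [scaleAct_env, D_mul])
    (fun r => by
      have := weightScale_of_mem 𝒜 (IsGradedOver.map_mem (𝒜 := 𝒜) (ρ := ρ) r)
      simp [this, D_base])

theorem env_smul_smul (c d : k) (a b : A) (ξ : Omega1 ρ) :
    env k (c • a) (d • b) • ξ = (c * d) • env k a b • ξ := by
  have : env k (c • a) (d • b) = (c * d) • env k a b := by
    rw [env, env, op_smul, ← TensorProduct.smul_tmul', TensorProduct.tmul_smul, smul_smul]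
    rfl
  rw [this, smul_assoc]

theorem part_le_eigenspace [CharZero k] [IsGradedOver 𝒜 ρ] (n : ℤ) :
    part ρ 𝒜 n ≤ Module.End.eigenspace (scale ρ 𝒜) ((2 : k) ^ n) := by
  refine Submodule.span_le.2 ?_
  rintro _ ⟨p, q, r, a, b, c, ha, hb, hc, rfl, rfl⟩
  rw [SetLike.mem_coe, Module.End.mem_eigenspace_iff, scale, lift_smul, lift_D, scaleAct_env,
    weightScale_of_mem 𝒜 ha, weightScale_of_mem 𝒜 hb, env_smul_smul, LinearMap.comp_apply,
    AlgHom.toLinearMap_apply, weightScale_of_mem 𝒜 hc, map_smul, smul_comm (env k a b), smul_smul,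
    zpow_add₀ two_ne_zero, zpow_add₀ two_ne_zero, zpow_natCast, zpow_natCast, zpow_natCast]

end Omega1

namespace Forms
variable {ρ 𝒜}

/-- A product of functions and exact forms which has form degree `0` is a function, and one of form
degree `1` is a 1-form of the same weight. -/
theorem IsHom.exists_of_degree_le_one {w p : ℕ} {x : Forms ρ} (h : IsHom ρ 𝒜 x w p) :
    (p = 0 → ∃ a ∈ 𝒜 w, x = Forms.base ρ a) ∧
    (p = 1 → ∃ ξ ∈ Omega1.part ρ 𝒜 w, x = TensorAlg.gen k ξ) := by
  induction h with
  | @base w a h => exact ⟨fun _ => ⟨a, h, rfl⟩, fun h => by omega⟩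
  | @D w a h => exact ⟨fun h => by omega, fun _ => ⟨_, Omega1.D_mem_part h, rfl⟩⟩
  | @mul x y w p w' p' _ _ ix iy =>
    refine ⟨fun h => ?_, fun h => ?_⟩
    · obtain ⟨a, ha, rfl⟩ := ix.1 (by omega)
      obtain ⟨b, hb, rfl⟩ := iy.1 (by omega)
      exact ⟨a * b, SetLike.mul_mem_graded ha hb, (map_mul _ _ _).symm⟩
    · obtain ⟨rfl, rfl⟩ | ⟨rfl, rfl⟩ : (p = 0 ∧ p' = 1) ∨ (p = 1 ∧ p' = 0) := by omega
      · obtain ⟨a, ha, rfl⟩ := ix.1 rfl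
        obtain ⟨ξ, hξ, rfl⟩ := iy.2 rfl
        refine ⟨env k a 1 • ξ, ?_, by rw [gen_env, map_one, mul_one]⟩
        have := Omega1.env_smul_mem_part ha (one_mem_weight_zero 𝒜) hξ
        simpa using this
      · obtain ⟨ξ, hξ, rfl⟩ := ix.2 rfl
        obtain ⟨b, hb, rfl⟩ := iy.1 rfl
        refine ⟨env k 1 b • ξ, ?_, by rw [gen_env, map_one, one_mul]⟩
        have := Omega1.env_smul_mem_part (one_mem_weight_zero 𝒜) hb hξ
        simpa using this

theorem part_one_le (w : ℕ) :
    part ρ 𝒜 w 1 ≤ (Omega1.part ρ 𝒜 w).map (TensorAlg.gen k) := by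
  refine Submodule.span_le.2 fun x hx => ?_
  obtain ⟨ξ, hξ, rfl⟩ := (IsHom.exists_of_degree_le_one hx).2 rfl
  exact ⟨ξ, hξ, rfl⟩

theorem circ_mem [CharZero k] [IsGradedOver 𝒜 ρ] {w : ℤ} {z : Forms ρ ⊗[k] Forms ρ}
    (hz : z ∈ tpart ρ 𝒜 w 1) : circ ρ 𝒜 z ∈ (Omega1.part ρ 𝒜 w).map (TensorAlg.gen k) := by
  induction hz using Submodule.span_induction with
  | zero => simp
  | add x y _ _ hx hy => rw [map_add]; exact Submodule.add_mem _ hx hy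
  | smul c x _ hx => rw [map_smul]; exact Submodule.smul_mem _ _ hx
  | mem z h =>
    obtain ⟨w₁, p₁, w₂, p₂, u, v, hu, hv, rfl, hp, rfl⟩ := h
    rw [circ_tmul hu hv]
    have := part_mul hv hu
    rw [show p₂ + p₁ = 1 by omega] at this
    have := part_one_le _ this
    rw [Nat.cast_add, add_comm] at this
    exact Submodule.smul_mem _ _ this

end Forms

variable [CharZero k] [IsGradedOver 𝒜 ρ]
variable {ρ 𝒜} {N : ℕ} {ω : DR ρ 𝒜}

/-- The contraction of `ω` is a 1-form, so that the projection to `Ω¹` in the definition of `iota` loses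
nothing. -/
theorem exists_gen_eq_contract (hω : ω ∈ DR.part ρ 𝒜 N 2) (d : ℤ) (Θ : DDerGr 𝒜 ρ d) :
    ∃ ξ ∈ Omega1.part ρ 𝒜 (N + d), DR.contract ρ 𝒜 d Θ ω = TensorAlg.gen k ξ := by
  obtain ⟨η, hη, rfl⟩ := hω
  have h := Forms.contract_mem d Θ hη
  rw [show ((2 : ℕ) : ℤ) - 1 = 1 by norm_num] at h
  obtain ⟨ξ, hξ, e⟩ := Forms.circ_mem h
  exact ⟨ξ, hξ, e.symm⟩

theorem iota_lof (ω : DR ρ 𝒜) (d : ℤ) (Θ : DDerGr 𝒜 ρ d) :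
    iota ρ 𝒜 ω (DirectSum.lof k ℤ (fun d => DDerGr 𝒜 ρ d) d Θ) =
      TensorAlg.toGen (DR.contract ρ 𝒜 d Θ ω) := by
  rw [iota, DirectSum.toModule_lof]
  rfl

theorem iota_lof_mem (hω : ω ∈ DR.part ρ 𝒜 N 2) (d : ℤ) (Θ : DDerGr 𝒜 ρ d) :
    iota ρ 𝒜 ω (DirectSum.lof k ℤ (fun d => DDerGr 𝒜 ρ d) d Θ) ∈ Omega1.part ρ 𝒜 (N + d) := by
  obtain ⟨ξ, hξ, e⟩ := exists_gen_eq_contract hω d Θ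
  rw [iota_lof, e, TensorAlg.toGen_gen]
  exact hξ

/-- The twisted bimodule property `ι(aΘb) = (-1)^(N|b|) a ι(Θ) b`: the sign comes from moving `b` past
`ω`, which has weight `N`. -/
theorem iota_act (hω : ω ∈ DR.part ρ 𝒜 N 2) {i j : ℕ} {a b : A} (ha : a ∈ 𝒜 i) (hb : b ∈ 𝒜 j)
    {d : ℤ} (Θ : DDerGr 𝒜 ρ d) :
    iota ρ 𝒜 ω (DirectSum.lof k ℤ (fun d => DDerGr 𝒜 ρ d) _ (DDerGr.act ha hb Θ)) =
      sgn k (N * j) • env k a b •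
        iota ρ 𝒜 ω (DirectSum.lof k ℤ (fun d => DDerGr 𝒜 ρ d) d Θ) := by
  obtain ⟨ξ, hξ, e⟩ := exists_gen_eq_contract hω d Θ
  have key : DR.contract ρ 𝒜 _ (DDerGr.act ha hb Θ) ω =
      sgn k (N * j) • TensorAlg.gen k (env k a b • ξ) := by
    rw [Forms.gen_env, ← e]
    obtain ⟨η, hη, rfl⟩ := hω
    change Forms.circ ρ 𝒜 (Forms.contract ρ 𝒜 _ (DDerGr.act ha hb Θ) η) =
      sgn k (N * j) • (_ * Forms.circ ρ 𝒜 (Forms.contract ρ 𝒜 d Θ η) * _)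
    rw [Forms.contract_act, Forms.weightAut_of_mem _ hη, map_smul, map_smul, map_smul,
      Forms.circ_innerGr ha hb (Forms.contract_mem d Θ hη), mul_comm (j : ℤ)]
  rw [iota_lof, iota_lof, key, e, map_smul, TensorAlg.toGen_gen, TensorAlg.toGen_gen]

end FormWeights

/-! ### Dual bases and the canonical map -/

section EnvTensor
variable {k : Type*} [Field k] {A : Type*} [Ring A] [Algebra k A]

/-- The linear map `Env k A → A ⊗ A` with `env a b ↦ a ⊗ b`. -/
noncomputable def envTensor : Env k A →ₗ[k] A ⊗[k] A :=
  (TensorProduct.map (LinearMap.id (R := k) (M := A)) (opLinearEquiv k (M := A)).symm.toLinearMap : _)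

theorem envTensor_env (a b : A) : envTensor (env k a b) = a ⊗ₜ b := rfl

theorem envTensor_env_mul (a b : A) (e : Env k A) :
    envTensor (env k a b * e) = (a ⊗ₜ 1) * envTensor e * (1 ⊗ₜ b) := by
  induction e using env_induction with
  | h x y => simp [env_mul, envTensor_env]
  | hadd x y hx hy => simp only [mul_add, map_add, hx, hy, add_mul]

/-- The linear map `A ⊗ A → Env k A` with `u ⊗ v ↦ env v u`. -/
noncomputable def revEnv : A ⊗[k] A →ₗ[k] Env k A :=
  (show A ⊗[k] A →ₗ[k] Env k A from
    TensorProduct.map (LinearMap.id (R := k) (M := A)) (opLinearEquiv k (M := A)).toLinearMap) ∘ₗ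
    (TensorProduct.comm k A A).toLinearMap

theorem revEnv_tmul (u v : A) : revEnv (u ⊗ₜ[k] v) = env k v u := rfl

variable (𝒜 : ℕ → Submodule k A) [GradedAlgebra 𝒜]

/-- The inverse of `revKoszul`: the map `u ⊗ v ↦ (-1)^(|u||v|) env v u`. -/
noncomputable def koszulEnv : A ⊗[k] A →ₗ[k] Env k A := revEnv ∘ₗ koszul (signAut 𝒜 1)

variable [CharZero k]

theorem koszul_signAut_tmul {i j : ℕ} {u v : A} (hu : u ∈ 𝒜 i) (hv : v ∈ 𝒜 j) :
    koszul (signAut 𝒜 1) (u ⊗ₜ v) = sgn k (i * j) • (u ⊗ₜ[k] v) :=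
  koszul_tmul _ (by simpa using signAut_of_mem 𝒜 1 hu) (by simpa using signAut_of_mem 𝒜 1 hv)

theorem koszulEnv_tmul {i j : ℕ} {u v : A} (hu : u ∈ 𝒜 i) (hv : v ∈ 𝒜 j) :
    koszulEnv 𝒜 (u ⊗ₜ v) = sgn k (i * j) • env k v u := by
  rw [koszulEnv, LinearMap.comp_apply, koszul_signAut_tmul 𝒜 hu hv, map_smul, revEnv_tmul]

theorem revKoszul_koszulEnv (z : A ⊗[k] A) : revKoszul 𝒜 (koszulEnv 𝒜 z) = z := by
  induction z using homogeneous_tensor_induction 𝒜 with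
  | h i j u hu v hv =>
    rw [koszulEnv_tmul 𝒜 hu hv, map_smul, revKoszul_env, koszul_signAut_tmul 𝒜 hu hv, smul_smul,
      sgn_sq, one_smul]
  | hadd x y hx hy => rw [map_add, map_add, hx, hy]

/-- The map `koszulEnv` identifies `A ⊗ A`, with its inner graded bimodule structure, with `Env k A` as a
left module over itself. -/
theorem koszulEnv_innerGr {i j : ℕ} {a b : A} (ha : a ∈ 𝒜 i) (hb : b ∈ 𝒜 j) (z : A ⊗[k] A) :
    koszulEnv 𝒜 (innerGr 𝒜 i j a b z) = env k a b * koszulEnv 𝒜 z := by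
  induction z using homogeneous_tensor_induction 𝒜 with
  | h p q u hu v hv =>
    rw [innerGr_tmul, map_smul, koszulEnv_tmul 𝒜 hu hv, signAut_of_mem 𝒜 _ hu,
      signAut_of_mem 𝒜 _ hv, smul_mul_assoc, mul_smul_comm, ← TensorProduct.smul_tmul',
      TensorProduct.tmul_smul, map_smul, map_smul,
      koszulEnv_tmul 𝒜 (SetLike.mul_mem_graded hu hb) (SetLike.mul_mem_graded ha hv),
      smul_smul, smul_smul, smul_smul, ← sgn_add, ← sgn_add, ← sgn_add, mul_smul_comm, env_mul]
    congr 1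
    apply sgn_eq_of_even
    exact ⟨i * j + i * p + j * q, by push_cast; ring⟩
  | hadd x y hx hy => simp only [map_add, hx, hy, mul_add]

omit [CharZero k] in
theorem env_homogeneous_induction {P : Env k A → Prop} (e : Env k A)
    (h : ∀ i j, ∀ a ∈ 𝒜 i, ∀ b ∈ 𝒜 j, P (env k a b)) (hadd : ∀ x y, P x → P y → P (x + y)) :
    P e := by
  induction e using env_induction with
  | hadd x y hx hy => exact hadd x y hx hy
  | h a b =>
    exact homogeneous_tensor_induction 𝒜 (P := fun z => P (revEnv z)) (b ⊗ₜ a)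
      (fun i j u hu v hv => h j i v hv u hu)
      (fun z w hz hw => by rw [map_add]; exact hadd _ _ hz hw)

variable {B : Type*} [Ring B] [Algebra k B] (φ : B →ₐ[k] A)

variable (k) in
omit [CharZero k] in
/-- The algebra map of enveloping algebras induced by `φ`. -/
noncomputable def envMap : Env k B →ₐ[k] Env k A := Algebra.TensorProduct.map φ φ.op

omit [CharZero k] in
theorem envMap_env (a b : B) : envMap k φ (env k a b) = env k (φ a) (φ b) := rfl

omit [CharZero k] in
theorem outer_add (z w : A ⊗[k] A) : outer φ (z + w) = outer φ z + outer φ w := by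
  refine TensorProduct.ext' fun u v => ?_
  simp [outer_tmul, mul_add, add_mul]

/-- Under `koszulEnv`, the outer action of `B ⊗ B` becomes right multiplication by elements of `Env k B`. -/
theorem koszulEnv_outer [IsGradedOver 𝒜 φ] (e : Env k A) (z : B ⊗[k] B) :
    koszulEnv 𝒜 (outer φ (revKoszul 𝒜 e) z) = e * envMap k φ (revEnv z) := by
  induction e using env_induction with
  | hadd x y hx hy =>
    rw [add_mul, ← hx, ← hy, map_add, outer_add, LinearMap.add_apply, map_add]
  | h a b =>
    induction z with
    | zero => simp
    | add x y hx hy => simp only [map_add, hx, hy, mul_add]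
    | tmul u v =>
      rw [outer_tmul, revEnv_tmul, envMap_env, env_mul, revKoszul_env]
      have hh := homogeneous_tensor_induction 𝒜 (P := fun z => koszulEnv 𝒜
        ((φ u ⊗ₜ 1) * koszul (signAut 𝒜 1) z * (1 ⊗ₜ φ v)) =
          revEnv z * env k (φ v) (φ u)) (b ⊗ₜ a) (fun i j x hx y hy => by
            have hu := SetLike.mul_mem_graded (IsGradedOver.map_mem (𝒜 := 𝒜) (ρ := φ) u) hx
            have hv := SetLike.mul_mem_graded hy (IsGradedOver.map_mem (𝒜 := 𝒜) (ρ := φ) v)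
            rw [zero_add] at hu
            rw [add_zero] at hv
            rw [koszul_signAut_tmul 𝒜 hx hy, mul_smul_comm, smul_mul_assoc, map_smul,
              Algebra.TensorProduct.tmul_mul_tmul, Algebra.TensorProduct.tmul_mul_tmul, mul_one,
              one_mul, koszulEnv_tmul 𝒜 hu hv, smul_smul, sgn_sq, one_smul, revEnv_tmul, env_mul])
          (fun x y hx hy => by simp only [map_add, mul_add, add_mul, hx, hy])
      rw [hh, revEnv_tmul, env_mul]

end EnvTensor

section DualBasis
variable {k : Type*} [Field k] {R B : Type*} [Ring R] [Algebra k R] [Ring B] [Algebra k B]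
  {ρ : R →ₐ[k] B}

theorem Omega1.span_D_image {s : Set B} (hs : Algebra.adjoin k (Set.range ρ ∪ s) = ⊤) :
    Submodule.span (Env k B) (D ρ '' s) = ⊤ := by
  rw [eq_top_iff, ← span_D, Submodule.span_le]
  rintro _ ⟨x, rfl⟩
  have hx : x ∈ Algebra.adjoin k (Set.range ρ ∪ s) := by rw [hs]; trivial
  rw [SetLike.mem_coe]
  induction hx using Algebra.adjoin_induction with
  | mem x hx =>
    obtain ⟨r, rfl⟩ | hx := hx
    · rw [D_base]; exact Submodule.zero_mem _
    · exact Submodule.subset_span ⟨x, hx, rfl⟩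
  | algebraMap c => rw [← ρ.commutes c, D_base]; exact Submodule.zero_mem _
  | add x y _ _ hx hy => rw [map_add]; exact Submodule.add_mem _ hx hy
  | mul x y _ _ hx hy =>
    rw [D_mul]
    exact Submodule.add_mem _ (Submodule.smul_mem _ _ hx) (Submodule.smul_mem _ _ hy)

/-- The bimodule of 1-forms of a smooth algebra has a finite dual basis consisting of exact forms. -/
theorem IsSmooth.exists_dual_basis (hB : IsSmooth ρ) :
    ∃ (s : Finset B) (f : s → Omega1 ρ →ₗ[Env k B] Env k B),
      ∀ ξ, ξ = ∑ i, f i ξ • Omega1.D ρ (i : B) := by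
  obtain ⟨s, hs⟩ := hB.finite
  have := hB.projective
  let p : (s → Env k B) →ₗ[Env k B] Omega1 ρ :=
    Fintype.linearCombination (Env k B) fun i : s => Omega1.D ρ (i : B)
  have hp : Function.Surjective p := by
    rw [← LinearMap.range_eq_top, Fintype.range_linearCombination, ← Omega1.span_D_image hs]
    congr 1
    ext x
    simp
  obtain ⟨g, hg⟩ := Module.projective_lifting_property p LinearMap.id hp
  refine ⟨s, fun i => LinearMap.proj i ∘ₗ g, fun ξ => ?_⟩
  exact (LinearMap.congr_fun hg ξ).symm

/-- The double derivation `b ↦ f (d b)` attached to a functional `f` on the bimodule of 1-forms. -/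
noncomputable def DDer.ofFunctional (f : Omega1 ρ →ₗ[Env k B] Env k B) : DDer ρ :=
  ⟨envTensor ∘ₗ f.restrictScalars k ∘ₗ Omega1.D ρ, fun r => by simp [Omega1.D_base], fun a b => by
    simp [Omega1.D_mul, envTensor_env_mul, ← Algebra.TensorProduct.one_def]⟩

theorem DDer.toLin_ofFunctional (f : Omega1 ρ →ₗ[Env k B] Env k B) (b : B) :
    DDer.toLin (DDer.ofFunctional f) b = envTensor (f (Omega1.D ρ b)) := rfl

variable {C : Type*} [Ring C] [Algebra k C]

/-- The outer `B`-bimodule structure on `C ⊗ C`, for an algebra map `φ : B → C`. -/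
noncomputable def outerAct (φ : B →ₐ[k] C) : Env k B →ₐ[k] Module.End k (C ⊗[k] C) :=
  Algebra.TensorProduct.lift (A := B) (B := Bᵐᵒᵖ)
    ((Algebra.lmul k (C ⊗[k] C)).comp (Algebra.TensorProduct.includeLeft.comp φ))
    (AlgHom.ofLinearMap ((LinearMap.mul k (C ⊗[k] C)).flip ∘ₗ
      (Algebra.TensorProduct.includeRight (R := k) (A := C) (B := C)).toLinearMap ∘ₗ
        φ.toLinearMap ∘ₗ (opLinearEquiv k).symm.toLinearMap)
      (by ext; simp) (by intro x y; ext; simp [mul_assoc]))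
    (by intro x y; ext; simp)

theorem outerAct_env (φ : B →ₐ[k] C) (a b : B) (z : C ⊗[k] C) :
    outerAct φ (env k a b) z = (φ a ⊗ₜ 1) * z * (1 ⊗ₜ φ b) := by
  refine (DFunLike.congr_fun (Algebra.TensorProduct.lift_tmul _ _ _ a (op b)) z).trans ?_
  simp [mul_assoc]

theorem outerAct_eq_outer (φ : B →ₐ[k] C) (e : Env k B) (z : C ⊗[k] C) :
    outerAct φ e z = outer φ z (envTensor e) := by
  induction e using env_induction with
  | h a b => rw [outerAct_env, envTensor_env, outer_tmul]
  | hadd x y hx hy => rw [map_add, map_add, map_add, ← hx, ← hy]; rfl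

/-- A derivation of `B` into `C ⊗ C` is determined by its values on a dual basis of the 1-forms. -/
theorem derivation_eq_sum {s : Finset B} {f : s → Omega1 ρ →ₗ[Env k B] Env k B}
    (hf : ∀ ξ, ξ = ∑ i, f i ξ • Omega1.D ρ (i : B)) (φ : B →ₐ[k] C) {T : B →ₗ[k] C ⊗[k] C}
    (hR : ∀ r, T (ρ r) = 0)
    (hT : ∀ a b, T (a * b) = T a * (1 ⊗ₜ φ b) + (φ a ⊗ₜ 1) * T b) (b : B) :
    T b = ∑ i : s, outer φ (T i) (DDer.toLin (DDer.ofFunctional (f i)) b) := by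
  have hmul : ∀ a b, T (a * b) = outerAct φ (env k 1 b) (T a) + outerAct φ (env k a 1) (T b) := by
    intro a b
    rw [hT, outerAct_env, outerAct_env, map_one, ← Algebra.TensorProduct.one_def, one_mul, mul_one]
  have e := congrArg (Omega1.lift ρ (outerAct φ) T hmul hR) (hf (Omega1.D ρ b))
  rw [Omega1.lift_D, map_sum] at e
  rw [e]
  refine Finset.sum_congr rfl fun i _ => ?_
  rw [Omega1.lift_smul, Omega1.lift_D, outerAct_eq_outer, DDer.toLin_ofFunctional]

/-- For `A = B`, the outer action of `w` on `z` is the inner action of `z` on `w`. -/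
theorem outer_id_eq_innerAct (z w : B ⊗[k] B) :
    outer (AlgHom.id k B) z w = DDer.innerAct k B (revEnv z) w := by
  induction z with
  | zero =>
    induction w with
    | zero => simp
    | tmul u v => simp [outer_tmul]
    | add x y hx hy => simp only [map_add, hx, hy]
  | add s t hs ht =>
    rw [outer_add, map_add, map_add, LinearMap.add_apply, LinearMap.add_apply, hs, ht]
  | tmul x y =>
    induction w with
    | zero => simp
    | tmul u v => simp [outer_tmul, revEnv_tmul, DDer.innerAct_tmul]
    | add x y hx hy => simp only [map_add, hx, hy]

/-- The double derivations of `B` are generated by the ones attached to a dual basis of the 1-forms. -/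
theorem DDer.eq_sum {s : Finset B} {f : s → Omega1 ρ →ₗ[Env k B] Env k B}
    (hf : ∀ ξ, ξ = ∑ i, f i ξ • Omega1.D ρ (i : B)) (θ : DDer ρ) :
    θ = ∑ i : s, revEnv (DDer.toLin θ i) • DDer.ofFunctional (f i) := by
  refine DDer.toLin_injective ρ (LinearMap.ext fun b => ?_)
  refine (derivation_eq_sum hf (AlgHom.id k B) θ.2.1 (fun a b => θ.2.2 a b) b).trans ?_
  simp only [map_sum, LinearMap.sum_apply, DDer.toLin_smul, outer_id_eq_innerAct]
  rfl

end DualBasis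

section CanInverse
variable {k : Type*} [Field k] {R B A : Type*} [Ring R] [Algebra k R] [Ring B] [Algebra k B]
  [Ring A] [Algebra k A]

namespace BiTensor
variable {X : Type*} [AddCommGroup X] [Module k X] [Module (Env k B) X] (φ : B →ₐ[k] A)

theorem tmul_eq_env_smul (a a' : A) (x : X) : tmul φ a x a' = env k a a' • incl φ x := by
  change _ = env k a a' • Submodule.Quotient.mk (1 ⊗ₜ x)
  rw [← Submodule.Quotient.mk_smul, TensorProduct.smul_tmul', smul_eq_mul, mul_one]
  rfl

theorem incl_smul (e : Env k B) (x : X) : incl φ (e • x) = envMap k φ e • incl φ x := by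
  induction e using env_induction with
  | h a b => exact incl_env φ a b x
  | hadd x y hx hy => rw [add_smul, map_add, hx, hy, map_add, add_smul]

theorem induction {P : BiTensor φ X → Prop} (t : BiTensor φ X)
    (h : ∀ (a : A) (x : X) (a' : A), P (env k a a' • incl φ x))
    (hadd : ∀ s t, P s → P t → P (s + t)) : P t := by
  obtain ⟨z, rfl⟩ := Submodule.Quotient.mk_surjective _ t
  induction z with
  | zero => simpa using h 0 0 0
  | add x y hx hy => rw [Submodule.Quotient.mk_add]; exact hadd _ _ hx hy
  | tmul e x =>
    induction e using env_induction with
    | h a a' => have := h a x a'; rwa [← tmul_eq_env_smul] at this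
    | hadd e e' he he' =>
      rw [TensorProduct.add_tmul, Submodule.Quotient.mk_add]; exact hadd _ _ he he'

theorem incl_mem_part (𝒜 : ℕ → Submodule k A) [GradedAlgebra 𝒜] (x : X) :
    incl φ x ∈ part φ X 𝒜 0 :=
  Submodule.subset_span ⟨0, 0, 1, 1, x, one_mem_weight_zero 𝒜, one_mem_weight_zero 𝒜, rfl, rfl⟩

theorem env_smul_mem_part (𝒜 : ℕ → Submodule k A) [GradedAlgebra 𝒜] [IsScalarTower k (Env k B) X]
    {i j n : ℕ} {a b : A} (ha : a ∈ 𝒜 i) (hb : b ∈ 𝒜 j) {t : BiTensor φ X}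
    (ht : t ∈ part φ X 𝒜 n) : env k a b • t ∈ part φ X 𝒜 (i + n + j) := by
  induction ht using Submodule.span_induction with
  | zero => simp
  | add x y _ _ hx hy => rw [smul_add]; exact Submodule.add_mem _ hx hy
  | smul c x _ hx => rw [smul_comm]; exact Submodule.smul_mem _ _ hx
  | mem z h =>
    obtain ⟨p, q, x, y, m, hx, hy, rfl, rfl⟩ := h
    rw [tmul_eq_env_smul, smul_smul, env_mul, ← tmul_eq_env_smul]
    exact Submodule.subset_span ⟨_, _, _, _, m, SetLike.mul_mem_graded ha hx,
      SetLike.mul_mem_graded hy hb, by ring, rfl⟩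

theorem koszulEnv_smul_incl_mem_part [CharZero k] (𝒜 : ℕ → Submodule k A) [GradedAlgebra 𝒜]
    {n : ℕ} {z : A ⊗[k] A} (hz : z ∈ tensorPart 𝒜 n) (x : X) :
    koszulEnv 𝒜 z • incl φ x ∈ part φ X 𝒜 n := by
  induction hz using Submodule.span_induction with
  | zero => simp
  | add x y _ _ hx hy => rw [map_add, add_smul]; exact Submodule.add_mem _ hx hy
  | smul c x _ hx => rw [map_smul, smul_assoc]; exact Submodule.smul_mem _ _ hx
  | mem z h =>
    obtain ⟨p, q, u, v, hu, hv, e, rfl⟩ := h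
    rw [koszulEnv_tmul 𝒜 hu hv, smul_assoc, ← tmul_eq_env_smul]
    exact Submodule.smul_mem _ _ (Submodule.subset_span ⟨q, p, v, u, x, hv, hu, by omega, rfl⟩)

end BiTensor

variable {ρ : R →ₐ[k] B} (φ : B →ₐ[k] A) (𝒜 : ℕ → Submodule k A) [GradedAlgebra 𝒜]
  {s : Finset B} (f : s → Omega1 ρ →ₗ[Env k B] Env k B)

/-- The inverse of the canonical map, built from a dual basis `(f i, d i)` of the 1-forms of `B`: a
derivation `T : B → A ⊗ A` is sent to the sum of the `T(i)'' ⊗ θ i ⊗ T(i)'`, up to Koszul signs, where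
`θ i` is the double derivation attached to `f i`. -/
noncomputable def canInv : (B →ₗ[k] A ⊗[k] A) →ₗ[k] BiTensor φ (DDer ρ) :=
  ∑ i : s, (LinearMap.toSpanSingleton (Env k A) (BiTensor φ (DDer ρ))
    (BiTensor.incl φ (DDer.ofFunctional (f i)))).restrictScalars k ∘ₗ koszulEnv 𝒜 ∘ₗ
      LinearMap.applyₗ (i : B)

theorem canInv_apply (T : B →ₗ[k] A ⊗[k] A) : canInv φ 𝒜 f T =
    ∑ i : s, koszulEnv 𝒜 (T i) • BiTensor.incl φ (DDer.ofFunctional (f i)) := by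
  simp [canInv]

variable [CharZero k] [IsGradedOver 𝒜 φ]

omit [CharZero k] in
theorem can_env_smul_incl (e : Env k A) (θ : DDer ρ) (b : B) :
    can ρ φ 𝒜 (e • BiTensor.incl φ θ) b = outer φ (revKoszul 𝒜 e) (DDer.toLin θ b) := by
  have : e • BiTensor.incl φ θ = Submodule.Quotient.mk (e ⊗ₜ θ) := by
    change e • Submodule.Quotient.mk (1 ⊗ₜ θ) = _
    rw [← Submodule.Quotient.mk_smul, TensorProduct.smul_tmul', smul_eq_mul, mul_one]
  rw [this]
  exact canAux_tmul ρ φ 𝒜 e θ b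

variable {f} (hf : ∀ ξ, ξ = ∑ i, f i ξ • Omega1.D ρ (i : B))
include hf

/-- The map `canInv` is a left inverse of `can`: as both are linear over `Env k A`, this is the expansion of
a double derivation of `B` in a dual basis. -/
theorem canInv_can (t : BiTensor φ (DDer ρ)) : canInv φ 𝒜 f (can ρ φ 𝒜 t) = t := by
  induction t using BiTensor.induction φ with
  | hadd s t hs ht => rw [map_add, map_add, hs, ht]
  | h a θ a' =>
    rw [canInv_apply]
    conv_rhs => rw [DDer.eq_sum hf θ, map_sum, Finset.smul_sum]
    refine Finset.sum_congr rfl fun i _ => ?_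
    rw [can_env_smul_incl, koszulEnv_outer, mul_smul, BiTensor.incl_smul]

/-- The map `canInv` is a right inverse of `can` on derivations: this is the expansion of a derivation
`B → A ⊗ A` in a dual basis. -/
theorem can_canInv {T : B →ₗ[k] A ⊗[k] A} (hR : ∀ r, T (ρ r) = 0)
    (hT : ∀ a b, T (a * b) = T a * (1 ⊗ₜ φ b) + (φ a ⊗ₜ 1) * T b) :
    can ρ φ 𝒜 (canInv φ 𝒜 f T) = T := by
  refine LinearMap.ext fun b => ?_
  rw [canInv_apply, map_sum, LinearMap.sum_apply]
  refine Eq.trans ?_ (derivation_eq_sum hf φ hR hT b).symm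
  refine Finset.sum_congr rfl fun i _ => ?_
  rw [can_env_smul_incl, revKoszul_koszulEnv]

end CanInverse

/-! ### Double derivations of the tensor algebra -/

section TensorAlgDerivation
variable {k : Type*} [Field k] {B : Type*} [Ring B] [Algebra k B]
  {M : Type*} [AddCommGroup M] [Module k M] [Module (Env k B) M]
  {C : Type*} [Ring C] [Algebra k C]

namespace TensorAlg

theorem gen_smul (e : Env k B) (m : M) :
    gen k (e • m) = sandwich (base k M) e (gen k m : TensorAlg k B M) := by
  induction e using env_induction with
  | h a b => rw [gen_env_smul, sandwich_apply]
  | hadd x y hx hy => rw [add_smul, map_add, hx, hy, map_add, LinearMap.add_apply]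

/-- A derivation of the tensor algebra with respect to two algebra maps `p` and `q` can be prescribed
on `B` and on `M`: it is the corner of an algebra map to upper triangular matrices. -/
theorem exists_derivation (p q : TensorAlg k B M →ₐ[k] C) (δ₀ : B →ₗ[k] C) (δ₁ : M →ₗ[k] C)
    (h₀ : ∀ a b, δ₀ (a * b) = p (base k M a) * δ₀ b + δ₀ a * q (base k M b))
    (h₁ : ∀ b b' m, δ₁ (env k b b' • m) = p (base k M b) * p (gen k m) * δ₀ b' +
      (p (base k M b) * δ₁ m + δ₀ b * q (gen k m)) * q (base k M b')) :
    ∃ δ : TensorAlg k B M →ₗ[k] C, (∀ b, δ (base k M b) = δ₀ b) ∧ (∀ m, δ (gen k m) = δ₁ m) ∧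
      ∀ x y, δ (x * y) = p x * δ y + δ x * q y := by
  have h1 : δ₀ 1 = 0 := by simpa using h₀ 1 1
  let F : TensorAlg k B M →ₐ[k] Matrix (Fin 2) (Fin 2) C := lift
    (AlgHom.ofLinearMap (Forms.triLin (p.comp (base k M)).toLinearMap δ₀
        (q.comp (base k M)).toLinearMap)
      (by simp [Forms.triLin, Forms.tri, h1, Matrix.one_fin_two])
      (fun a b => by simp [Forms.triLin, Forms.tri_mul, h₀]))
    (Forms.triLin (p.toLinearMap ∘ₗ gen k) δ₁ (q.toLinearMap ∘ₗ gen k))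
    (fun b b' m => by simp [Forms.triLin, Forms.tri_mul, h₁, gen_env_smul])
  have hF : ∀ x, F x = Forms.tri (p x) (F x 0 1) (q x) := by
    intro x
    induction x using induction with
    | hb b => simp [F, Forms.triLin, Forms.tri]
    | hg m => simp [F, Forms.triLin, Forms.tri]
    | hadd x y hx hy => rw [map_add, hx, hy, Forms.tri_add]; simp [Forms.tri]
    | hmul x y hx hy => rw [map_mul, hx, hy, Forms.tri_mul]; simp [Forms.tri]
  refine ⟨{ toFun := fun x => F x 0 1, map_add' := by simp, map_smul' := by simp }, ?_, ?_, ?_⟩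
  · intro b; simp [F, Forms.triLin, Forms.tri]
  · intro m; simp [F, Forms.triLin, Forms.tri]
  · intro x y
    change F (x * y) 0 1 = _
    rw [map_mul, hF x, hF y, Forms.tri_mul]
    simp [Forms.tri]

end TensorAlg
end TensorAlgDerivation

section Extension
variable {k : Type*} [Field k] {B : Type*} [Ring B] [Algebra k B] {N : ℕ} (E : Fin N → Type*)
  [∀ i, AddCommGroup (E i)] [∀ i, Module k (E i)] [∀ i, Module (Env k B) (E i)]
  {R : Type*} [Ring R] [Algebra k R] (ρ : R →ₐ[k] B)

namespace TAlg

variable {E ρ} in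
/-- A double derivation of weight `d` of `A = T_B M` can be prescribed on `B` and on `M`. -/
theorem exists_DDerGr {d : ℤ} (T : B →ₗ[k] TAlg k B E ⊗[k] TAlg k B E)
    (T' : (∀ i, E i) →ₗ[k] TAlg k B E ⊗[k] TAlg k B E) (hR : ∀ r, T (ρ r) = 0)
    (hT : ∀ a b, T (a * b) = T a * (1 ⊗ₜ base k B E b) + (base k B E a ⊗ₜ 1) * T b)
    (hT' : ∀ b b' m, T' (env k b b' • m) =
      (base k B E b ⊗ₜ 1) * (signAut (weight k B E) d (TensorAlg.gen k m) ⊗ₜ 1) * T b' +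
      ((base k B E b ⊗ₜ 1) * T' m + T b * (1 ⊗ₜ TensorAlg.gen k m)) * (1 ⊗ₜ base k B E b'))
    (hw : ∀ b, T b ∈ tensorPart (weight k B E) d)
    (hw' : ∀ i (e : E i), T' (Pi.single i e) ∈ tensorPart (weight k B E) (i + 1 + d)) :
    ∃ Θ : DDerGr (weight k B E) ((base k B E).comp ρ) d,
      (∀ b, Θ.1 (base k B E b) = T b) ∧ ∀ m, Θ.1 (TensorAlg.gen k m) = T' m := by
  have hs : ∀ b, signAut (weight k B E) d (base k B E b) = base k B E b := fun b =>
    signAut_of_mem_zero _ d (base_mem E b)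
  obtain ⟨Θ, h0, h1, h2⟩ := TensorAlg.exists_derivation
    (Algebra.TensorProduct.includeLeft.comp (signAut (weight k B E) d))
    (Algebra.TensorProduct.includeRight (R := k) (A := TAlg k B E) (B := TAlg k B E)) T T'
    (fun a b => by
      rw [hT, add_comm]
      simp [hs])
    (fun b b' m => by
      rw [hT']
      simp [hs])
  refine ⟨⟨Θ, mem_DDerGr (fun r => by simp [h0, hR]) (fun n a ha => ?_) (fun a b => h2 a b)⟩,
    h0, h1⟩
  induction ha using Submodule.span_induction with
  | zero => simp
  | add x y _ _ hx hy => rw [map_add]; exact Submodule.add_mem _ hx hy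
  | smul c x _ hx => rw [map_smul]; exact Submodule.smul_mem _ _ hx
  | mem x h =>
    induction h with
    | base b => rw [h0]; simpa using hw b
    | gen i e => rw [h1]; simpa using hw' i e
    | @mul x y m n hx hy ix iy =>
      rw [h2]
      have hx' : x ∈ weight k B E m := Submodule.subset_span hx
      have hy' : y ∈ weight k B E n := Submodule.subset_span hy
      have e1 := tensorPart_mul_left (signAut_mem _ d hx') iy
      have e2 := tensorPart_mul_right hy' ix
      rw [show ((m + n : ℕ) : ℤ) + d = m + (n + d) by push_cast; ring]
      rw [show (m : ℤ) + d + n = m + (n + d) by ring] at e2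
      exact Submodule.add_mem _ e1 e2

variable (k B) in
omit [∀ i, Module k (E i)] in
/-- The bimodule `M` has a finite dual basis of homogeneous elements. -/
theorem exists_dual_basis [∀ i, Module.Finite (Env k B) (E i)]
    [∀ i, Module.Projective (Env k B) (E i)] :
    ∃ (I : Type) (_ : Fintype I) (deg : I → Fin N) (e : ∀ x, E (deg x))
      (f : ∀ x, E (deg x) →ₗ[Env k B] Env k B),
      ∀ m : ∀ i, E i, m = ∑ x, f x (m (deg x)) • Pi.single (deg x) (e x) := by
  have h : ∀ i, ∃ (n : ℕ) (e : Fin n → E i) (f : Fin n → E i →ₗ[Env k B] Env k B),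
      ∀ m, m = ∑ l, f l m • e l := by
    intro i
    obtain ⟨n, p, g, -, -, hpg⟩ := Module.Finite.exists_comp_eq_id_of_projective (Env k B) (E i)
    refine ⟨n, fun l => p (Pi.single l 1), fun l => LinearMap.proj l ∘ₗ g, fun m => ?_⟩
    have h1 : p (g m) = m := LinearMap.congr_fun hpg m
    conv_lhs => rw [← h1, LinearMap.pi_apply_eq_sum_univ p (g m)]
    refine Finset.sum_congr rfl fun l _ => ?_
    simp only [LinearMap.comp_apply, LinearMap.proj_apply]
    congr 2
    ext j
    simp [Pi.single_apply, eq_comm]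
  choose n e f h using h
  refine ⟨Σ i, Fin (n i), inferInstance, fun x => x.1, fun x => e x.1 x.2, fun x => f x.1 x.2,
    fun m => ?_⟩
  rw [Fintype.sum_sigma]
  conv_lhs => rw [← Finset.univ_sum_single m]
  refine Finset.sum_congr rfl fun i _ => ?_
  simp only [← Pi.single_smul]
  conv_lhs => rw [h i (m i)]
  exact map_sum (AddMonoidHom.single E i) _ _

variable {E}
/-- For `g` in `A` and a derivation `T : B → A ⊗ A`, the value `T(b) g b' ± b g T(b')` at `b g b'` of an
extension of `T` which vanishes at `g`, with the sign built into `s`. -/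
noncomputable def leibniz (T : B →ₗ[k] TAlg k B E ⊗[k] TAlg k B E)
    (s : TAlg k B E →ₐ[k] TAlg k B E) (g : TAlg k B E) :
    Env k B →ₗ[k] TAlg k B E ⊗[k] TAlg k B E :=
  (TensorProduct.lift (LinearMap.mk₂ k
    (fun (b : B) (b' : Bᵐᵒᵖ) => T b * (1 ⊗ₜ (g * base k B E b'.unop)) +
      ((base k B E b * s g) ⊗ₜ 1) * T b'.unop)
    (fun b c b' => by simp only [map_add, add_mul, TensorProduct.add_tmul]; abel)
    (fun c b b' => by
      simp only [map_smul, smul_mul_assoc, ← TensorProduct.smul_tmul', smul_add])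
    (fun b b' c => by
      simp only [unop_add, map_add, mul_add, TensorProduct.tmul_add]; abel)
    (fun c b b' => by
      simp only [unop_smul, map_smul, mul_smul_comm, TensorProduct.tmul_smul, smul_add])) : _)

theorem leibniz_env (T : B →ₗ[k] TAlg k B E ⊗[k] TAlg k B E) (s : TAlg k B E →ₐ[k] TAlg k B E)
    (g : TAlg k B E) (b b' : B) : leibniz T s g (env k b b') =
      T b * (1 ⊗ₜ (g * base k B E b')) + ((base k B E b * s g) ⊗ₜ 1) * T b' :=
  TensorProduct.lift.tmul ..

/-- The compatibility of `leibniz` with the bimodule structure which `exists_DDerGr` asks for. -/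
theorem leibniz_env_mul {T : B →ₗ[k] TAlg k B E ⊗[k] TAlg k B E}
    (hT : ∀ a b, T (a * b) = T a * (1 ⊗ₜ base k B E b) + (base k B E a ⊗ₜ 1) * T b)
    {s : TAlg k B E →ₐ[k] TAlg k B E} (hs : ∀ b, s (base k B E b) = base k B E b)
    (g : TAlg k B E) (b b' : B) (z : Env k B) : leibniz T s g (env k b b' * z) =
      (base k B E b ⊗ₜ 1) * (s (sandwich (base k B E) z g) ⊗ₜ 1) * T b' +
      ((base k B E b ⊗ₜ 1) * leibniz T s g z + T b * (1 ⊗ₜ sandwich (base k B E) z g)) *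
        (1 ⊗ₜ base k B E b') := by
  have h1 : ∀ u v : TAlg k B E, (1 ⊗ₜ[k] (u * v) : TAlg k B E ⊗[k] TAlg k B E) =
      (1 ⊗ₜ u) * (1 ⊗ₜ v) := fun u v => by simp
  have h2 : ∀ u v : TAlg k B E, ((u * v) ⊗ₜ[k] 1 : TAlg k B E ⊗[k] TAlg k B E) =
      (u ⊗ₜ 1) * (v ⊗ₜ 1) := fun u v => by simp
  induction z using env_induction with
  | hadd x y hx hy =>
    simp only [mul_add, add_mul, map_add, LinearMap.add_apply, TensorProduct.add_tmul,
      TensorProduct.tmul_add] at *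
    rw [hx, hy]
    abel
  | h x y =>
    rw [env_mul, leibniz_env, leibniz_env, hT, hT, sandwich_apply]
    simp only [map_mul, hs, h1, h2, mul_add, add_mul, mul_assoc]
    abel

theorem leibniz_mem {d : ℤ} {T : B →ₗ[k] TAlg k B E ⊗[k] TAlg k B E}
    (hw : ∀ b, T b ∈ tensorPart (weight k B E) d) {n : ℕ} {g : TAlg k B E}
    (hg : g ∈ weight k B E n) (z : Env k B) :
    leibniz T (signAut (weight k B E) d) g z ∈ tensorPart (weight k B E) (n + d) := by
  induction z using env_induction with
  | hadd x y hx hy => rw [map_add]; exact Submodule.add_mem _ hx hy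
  | h b b' =>
    rw [leibniz_env]
    refine Submodule.add_mem _ ?_ ?_
    · have := tensorPart_mul_right (SetLike.mul_mem_graded hg (base_mem E b')) (hw b)
      rwa [add_zero, add_comm] at this
    · have := tensorPart_mul_left
        (SetLike.mul_mem_graded (base_mem E b) (signAut_mem _ d hg)) (hw b')
      rwa [zero_add] at this

variable {ρ}
variable [∀ i, IsScalarTower k (Env k B) (E i)]

omit [∀ i, IsScalarTower k (Env k B) (E i)] in
theorem gen_eq_sum {I : Type*} [Fintype I] {deg : I → Fin N} {e : ∀ x, E (deg x)}
    {f : ∀ x, E (deg x) →ₗ[Env k B] Env k B}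
    (h : ∀ m : ∀ i, E i, m = ∑ x, f x (m (deg x)) • Pi.single (deg x) (e x)) (m : ∀ i, E i) :
    (TensorAlg.gen k m : TAlg k B E) = ∑ x,
      sandwich (base k B E) (f x (m (deg x))) (TensorAlg.gen k (Pi.single (deg x) (e x))) := by
  conv_lhs => rw [h m, map_sum]
  exact Finset.sum_congr rfl fun x _ => TensorAlg.gen_smul _ _

/-- A derivation `T : B → A ⊗ A` of weight `d` extends to a double derivation of `A`: for a dual basis
`(f x, e x)` of `M`, the extension to the free bimodule on the `e x` which vanishes at each `e x` is
composed with the embedding of `M` given by the `f x`. -/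
theorem exists_extension [∀ i, Module.Finite (Env k B) (E i)]
    [∀ i, Module.Projective (Env k B) (E i)] {d : ℤ} (T : B →ₗ[k] TAlg k B E ⊗[k] TAlg k B E)
    (hR : ∀ r, T (ρ r) = 0)
    (hT : ∀ a b, T (a * b) = T a * (1 ⊗ₜ base k B E b) + (base k B E a ⊗ₜ 1) * T b)
    (hw : ∀ b, T b ∈ tensorPart (weight k B E) d) :
    ∃ Θ : DDerGr (weight k B E) ((base k B E).comp ρ) d, ∀ b, Θ.1 (base k B E b) = T b := by
  obtain ⟨I, _, deg, e, f, h⟩ := exists_dual_basis k B E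
  let g : I → TAlg k B E := fun x => TensorAlg.gen k (Pi.single (deg x) (e x))
  let T' : (∀ i, E i) →ₗ[k] TAlg k B E ⊗[k] TAlg k B E :=
    ∑ x, leibniz T (signAut (weight k B E) d) (g x) ∘ₗ
      (f x).restrictScalars k ∘ₗ LinearMap.proj (deg x)
  have hT'_apply : ∀ m, T' m =
      ∑ x, leibniz T (signAut (weight k B E) d) (g x) (f x (m (deg x))) := fun m => by
    simp [T', LinearMap.sum_apply]
  have hs : ∀ b, signAut (weight k B E) d (base k B E b) = base k B E b := fun b =>
    signAut_of_mem_zero _ d (base_mem E b)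
  obtain ⟨Θ, hΘ, -⟩ := exists_DDerGr (d := d) T T' hR hT (fun b b' m => by
      rw [hT'_apply, hT'_apply, gen_eq_sum h m]
      simp only [Pi.smul_apply, map_smul, smul_eq_mul, leibniz_env_mul hT hs]
      simp only [map_sum, TensorProduct.sum_tmul, TensorProduct.tmul_sum, Finset.mul_sum,
        Finset.sum_mul, Finset.sum_add_distrib, add_mul]
      rfl) hw (fun i m => by
      rw [hT'_apply]
      refine Submodule.sum_mem _ fun x _ => ?_
      by_cases hx : deg x = i
      · subst hx
        have := leibniz_mem hw (gen_mem E (deg x) (e x)) (f x (Pi.single (deg x) m (deg x)))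
        rw [Nat.cast_add, Nat.cast_one] at this
        exact this
      · rw [Pi.single_eq_of_ne hx, map_zero, map_zero]
        exact Submodule.zero_mem _)
  exact ⟨Θ, hΘ⟩

/-- The double derivation of weight `-|M_i|` which is dual to the functional `f` on `M_i = E i`. -/
theorem exists_dual_DDerGr (i : Fin N) (f : E i →ₗ[Env k B] Env k B) :
    ∃ Θ : DDerGr (weight k B E) ((base k B E).comp ρ) (-(i + 1)),
      (∀ b, Θ.1 (base k B E b) = 0) ∧ ∀ m, Θ.1 (TensorAlg.gen k m) =
        TensorProduct.map (base k B E).toLinearMap (base k B E).toLinearMap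
          (envTensor (f (m i))) := by
  have hmap : ∀ z : B ⊗[k] B, TensorProduct.map (base k B E).toLinearMap (base k B E).toLinearMap z
      ∈ tensorPart (weight k B E) 0 := fun z => by
    induction z with
    | zero => simp
    | add x y hx hy => rw [map_add]; exact Submodule.add_mem _ hx hy
    | tmul u v => exact tmul_mem_tensorPart (base_mem E u) (base_mem E v) (by simp)
  refine exists_DDerGr 0 (TensorProduct.map (base k B E).toLinearMap (base k B E).toLinearMap ∘ₗ
    envTensor ∘ₗ f.restrictScalars k ∘ₗ LinearMap.proj i) (by simp) (by simp)
    (fun b b' m => ?_) (by simp) (fun j e => ?_)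
  · simp only [LinearMap.comp_apply, LinearMap.proj_apply, LinearMap.restrictScalars_apply,
      Pi.smul_apply, map_smul, smul_eq_mul, envTensor_env_mul, LinearMap.zero_apply, mul_zero,
      zero_mul, zero_add, add_zero]
    have := (Algebra.TensorProduct.map (base k B E) (base k B E)).map_mul
    refine (this _ _).trans (congrArg₂ (· * ·) ((this _ _).trans ?_) ?_)
    · exact congrArg₂ (· * ·) (by simp) rfl
    · simp
  · by_cases hj : i = j
    · subst hj
      have := hmap (envTensor (f (Pi.single i e i)))
      rwa [show (i : ℤ) + 1 + -(i + 1) = 0 by ring]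
    · simp [Pi.single_eq_of_ne hj]

omit [∀ i, IsScalarTower k (Env k B) (E i)] in
theorem signAut_gen (d : ℤ) (m : ∀ i, E i) :
    signAut (weight k B E) d (TensorAlg.gen k m) =
      TensorAlg.gen k (fun i : Fin N => sgn k (d * (i + 1)) • m i) := by
  conv_lhs => rw [← Finset.univ_sum_single m]
  conv_rhs => rw [← Finset.univ_sum_single fun i : Fin N => sgn k (d * (i + 1)) • m i]
  simp only [map_sum]
  refine Finset.sum_congr rfl fun i _ => ?_
  rw [signAut_of_mem _ d (gen_mem E i (m i)), Pi.single_smul, map_smul, Nat.cast_add, Nat.cast_one]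

omit [∀ i, IsScalarTower k (Env k B) (E i)] in
theorem innerGr_map_base (i j : ℤ) (a b : TAlg k B E) (w : B ⊗[k] B) :
    innerGr (weight k B E) i j a b
      (TensorProduct.map (base k B E).toLinearMap (base k B E).toLinearMap w) =
    sgn k (i * j) • outer (base k B E) (b ⊗ₜ a) w := by
  induction w with
  | zero => simp
  | add x y hx hy => simp only [map_add, hx, hy, smul_add]
  | tmul u v =>
    rw [TensorProduct.map_tmul, AlgHom.toLinearMap_apply, AlgHom.toLinearMap_apply, innerGr_tmul,
      signAut_of_mem_zero _ i (base_mem E u), signAut_of_mem_zero _ j (base_mem E v), outer_tmul]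
    simp

omit [∀ i, IsScalarTower k (Env k B) (E i)] in
/-- A double derivation which vanishes on `B` is a bimodule map over `B`. -/
theorem map_sandwich {d : ℤ} {Θ : DDerGr (weight k B E) ((base k B E).comp ρ) d}
    (hΘ : ∀ b, Θ.1 (base k B E b) = 0) (z : Env k B) (g : TAlg k B E) :
    Θ.1 (sandwich (base k B E) z g) = outer (base k B E) (Θ.1 g) (envTensor z) := by
  induction z using env_induction with
  | hadd x y hx hy => rw [map_add, LinearMap.add_apply, map_add, hx, hy, map_add, map_add]
  | h b b' =>
    rw [sandwich_apply, DDerGr.map_mul _ _ Θ.2, DDerGr.map_mul _ _ Θ.2, hΘ, hΘ, envTensor_env,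
      outer_tmul, signAut_of_mem_zero _ d (base_mem E b)]
    simp

/-- The double derivations of `A` which vanish on `B` are generated, as a graded bimodule, by double
derivations of negative weight. -/
theorem lof_mem_of_vanishing [∀ i, Module.Finite (Env k B) (E i)]
    [∀ i, Module.Projective (Env k B) (E i)]
    (W : Submodule k (⨁ d : ℤ, DDerGr (weight k B E) ((base k B E).comp ρ) d))
    (hW : ∀ d < 0, ∀ (Θ : DDerGr (weight k B E) ((base k B E).comp ρ) d) (i j : ℕ)
      (a b : TAlg k B E) (ha : a ∈ weight k B E i) (hb : b ∈ weight k B E j),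
      DirectSum.lof k ℤ (fun d => DDerGr (weight k B E) ((base k B E).comp ρ) d) _
        (DDerGr.act ha hb Θ) ∈ W)
    {d : ℤ} (Θ : DDerGr (weight k B E) ((base k B E).comp ρ) d)
    (hΘ : ∀ b, Θ.1 (base k B E b) = 0) :
    DirectSum.lof k ℤ (fun d => DDerGr (weight k B E) ((base k B E).comp ρ) d) d Θ ∈ W := by
  obtain ⟨I, _, deg, e, f, h⟩ := exists_dual_basis k B E
  -- The double derivation which sends `e x` to `z = u ⊗ v`, and the rest of the dual basis to zero, is
  -- `± v Ξ u`, where `Ξ` is dual to `f x`.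
  have key : ∀ x, ∀ z ∈ tensorPart (weight k B E) (deg x + 1 + d),
      ∃ Δ : DDerGr (weight k B E) ((base k B E).comp ρ) d,
        DirectSum.lof k ℤ (fun d => DDerGr (weight k B E) ((base k B E).comp ρ) d) d Δ ∈ W ∧
        (∀ b, Δ.1 (base k B E b) = 0) ∧ ∀ m, Δ.1 (TensorAlg.gen k m) =
          outer (base k B E) z (envTensor (f x (m (deg x)))) := by
    intro x z hz
    obtain ⟨Ξ, hΞ, hΞ'⟩ := exists_dual_DDerGr (ρ := ρ) (deg x) (f x)
    induction hz using Submodule.span_induction with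
    | zero =>
      have h0 : outer (base k B E) (0 : TAlg k B E ⊗[k] TAlg k B E) = 0 :=
        TensorProduct.ext' fun u v => by simp [outer_tmul]
      exact ⟨0, by rw [map_zero]; exact Submodule.zero_mem _, fun _ => rfl, fun _ => by
        rw [h0]; rfl⟩
    | add y z _ _ hy hz =>
      obtain ⟨Δ, h1, h2, h3⟩ := hy
      obtain ⟨Δ', h1', h2', h3'⟩ := hz
      refine ⟨Δ + Δ', by rw [map_add]; exact Submodule.add_mem _ h1 h1', fun b => ?_, fun m => ?_⟩
      · change Δ.1 _ + Δ'.1 _ = 0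
        rw [h2, h2', add_zero]
      · change Δ.1 _ + Δ'.1 _ = _
        rw [h3, h3', outer_add, LinearMap.add_apply]
    | smul c y _ hy =>
      obtain ⟨Δ, h1, h2, h3⟩ := hy
      have hc : outer (base k B E) (c • y) = c • outer (base k B E) y :=
        TensorProduct.ext' fun u v => by simp [outer_tmul]
      refine ⟨c • Δ, by rw [map_smul]; exact Submodule.smul_mem _ _ h1, fun b => ?_, fun m => ?_⟩
      · change c • Δ.1 _ = 0
        rw [h2, smul_zero]
      · change c • Δ.1 _ = _
        rw [h3, hc, LinearMap.smul_apply]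
    | mem z hz =>
      obtain ⟨p, q, u, v, hu, hv, hpq, rfl⟩ := hz
      obtain rfl : d = -(deg x + 1) + q + p := by omega
      refine ⟨(sgn k (q * p) * sgn k (p * (deg x + 1))) • DDerGr.act hv hu Ξ, ?_, fun b => ?_,
        fun m => ?_⟩
      · rw [map_smul]
        exact Submodule.smul_mem _ _ (hW _ (by omega) Ξ _ _ _ _ hv hu)
      · change (sgn k (q * p) * sgn k (p * (deg x + 1))) • (DDerGr.act hv hu Ξ).1 _ = 0
        rw [DDerGr.act_apply, signAut_of_mem_zero _ _ (base_mem E b), hΞ, map_zero, smul_zero]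
      · change (sgn k (q * p) * sgn k (p * (deg x + 1))) • (DDerGr.act hv hu Ξ).1 _ = _
        rw [DDerGr.act_apply, signAut_gen, hΞ', ← LinearMap.restrictScalars_apply k (f x)]
        simp only [map_smul]
        rw [innerGr_map_base, smul_smul, smul_smul, LinearMap.restrictScalars_apply]
        rw [mul_assoc (sgn k _), sgn_sq, mul_one, sgn_sq, one_smul]
  have hmem : ∀ x, Θ.1 (TensorAlg.gen k (Pi.single (deg x) (e x))) ∈
      tensorPart (weight k B E) (deg x + 1 + d) := fun x => by
    simpa using Θ.2.2.1 _ _ (gen_mem E (deg x) (e x))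
  choose Δ h1 h2 h3 using fun x => key x _ (hmem x)
  -- Both sides vanish on `B` and agree on `M`.
  have hsum : Θ = ∑ x, Δ x := by
    have hb : ∀ b, (∑ x, Δ x).1 (base k B E b) = 0 := fun b => by
      simp [h2]
    refine Subtype.ext (LinearMap.ext fun a => ?_)
    induction a using TensorAlg.induction with
    | hb b => rw [hb, hΘ]
    | hg m =>
      have e1 : (∑ x, Δ x).1 (TensorAlg.gen k m) = ∑ x, (Δ x).1 (TensorAlg.gen k m) := by
        simp
      rw [e1, gen_eq_sum h m, map_sum]
      refine Finset.sum_congr rfl fun x _ => ?_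
      rw [map_sandwich hΘ, ← gen_eq_sum h m, h3]
    | hadd a b ha hb => rw [map_add, map_add, ha, hb]
    | hmul a b ha hb =>
      rw [DDerGr.map_mul _ _ Θ.2, DDerGr.map_mul _ _ (∑ x, Δ x).2, ha, hb]
  rw [hsum, map_sum]
  exact Submodule.sum_mem _ fun x _ => h1 x

end TAlg
end Extension

/-! ### The kernel of the projection `ν` -/

section BiTensorLift
variable {k : Type*} [Field k] {B A : Type*} [Ring B] [Algebra k B] [Ring A] [Algebra k A]
  (φ : B →ₐ[k] A) {X : Type*} [AddCommGroup X] [Module k X] [Module (Env k B) X]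
  {Y : Type*} [AddCommGroup Y] [Module k Y]

namespace BiTensor

/-- The universal property of `A ⊗_B X ⊗_B A`, for an `A`-bimodule `Y` with action `Φ`. -/
noncomputable def lift (Φ : Env k A →ₐ[k] Module.End k Y) (g : X →ₗ[k] Y)
    (hg : ∀ b b' x, g (env k b b' • x) = Φ (env k (φ b) (φ b')) (g x)) : BiTensor φ X →ₗ[k] Y :=
  letI : Module (Env k A) Y := Module.compHom Y Φ.toRingHom
  haveI : IsScalarTower k (Env k A) Y := ⟨fun c e x => by
    change Φ (c • e) x = c • Φ e x
    rw [map_smul]; rfl⟩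
  ((rel φ X).liftQ (AlgebraTensorModule.lift (LinearMap.toSpanSingleton (Env k A) (X →ₗ[k] Y) g)) (by
    refine Submodule.span_le.2 ?_
    rintro _ ⟨b, b', x, rfl⟩
    have hs : ∀ (e : Env k A) (x : Y), e • x = Φ e x := fun _ _ => rfl
    simp [hg, hs])).restrictScalars k

section
variable (Φ : Env k A →ₐ[k] Module.End k Y) (g : X →ₗ[k] Y)
    (hg : ∀ b b' x, g (env k b b' • x) = Φ (env k (φ b) (φ b')) (g x))

theorem lift_incl (x : X) : lift φ Φ g hg (incl φ x) = g x := by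
  let _ : Module (Env k A) Y := Module.compHom Y Φ.toRingHom
  change (1 : Env k A) • g x = g x
  exact one_smul _ _

theorem lift_smul (e : Env k A) (t : BiTensor φ X) :
    lift φ Φ g hg (e • t) = Φ e (lift φ Φ g hg t) := by
  let _ : Module (Env k A) Y := Module.compHom Y Φ.toRingHom
  unfold lift
  simp only [LinearMap.restrictScalars_apply, map_smul]
  rfl
end

variable [IsScalarTower k (Env k B) X] {φ}

/-- For a retraction `π` of `φ : B → A`, the map `a ⊗ x ⊗ a' ↦ π a · x · π a'`. -/
noncomputable def retract {π : A →ₐ[k] B} (hπ : ∀ b, π (φ b) = b) : BiTensor φ X →ₗ[k] X :=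
  lift φ ((Algebra.lsmul k k X).comp (envMap k π)) LinearMap.id (fun b b' x => by
    change _ = envMap k π (env k (φ b) (φ b')) • x
    rw [envMap_env, hπ, hπ]
    rfl)

theorem retract_incl {π : A →ₐ[k] B} (hπ : ∀ b, π (φ b) = b) (x : X) :
    retract hπ (incl φ x) = x := lift_incl ..

variable (φ) in
theorem env_smul_mem_part_zero (𝒜 : ℕ → Submodule k A)
    [GradedAlgebra 𝒜] {a b : A} (ha : a ∈ 𝒜 0) (hb : b ∈ 𝒜 0) {t : BiTensor φ X}
    (ht : t ∈ part φ X 𝒜 0) : env k a b • t ∈ part φ X 𝒜 0 := by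
  simpa using env_smul_mem_part φ 𝒜 ha hb ht

end BiTensor
end BiTensorLift

section TensorWeights
variable {k : Type*} [Field k] {B : Type*} [Ring B] [Algebra k B] {N : ℕ} {E : Fin N → Type*}
  [∀ i, AddCommGroup (E i)] [∀ i, Module k (E i)] [∀ i, Module (Env k B) (E i)]
  {R : Type*} [Ring R] [Algebra k R] {ρ : R →ₐ[k] B}

namespace TAlg

theorem exists_base_of_mem_weight_zero {a : TAlg k B E} (ha : a ∈ weight k B E 0) :
    ∃ b, a = base k B E b := by
  have h : ∀ n, ∀ x : TAlg k B E, IsHom E x n → n = 0 → ∃ b, x = base k B E b := by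
    intro n x hx
    induction hx with
    | base b => exact fun _ => ⟨b, rfl⟩
    | gen i e => exact fun h => by omega
    | mul _ _ ix iy =>
      intro h
      obtain ⟨b, rfl⟩ := ix (by omega)
      obtain ⟨b', rfl⟩ := iy (by omega)
      exact ⟨b * b', (map_mul _ _ _).symm⟩
  induction ha using Submodule.span_induction with
  | zero => exact ⟨0, (map_zero _).symm⟩
  | add x y _ _ hx hy =>
    obtain ⟨b, rfl⟩ := hx
    obtain ⟨b', rfl⟩ := hy
    exact ⟨b + b', (map_add _ _ _).symm⟩
  | smul c x _ hx =>
    obtain ⟨b, rfl⟩ := hx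
    exact ⟨c • b, (map_smul _ _ _).symm⟩
  | mem x hx => exact h 0 x hx rfl

theorem exists_incl_of_mem_part_zero {X : Type*} [AddCommGroup X] [Module k X]
    [Module (Env k B) X] {t : BiTensor (base k B E) X}
    (ht : t ∈ BiTensor.part (base k B E) X (weight k B E) 0) :
    ∃ x, t = BiTensor.incl (base k B E) x := by
  induction ht using Submodule.span_induction with
  | zero => exact ⟨0, (map_zero _).symm⟩
  | add x y _ _ hx hy =>
    obtain ⟨b, rfl⟩ := hx
    obtain ⟨b', rfl⟩ := hy
    exact ⟨b + b', (map_add _ _ _).symm⟩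
  | smul c x _ hx =>
    obtain ⟨b, rfl⟩ := hx
    exact ⟨c • b, (map_smul _ _ _).symm⟩
  | mem t h =>
    obtain ⟨i, j, a, a', x, ha, ha', hij, rfl⟩ := h
    obtain ⟨rfl, rfl⟩ : i = 0 ∧ j = 0 := by omega
    obtain ⟨b, rfl⟩ := exists_base_of_mem_weight_zero ha
    obtain ⟨b', rfl⟩ := exists_base_of_mem_weight_zero ha'
    exact ⟨env k b b' • x, by rw [BiTensor.tmul_eq_env_smul, BiTensor.incl_env]⟩

variable (k B E) in
/-- The projection of the tensor algebra onto its part `B` of weight zero. -/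
noncomputable def toBase : TAlg k B E →ₐ[k] B :=
  TensorAlg.lift (AlgHom.id k B) 0 (by simp)

theorem toBase_base (b : B) : toBase k B E (base k B E b) = b := TensorAlg.lift_base ..

variable (i : Fin N)

theorem nu_smul (e : Env k (TAlg k B E)) (ξ : Omega1 ((base k B E).comp ρ)) :
    nu E ρ i (e • ξ) = e • nu E ρ i ξ := Omega1.lift_smul ..

theorem nu_D_base (b : B) : nu E ρ i (Omega1.D _ (base k B E b)) = 0 :=
  (Omega1.lift_D ..).trans (TensorAlg.genDer_base ..)

theorem nu_D_gen (m : ∀ i, E i) :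
    nu E ρ i (Omega1.D _ (TensorAlg.gen k m)) = BiTensor.incl (base k B E) (m i) :=
  (Omega1.lift_D ..).trans (TensorAlg.genDer_gen ..)

theorem nu_D_mul (a b : TAlg k B E) : nu E ρ i (Omega1.D _ (a * b)) =
    env k 1 b • nu E ρ i (Omega1.D _ a) + env k a 1 • nu E ρ i (Omega1.D _ b) := by
  rw [Omega1.D_mul, map_add, nu_smul, nu_smul]

section
variable [∀ i, IsScalarTower k (Env k B) (E i)]

/-- The map `ν` vanishes on `d c` if the weight of `c` is too small, and takes weight `i + 1`, which is that
of the summand with index `i`, to weight zero. -/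
theorem nu_D_of_isHom {n : ℕ} {c : TAlg k B E} (hc : IsHom E c n) :
    (n < i + 1 → nu E ρ i (Omega1.D _ c) = 0) ∧
    (n = i + 1 → nu E ρ i (Omega1.D _ c) ∈
      BiTensor.part (base k B E) (E i) (weight k B E) 0) := by
  induction hc with
  | base b => exact ⟨fun _ => nu_D_base i b, fun h => by omega⟩
  | gen j e =>
    rw [nu_D_gen]
    by_cases h : i = j
    · subst h
      exact ⟨fun h => by omega, fun _ => BiTensor.incl_mem_part _ _ _⟩
    · rw [Pi.single_eq_of_ne h, map_zero]
      exact ⟨fun _ => rfl, fun _ => Submodule.zero_mem _⟩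
  | @mul x y m n hx hy ix iy =>
    rw [nu_D_mul]
    refine ⟨fun h => by rw [ix.1 (by omega), iy.1 (by omega), smul_zero, smul_zero, add_zero],
      fun h => Submodule.add_mem _ ?_ ?_⟩
    · rcases Nat.lt_or_ge m (i + 1) with hm | hm
      · rw [ix.1 hm, smul_zero]; exact Submodule.zero_mem _
      · obtain rfl : n = 0 := by omega
        exact BiTensor.env_smul_mem_part_zero _ _ (one_mem_weight_zero _)
          (Submodule.subset_span hy : y ∈ weight k B E 0) (ix.2 (by omega))
    · rcases Nat.lt_or_ge n (i + 1) with hn | hn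
      · rw [iy.1 hn, smul_zero]; exact Submodule.zero_mem _
      · obtain rfl : m = 0 := by omega
        exact BiTensor.env_smul_mem_part_zero _ _ (Submodule.subset_span hx : x ∈ weight k B E 0)
          (one_mem_weight_zero _) (iy.2 (by omega))

theorem nu_D_eq_zero {n : ℕ} (hn : n < i + 1) {c : TAlg k B E} (hc : c ∈ weight k B E n) :
    nu E ρ i (Omega1.D _ c) = 0 := by
  induction hc using Submodule.span_induction with
  | zero => simp
  | add x y _ _ hx hy => rw [map_add, map_add, hx, hy, add_zero]
  | smul c x _ hx => rw [map_smul, map_smul, hx, smul_zero]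
  | mem x hx => exact (nu_D_of_isHom i hx).1 hn

theorem nu_D_mem_part {c : TAlg k B E} (hc : c ∈ weight k B E (i + 1)) :
    nu E ρ i (Omega1.D _ c) ∈ BiTensor.part (base k B E) (E i) (weight k B E) 0 := by
  induction hc using Submodule.span_induction with
  | zero => simp
  | add x y _ _ hx hy => rw [map_add, map_add]; exact Submodule.add_mem _ hx hy
  | smul c x _ hx => rw [map_smul, map_smul]; exact Submodule.smul_mem _ _ hx
  | mem x hx => exact (nu_D_of_isHom i hx).2 rfl

theorem nu_eq_zero_of_mem_part {w : ℤ} (hw : w < i + 1) {ξ : Omega1 ((base k B E).comp ρ)}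
    (hξ : ξ ∈ Omega1.part _ (weight k B E) w) : nu E ρ i ξ = 0 := by
  induction hξ using Submodule.span_induction with
  | zero => simp
  | add x y _ _ hx hy => rw [map_add, hx, hy, add_zero]
  | smul c x _ hx => rw [map_smul, hx, smul_zero]
  | mem x hx =>
    obtain ⟨p, q, r, a, b, c, -, -, hc, e, rfl⟩ := hx
    rw [nu_smul, nu_D_eq_zero i (by omega) hc, smul_zero]

theorem nu_mem_part_zero {ξ : Omega1 ((base k B E).comp ρ)}
    (hξ : ξ ∈ Omega1.part _ (weight k B E) (i + 1)) :
    nu E ρ i ξ ∈ BiTensor.part (base k B E) (E i) (weight k B E) 0 := by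
  induction hξ using Submodule.span_induction with
  | zero => simp
  | add x y _ _ hx hy => rw [map_add]; exact Submodule.add_mem _ hx hy
  | smul c x _ hx => rw [map_smul]; exact Submodule.smul_mem _ _ hx
  | mem x hx =>
    obtain ⟨p, q, r, a, b, c, ha, hb, hc, e, rfl⟩ := hx
    rw [nu_smul]
    rcases Nat.lt_or_ge r (i + 1) with hr | hr
    · rw [nu_D_eq_zero i hr hc, smul_zero]
      exact Submodule.zero_mem _
    · obtain ⟨rfl, rfl, rfl⟩ : p = 0 ∧ q = 0 ∧ r = i + 1 := by omega
      exact BiTensor.env_smul_mem_part_zero _ _ ha hb (nu_D_mem_part i hc)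

end

theorem nu_surjective : Function.Surjective (nu E ρ i) := by
  intro t
  induction t using BiTensor.induction with
  | hadd s t hs ht =>
    obtain ⟨ξ, rfl⟩ := hs
    obtain ⟨η, rfl⟩ := ht
    exact ⟨ξ + η, map_add _ _ _⟩
  | h a x a' =>
    exact ⟨env k a a' • Omega1.D _ (TensorAlg.gen k (Pi.single i x)), by
      rw [nu_smul, nu_D_gen, Pi.single_eq_same]⟩

variable {i}

/-- For the top index `i`, the kernel of `ν_i` is generated by the `d c` with `c` of weight less than
`i + 1`: modulo these, `a ⊗ e ⊗ a' ↦ a (d e) a'` is an inverse of `ν_i`. -/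
theorem mem_span_of_nu_eq_zero (hi : ∀ j, j ≤ i) {ξ : Omega1 ((base k B E).comp ρ)}
    (hξ : nu E ρ i ξ = 0) : ξ ∈ Submodule.span (Env k (TAlg k B E))
      {η | ∃ r < (i : ℕ) + 1, ∃ c ∈ weight k B E r, η = Omega1.D ((base k B E).comp ρ) c} := by
  set K := Submodule.span (Env k (TAlg k B E))
      {η | ∃ r < (i : ℕ) + 1, ∃ c ∈ weight k B E r, η = Omega1.D ((base k B E).comp ρ) c} with hK
  have hbase : ∀ b, Omega1.D ((base k B E).comp ρ) (base k B E b) ∈ K := fun b =>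
    Submodule.subset_span ⟨0, by omega, _, base_mem E b, rfl⟩
  have hgen : ∀ j ≠ i, ∀ e : E j,
      Omega1.D ((base k B E).comp ρ) (TensorAlg.gen k (Pi.single j e)) ∈ K := fun j hj e =>
    Submodule.subset_span ⟨j + 1, by
      have := lt_of_le_of_ne (hi j) hj
      have := Fin.lt_def.1 this
      omega, _, gen_mem E j e, rfl⟩
  let g : E i →ₗ[k] Omega1 ((base k B E).comp ρ) ⧸ K :=
    K.mkQ.restrictScalars k ∘ₗ Omega1.D _ ∘ₗ TensorAlg.gen k ∘ₗ LinearMap.single k E i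
  have hg_apply : ∀ e, g e = Submodule.Quotient.mk
    (Omega1.D ((base k B E).comp ρ) (TensorAlg.gen k (Pi.single i e))) := fun e => rfl
  let inv : BiTensor (base k B E) (E i) →ₗ[k] Omega1 ((base k B E).comp ρ) ⧸ K :=
    BiTensor.lift (base k B E) (Algebra.lsmul k k _) g (fun b b' e => by
      -- The terms of `d (b e b')` which contain `d b` or `d b'` lie in `K`.
      change g _ = env k (base k B E b) (base k B E b') • g e
      rw [hg_apply, hg_apply, ← Submodule.Quotient.mk_smul,
        Submodule.Quotient.eq, Pi.single_smul, TensorAlg.gen_env_smul, Omega1.D_mul, Omega1.D_mul,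
        smul_add, smul_smul, smul_smul, env_mul, env_mul, one_mul, one_mul, one_mul]
      have e1 := Submodule.smul_mem K (env k 1 (TensorAlg.gen k (Pi.single i e) * base k B E b'))
        (hbase b)
      have e2 := Submodule.smul_mem K (env k (base k B E b * TensorAlg.gen k (Pi.single i e)) 1)
        (hbase b')
      convert Submodule.add_mem K e1 e2 using 1
      abel)
  have hinv_smul : ∀ (e : Env k (TAlg k B E)) t, inv (e • t) = e • inv t := fun e t =>
    BiTensor.lift_smul ..
  have key : ∀ η, inv (nu E ρ i η) = Submodule.Quotient.mk η := by
    intro η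
    have hη : η ∈ Submodule.span (Env k (TAlg k B E))
        (Set.range (Omega1.D ((base k B E).comp ρ))) := by
      rw [Omega1.span_D]; trivial
    induction hη using Submodule.span_induction with
    | zero => simp
    | add x y _ _ hx hy => rw [map_add, map_add, hx, hy, Submodule.Quotient.mk_add]
    | smul e x _ hx => rw [nu_smul, hinv_smul, hx, Submodule.Quotient.mk_smul]
    | mem x hx =>
      obtain ⟨c, rfl⟩ := hx
      induction c using TensorAlg.induction with
      | hb b =>
        rw [nu_D_base, map_zero]
        exact ((Submodule.Quotient.mk_eq_zero _).2 (hbase b)).symm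
      | hg m =>
        rw [nu_D_gen]
        refine (BiTensor.lift_incl ..).trans ?_
        have e : Omega1.D ((base k B E).comp ρ) (TensorAlg.gen k m) =
            ∑ j, Omega1.D ((base k B E).comp ρ) (TensorAlg.gen k (Pi.single j (m j))) := by
          conv_lhs => rw [← Finset.univ_sum_single m]
          simp only [map_sum]
        rw [hg_apply, Submodule.Quotient.eq, e, ← Finset.add_sum_erase _ _ (Finset.mem_univ i),
          sub_add_cancel_left]
        exact Submodule.neg_mem _ (Submodule.sum_mem _ fun j hj =>
          hgen j (Finset.ne_of_mem_erase hj) _)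
      | hadd x y hx hy => simp only [map_add, hx, hy, Submodule.Quotient.mk_add]
      | hmul x y hx hy =>
        rw [nu_D_mul, map_add, hinv_smul, hinv_smul, hx, hy, Omega1.D_mul,
          Submodule.Quotient.mk_add, Submodule.Quotient.mk_smul, Submodule.Quotient.mk_smul]
  have := key ξ
  rw [hξ, map_zero] at this
  exact (Submodule.Quotient.mk_eq_zero _).1 this.symm

end TAlg
end TensorWeights

section ActionOnSum
variable {k : Type*} [Field k] {R A : Type*} [Ring R] [Algebra k R] [Ring A] [Algebra k A]
  {ρ : R →ₐ[k] A} {𝒜 : ℕ → Submodule k A} [GradedAlgebra 𝒜] [IsGradedOver 𝒜 ρ]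

/-- The action of homogeneous elements on the graded bimodule of double derivations. -/
noncomputable def actSum {i j : ℕ} {a b : A} (ha : a ∈ 𝒜 i) (hb : b ∈ 𝒜 j) :
    (⨁ d : ℤ, DDerGr 𝒜 ρ d) →ₗ[k] ⨁ d : ℤ, DDerGr 𝒜 ρ d :=
  DirectSum.toModule k ℤ _ fun d => DirectSum.lof k ℤ (fun d => DDerGr 𝒜 ρ d) (d + i + j) ∘ₗ
    { toFun := DDerGr.act ha hb
      map_add' := fun _ _ => Subtype.ext (LinearMap.ext fun _ => map_add (innerGr 𝒜 i j a b) _ _)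
      map_smul' := fun r _ => Subtype.ext (LinearMap.ext fun _ =>
        map_smul (innerGr 𝒜 i j a b) r _) }

theorem actSum_lof {i j : ℕ} {a b : A} (ha : a ∈ 𝒜 i) (hb : b ∈ 𝒜 j) {d : ℤ}
    (Θ : DDerGr 𝒜 ρ d) : actSum ha hb (DirectSum.lof k ℤ (fun d => DDerGr 𝒜 ρ d) d Θ) =
      DirectSum.lof k ℤ (fun d => DDerGr 𝒜 ρ d) _ (DDerGr.act ha hb Θ) := by
  rw [actSum, DirectSum.toModule_lof]
  rfl

theorem iota_actSum [CharZero k] {N : ℕ} {ω : DR ρ 𝒜} (hω : ω ∈ DR.part ρ 𝒜 N 2) {i j : ℕ}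
    {a b : A} (ha : a ∈ 𝒜 i) (hb : b ∈ 𝒜 j) (Θ : ⨁ d : ℤ, DDerGr 𝒜 ρ d) :
    iota ρ 𝒜 ω (actSum ha hb Θ) = sgn k (N * j) • env k a b • iota ρ 𝒜 ω Θ := by
  induction Θ using DirectSum.induction_on with
  | zero => simp
  | add x y hx hy => simp only [map_add, hx, hy, smul_add]
  | of d Θ =>
    change iota ρ 𝒜 ω (actSum ha hb (DirectSum.lof k ℤ (fun d => DDerGr 𝒜 ρ d) d Θ)) = _
    rw [actSum_lof, iota_act hω]
    rfl

end ActionOnSum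

section Restriction
variable {k : Type*} [Field k] {R B A : Type*} [Ring R] [Algebra k R] [Ring B] [Algebra k B]
  [Ring A] [Algebra k A] (ρ : R →ₐ[k] B) (φ : B →ₐ[k] A)
  (𝒜 : ℕ → Submodule k A) [GradedAlgebra 𝒜]

omit [GradedAlgebra 𝒜] in
theorem restrict_lof (d : ℤ) (Θ : DDerGr 𝒜 (φ.comp ρ) d) (b : B) :
    restrict ρ φ 𝒜 (DirectSum.lof k ℤ (fun d => DDerGr 𝒜 (φ.comp ρ) d) d Θ) b = Θ.1 (φ b) := by
  rw [restrict, DirectSum.toModule_lof]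
  rfl

variable [IsGradedOver 𝒜 φ]

theorem restrict_mul (Θ : ⨁ d : ℤ, DDerGr 𝒜 (φ.comp ρ) d) (a b : B) :
    restrict ρ φ 𝒜 Θ (a * b) =
      restrict ρ φ 𝒜 Θ a * (1 ⊗ₜ φ b) + (φ a ⊗ₜ 1) * restrict ρ φ 𝒜 Θ b := by
  induction Θ using DirectSum.induction_on with
  | zero => simp
  | add x y hx hy => simp only [map_add, LinearMap.add_apply, hx, hy, add_mul, mul_add]; abel
  | of d Θ =>
    change restrict ρ φ 𝒜 (DirectSum.lof k ℤ (fun d => DDerGr 𝒜 (φ.comp ρ) d) d Θ) _ =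
      restrict ρ φ 𝒜 (DirectSum.lof k ℤ (fun d => DDerGr 𝒜 (φ.comp ρ) d) d Θ) _ * _ +
      _ * restrict ρ φ 𝒜 (DirectSum.lof k ℤ (fun d => DDerGr 𝒜 (φ.comp ρ) d) d Θ) _
    rw [restrict_lof, restrict_lof, restrict_lof, map_mul, DDerGr.map_mul _ _ Θ.2, add_comm,
      signAut_base φ 𝒜]

omit [GradedAlgebra 𝒜] [IsGradedOver 𝒜 φ] in
theorem restrict_base (Θ : ⨁ d : ℤ, DDerGr 𝒜 (φ.comp ρ) d) (r : R) :
    restrict ρ φ 𝒜 Θ (ρ r) = 0 := by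
  induction Θ using DirectSum.induction_on with
  | zero => simp
  | add x y hx hy => simp only [map_add, LinearMap.add_apply, hx, hy, add_zero]
  | of d Θ => exact (restrict_lof ρ φ 𝒜 d Θ _).trans (Θ.2.1 r)

variable {ρ φ 𝒜}

theorem restrict_actSum [IsGradedOver 𝒜 (φ.comp ρ)] {i j : ℕ} {a b : A} (ha : a ∈ 𝒜 i)
    (hb : b ∈ 𝒜 j) (Θ : ⨁ d : ℤ, DDerGr 𝒜 (φ.comp ρ) d) (c : B) :
    restrict ρ φ 𝒜 (actSum ha hb Θ) c = innerGr 𝒜 i j a b (restrict ρ φ 𝒜 Θ c) := by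
  induction Θ using DirectSum.induction_on with
  | zero => simp
  | add x y hx hy => simp only [map_add, LinearMap.add_apply, hx, hy]
  | of d Θ =>
    change restrict ρ φ 𝒜 (actSum ha hb
      (DirectSum.lof k ℤ (fun d => DDerGr 𝒜 (φ.comp ρ) d) d Θ)) c = innerGr 𝒜 i j a b
        (restrict ρ φ 𝒜 (DirectSum.lof k ℤ (fun d => DDerGr 𝒜 (φ.comp ρ) d) d Θ) c)
    rw [actSum_lof, restrict_lof, restrict_lof, DDerGr.act_apply, signAut_base φ 𝒜]

/-- The composite `ε` of restriction and `canInv` is a map of bimodules. -/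
theorem canInv_restrict_actSum [CharZero k] [IsGradedOver 𝒜 (φ.comp ρ)] {s : Finset B}
    (f : s → Omega1 ρ →ₗ[Env k B] Env k B) {i j : ℕ} {a b : A} (ha : a ∈ 𝒜 i) (hb : b ∈ 𝒜 j)
    (Θ : ⨁ d : ℤ, DDerGr 𝒜 (φ.comp ρ) d) :
    canInv φ 𝒜 f (restrict ρ φ 𝒜 (actSum ha hb Θ)) =
      env k a b • canInv φ 𝒜 f (restrict ρ φ 𝒜 Θ) := by
  rw [canInv_apply, canInv_apply, Finset.smul_sum]
  refine Finset.sum_congr rfl fun x _ => ?_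
  rw [restrict_actSum, koszulEnv_innerGr 𝒜 ha hb, mul_smul]

end Restriction

/-! ### The restriction theorem -/

section Outer
variable {k : Type*} [Field k] {R B A : Type*} [Ring R] [Algebra k R] [Ring B] [Algebra k B]
  [Ring A] [Algebra k A] {ρ : R →ₐ[k] B} (φ : B →ₐ[k] A)

theorem outer_mul_right (z : A ⊗[k] A) (w : B ⊗[k] B) (b : B) :
    outer φ z (w * (1 ⊗ₜ b)) = outer φ z w * (1 ⊗ₜ φ b) := by
  induction w with
  | zero => simp
  | add x y hx hy => rw [add_mul, map_add, map_add, hx, hy, add_mul]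
  | tmul u v =>
    rw [Algebra.TensorProduct.tmul_mul_tmul, outer_tmul, outer_tmul, mul_assoc _ _ (1 ⊗ₜ φ b)]
    simp

theorem outer_mul_left (z : A ⊗[k] A) (w : B ⊗[k] B) (b : B) :
    outer φ z ((b ⊗ₜ 1) * w) = (φ b ⊗ₜ 1) * outer φ z w := by
  induction w with
  | zero => simp
  | add x y hx hy => rw [mul_add, map_add, map_add, hx, hy, mul_add]
  | tmul u v =>
    rw [Algebra.TensorProduct.tmul_mul_tmul, outer_tmul, outer_tmul, ← mul_assoc, ← mul_assoc]
    simp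

theorem outer_mem {𝒜 : ℕ → Submodule k A} [GradedAlgebra 𝒜] [IsGradedOver 𝒜 φ] {n : ℤ}
    {z : A ⊗[k] A} (hz : z ∈ tensorPart 𝒜 n) (w : B ⊗[k] B) : outer φ z w ∈ tensorPart 𝒜 n := by
  induction w with
  | zero => simp
  | add x y hx hy => rw [map_add]; exact Submodule.add_mem _ hx hy
  | tmul u v =>
    rw [outer_tmul]
    simpa using tensorPart_mul (IsGradedOver.map_mem (𝒜 := 𝒜) (ρ := φ) u)
      (IsGradedOver.map_mem (𝒜 := 𝒜) (ρ := φ) v) hz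

end Outer

/-- Two surjections with the same kernel have isomorphic targets. The modules are over additive monoids
since the direct sum of the spaces of double derivations carries that structure; over a field they are
groups. -/
theorem exists_equiv_of_ker_eq {k V U W : Type*} [Field k] [AddCommMonoid V] [Module k V]
    [AddCommMonoid U] [Module k U] [AddCommMonoid W] [Module k W] (f : V →ₗ[k] U) (g : V →ₗ[k] W)
    (hf : Function.Surjective f) (hg : Function.Surjective g)
    (h : LinearMap.ker f = LinearMap.ker g) : ∃ e : U ≃ₗ[k] W, ∀ x, e (f x) = g x := by
  let _ : AddCommGroup V := Module.addCommMonoidToAddCommGroup k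
  let _ : AddCommGroup U := Module.addCommMonoidToAddCommGroup k
  let _ : AddCommGroup W := Module.addCommMonoidToAddCommGroup k
  refine ⟨(f.quotKerEquivOfSurjective hf).symm.trans ((Submodule.quotEquivOfEq _ _ h).trans
    (g.quotKerEquivOfSurjective hg)), fun x => ?_⟩
  have : (f.quotKerEquivOfSurjective hf).symm (f x) = Submodule.Quotient.mk x := by
    rw [LinearEquiv.symm_apply_eq]; rfl
  rw [LinearEquiv.trans_apply, this]
  rfl

section WeightZero
variable {k : Type*} [Field k] {B A : Type*} [Ring B] [Algebra k B] [Ring A] [Algebra k A]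
  {X Y : Type*} [AddCommGroup X] [Module k X] [Module (Env k B) X]
  [AddCommGroup Y] [Module k Y] [Module (Env k B) Y] [IsScalarTower k (Env k B) Y]

/-- A twisted bimodule isomorphism `A ⊗_B X ⊗_B A → A ⊗_B Y ⊗_B A` preserves weights if it does so on the
generators and the generators of the target are images of elements of weight zero. -/
theorem BiTensor.map_part_eq [IsScalarTower k (Env k B) X] {φ : B →ₐ[k] A}
    {𝒜 : ℕ → Submodule k A} [GradedAlgebra 𝒜] {N : ℕ}
    (f : BiTensor φ X →ₗ[k] BiTensor φ Y)
    (hf : ∀ (p q : ℕ), ∀ a ∈ 𝒜 p, ∀ b ∈ 𝒜 q, ∀ t,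
      f (env k a b • t) = sgn k (N * q) • env k a b • f t)
    (hincl : ∀ x, f (incl φ x) ∈ part φ Y 𝒜 0)
    (hsurj : ∀ y, ∃ t ∈ part φ X 𝒜 0, f t = incl φ y) (n : ℕ) :
    (part φ X 𝒜 n).map f = part φ Y 𝒜 n := by
  apply le_antisymm
  · rw [Submodule.map_le_iff_le_comap]
    refine Submodule.span_le.2 ?_
    rintro _ ⟨p, q, a, a', x, ha, ha', rfl, rfl⟩
    rw [SetLike.mem_coe, Submodule.mem_comap, tmul_eq_env_smul, hf p q a ha a' ha']
    have hx := env_smul_mem_part φ 𝒜 ha ha' (hincl x)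
    rw [add_zero] at hx
    exact Submodule.smul_mem _ _ hx
  · refine Submodule.span_le.2 ?_
    rintro _ ⟨p, q, a, a', y, ha, ha', rfl, rfl⟩
    obtain ⟨t, ht, hty⟩ := hsurj y
    have ht' := env_smul_mem_part φ 𝒜 ha ha' ht
    rw [add_zero] at ht'
    refine ⟨sgn k (N * q) • env k a a' • t, Submodule.smul_mem _ _ ht', ?_⟩
    rw [map_smul, hf p q a ha a' ha', hty, smul_smul, sgn_sq, one_smul, tmul_eq_env_smul]

omit [IsScalarTower k (Env k B) Y] in
theorem BiTensor.map_left_smul {φ : B →ₐ[k] A} {𝒜 : ℕ → Submodule k A} [GradedAlgebra 𝒜] {N : ℕ}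
    (f : BiTensor φ X →ₗ[k] BiTensor φ Y)
    (hf : ∀ (p q : ℕ), ∀ a ∈ 𝒜 p, ∀ b ∈ 𝒜 q, ∀ t,
      f (env k a b • t) = sgn k (N * q) • env k a b • f t) (a : A) (t : BiTensor φ X) :
    f (env k a 1 • t) = env k a 1 • f t := by
  induction a using graded_induction 𝒜 with
  | h p a ha =>
    rw [hf p 0 a ha 1 (one_mem_weight_zero 𝒜), Nat.cast_zero, mul_zero, sgn_zero, one_smul]
  | hadd x y hx hy =>
    rw [← envLeft_apply] at hx hy ⊢
    rw [map_add, add_smul, map_add, hx, hy, add_smul]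

variable {N : ℕ} {E : Fin N → Type*}
  [∀ i, AddCommGroup (E i)] [∀ i, Module k (E i)] [∀ i, Module (Env k B) (E i)]

omit [IsScalarTower k (Env k B) Y] in
theorem TAlg.incl_injective [IsScalarTower k (Env k B) X] :
    Function.Injective (BiTensor.incl (X := X) (base k B E)) :=
  Function.LeftInverse.injective (g := BiTensor.retract toBase_base)
    (BiTensor.retract_incl toBase_base)

/-- An isomorphism `A ⊗_B X ⊗_B A → A ⊗_B Y ⊗_B A` which preserves the part of weight zero restricts to
an isomorphism of the `B`-bimodules `X` and `Y`, as `X` is the part of weight zero of the source. -/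
theorem TAlg.exists_linearEquiv_of_map_part_zero [IsScalarTower k (Env k B) X]
    (f : BiTensor (base k B E) X ≃ₗ[k] BiTensor (base k B E) Y)
    (hf : ∀ b b' t, f (env k (base k B E b) (base k B E b') • t) =
      env k (base k B E b) (base k B E b') • f t)
    (hpart : (BiTensor.part (base k B E) X (weight k B E) 0).map f.toLinearMap =
      BiTensor.part (base k B E) Y (weight k B E) 0) :
    ∃ j : X ≃ₗ[Env k B] Y,
      ∀ x, f (BiTensor.incl (base k B E) x) = BiTensor.incl (base k B E) (j x) := by
  have hmem : ∀ x, ∃ y, f (BiTensor.incl (base k B E) x) = BiTensor.incl (base k B E) y :=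
    fun x => exists_incl_of_mem_part_zero (hpart ▸ ⟨_, BiTensor.incl_mem_part _ _ x, rfl⟩)
  choose j hj using hmem
  have inj := incl_injective (k := k) (B := B) (E := E) (X := Y)
  let j' : X →ₗ[Env k B] Y :=
    { toFun := j
      map_add' := fun x y => inj (by rw [← hj, map_add, map_add, map_add, hj, hj])
      map_smul' := fun e x => by
        rw [RingHom.id_apply]
        induction e using env_induction with
        | hadd e e' he he' =>
          refine inj ?_
          rw [← hj, add_smul, map_add, map_add, hj, hj, he, he', add_smul, map_add]
        | h b b' =>
          refine inj ?_
          rw [← hj, BiTensor.incl_env, hf, hj, BiTensor.incl_env] }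
  refine ⟨LinearEquiv.ofBijective j' ⟨fun x y h => ?_, fun y => ?_⟩, hj⟩
  · refine incl_injective (k := k) (B := B) (E := E) (f.injective ?_)
    rw [hj, hj]
    exact congrArg _ h
  · have hy := BiTensor.incl_mem_part (base k B E) (weight k B E) y
    rw [← hpart] at hy
    obtain ⟨t, ht, hty⟩ := hy
    obtain ⟨x, rfl⟩ := exists_incl_of_mem_part_zero ht
    exact ⟨x, inj ((hj x).symm.trans hty)⟩

end WeightZero

section RestrictionTheorem
variable {k : Type*} [Field k] [CharZero k] {R : Type*} [Ring R] [Algebra k R]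
  {B : Type*} [Ring B] [Algebra k B] {ρ : R →ₐ[k] B} {N : ℕ} {E : Fin N → Type*}
  [∀ i, AddCommGroup (E i)] [∀ i, Module k (E i)] [∀ i, Module (Env k B) (E i)]

namespace TAlg

section Restriction
variable {s : Finset B} (f : s → Omega1 ρ →ₗ[Env k B] Env k B)

/-- The composite `ε` of restriction and `canInv` preserves weights. -/
theorem canInv_restrict_mem_part {d : ℤ} {n : ℕ} (h : d = n)
    (Θ : DDerGr (weight k B E) ((base k B E).comp ρ) d) :
    canInv (base k B E) (weight k B E) f (restrict ρ (base k B E) (weight k B E)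
      (DirectSum.lof k ℤ (fun d => DDerGr (weight k B E) ((base k B E).comp ρ) d) d Θ)) ∈
      BiTensor.part (base k B E) (DDer ρ) (weight k B E) n := by
  subst h
  rw [canInv_apply]
  refine Submodule.sum_mem _ fun x _ => BiTensor.koszulEnv_smul_incl_mem_part _ _ ?_ _
  rw [restrict_lof]
  simpa using Θ.2.2.1 0 _ (base_mem E (x : B))

variable [∀ i, IsScalarTower k (Env k B) (E i)] [∀ i, Module.Finite (Env k B) (E i)]
  [∀ i, Module.Projective (Env k B) (E i)]

variable {f} in
/-- The element `a ⊗ θ ⊗ a'` lifts to a double derivation of `A` of the same weight. -/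
theorem exists_canInv_restrict_eq (hf : ∀ ξ, ξ = ∑ i, f i ξ • Omega1.D ρ (i : B)) {i j : ℕ}
    {a a' : TAlg k B E} (ha : a ∈ weight k B E i) (ha' : a' ∈ weight k B E j) (θ : DDer ρ) :
    ∃ Θ : DDerGr (weight k B E) ((base k B E).comp ρ) (i + j),
      canInv (base k B E) (weight k B E) f (restrict ρ (base k B E) (weight k B E)
        (DirectSum.lof k ℤ (fun d => DDerGr (weight k B E) ((base k B E).comp ρ) d) _ Θ)) =
      env k a a' • BiTensor.incl (base k B E) θ := by
  obtain ⟨Θ, hΘ⟩ := exists_extension (ρ := ρ) (d := (i + j : ℤ))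
    (can ρ (base k B E) (weight k B E) (env k a a' • BiTensor.incl (base k B E) θ))
    (fun r => by rw [can_env_smul_incl, show DDer.toLin θ (ρ r) = 0 from θ.2.1 r, map_zero])
    (fun b b' => by
      rw [can_env_smul_incl, can_env_smul_incl, can_env_smul_incl,
        show DDer.toLin θ (b * b') = DDer.toLin θ b * (1 ⊗ₜ b') + (b ⊗ₜ 1) * DDer.toLin θ b' from
          θ.2.2 b b', map_add, outer_mul_right, outer_mul_left])
    (fun b => by
      rw [can_env_smul_incl, revKoszul_env, koszul_signAut_tmul _ ha' ha]
      exact outer_mem _ (Submodule.smul_mem _ _ (tmul_mem_tensorPart ha' ha (add_comm _ _))) _)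
  refine ⟨Θ, ?_⟩
  conv_rhs => rw [← canInv_can (base k B E) (weight k B E) hf
    (env k a a' • BiTensor.incl (base k B E) θ)]
  congr 1
  exact LinearMap.ext fun b => (restrict_lof ρ _ _ _ Θ b).trans (hΘ b)

variable {f} in
theorem canInv_restrict_surjective (hf : ∀ ξ, ξ = ∑ i, f i ξ • Omega1.D ρ (i : B)) :
    Function.Surjective (canInv (base k B E) (weight k B E) f ∘ₗ
      restrict ρ (base k B E) (weight k B E)) := by
  intro t
  induction t using BiTensor.induction with
  | hadd s t hs ht =>
    obtain ⟨Θ, rfl⟩ := hs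
    obtain ⟨Δ, rfl⟩ := ht
    exact ⟨Θ + Δ, map_add _ _ _⟩
  | h a θ a' =>
    generalize env k a a' = e
    induction e using env_homogeneous_induction (weight k B E) with
    | hadd x y hx hy =>
      obtain ⟨Θ, hΘ⟩ := hx
      obtain ⟨Δ, hΔ⟩ := hy
      exact ⟨Θ + Δ, by rw [map_add, hΘ, hΔ, add_smul]⟩
    | h i j a ha b hb =>
      obtain ⟨Θ, hΘ⟩ := exists_canInv_restrict_eq hf ha hb θ
      exact ⟨_, hΘ⟩

end Restriction

omit [CharZero k] in
/-- A double derivation of negative weight vanishes on `B`, as `A ⊗ A` has no negative weights. -/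
theorem map_base_eq_zero_of_neg {d : ℤ} (hd : d < 0)
    (Θ : DDerGr (weight k B E) ((base k B E).comp ρ) d) (b : B) : Θ.1 (base k B E b) = 0 :=
  eq_zero_of_mem_tensorPart_neg hd (by simpa using Θ.2.2.1 0 _ (base_mem E b))

/-- If a sum of double derivations of different weights vanishes on `B`, so does each of them. -/
theorem component_map_base_eq_zero {Θ : ⨁ d : ℤ, DDerGr (weight k B E) ((base k B E).comp ρ) d}
    (hΘ : restrict ρ (base k B E) (weight k B E) Θ = 0) (d : ℤ) (b : B) :
    (Θ d).1 (base k B E b) = 0 := by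
  have h0 : (LinearMap.applyₗ b ∘ₗ restrict ρ (base k B E) (weight k B E)) Θ = 0 := by
    simp [hΘ]
  have hmem : ∀ n (Ξ : DDerGr (weight k B E) ((base k B E).comp ρ) n),
      (LinearMap.applyₗ b ∘ₗ restrict ρ (base k B E) (weight k B E))
        (DirectSum.lof k ℤ (fun d => DDerGr (weight k B E) ((base k B E).comp ρ) d) n Ξ) ∈
      tensorPart (weight k B E) n := fun n Ξ => by
    rw [LinearMap.comp_apply, LinearMap.applyₗ_apply_apply, restrict_lof]
    simpa using Ξ.2.2.1 0 _ (base_mem E b)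
  have := map_component_of_mem_eigenspace _ (two_zpow_injective (k := k)) _
    (fun n Ξ => tensorPart_le_eigenspace (weight k B E) n (hmem n Ξ)) Θ d
    (by rw [h0]; exact Submodule.zero_mem _)
  rwa [h0, LinearMap.comp_apply, LinearMap.applyₗ_apply_apply, restrict_lof] at this

variable {ω : DR ((base k B E).comp ρ) (weight k B E)}
  (hω : IsBiSymplectic ((base k B E).comp ρ) (weight k B E) N ω)
include hω

/-- The differential of an element of weight `r` is the contraction of `ω` with a double derivation of
weight `r - N`: among the components of a preimage under the bijection `ι(ω)`, only this one matters. -/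
theorem exists_iota_eq_D {r : ℕ} {c : TAlg k B E} (hc : c ∈ weight k B E r) :
    ∃ Θ : DDerGr (weight k B E) ((base k B E).comp ρ) (r - N),
      iota ((base k B E).comp ρ) (weight k B E) ω
        (DirectSum.lof k ℤ (fun d => DDerGr (weight k B E) ((base k B E).comp ρ) d) _ Θ) =
      Omega1.D ((base k B E).comp ρ) c := by
  obtain ⟨Θ, hΘ⟩ := hω.bijective.2 (Omega1.D ((base k B E).comp ρ) c)
  refine ⟨Θ (r - N), ?_⟩
  rw [← hΘ]
  refine map_component_of_mem_eigenspace
    (Omega1.scale ((base k B E).comp ρ) (weight k B E)) (μ := fun d : ℤ => (2 : k) ^ ((N : ℤ) + d))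
    (fun m n h => add_left_cancel (two_zpow_injective h)) _
    (fun d Ξ => Omega1.part_le_eigenspace _ (iota_lof_mem hω.mem_part d Ξ)) Θ _ ?_
  rw [hΘ, show (N : ℤ) + (r - N) = r by ring]
  exact Omega1.part_le_eigenspace _ (Omega1.D_mem_part hc)

variable {i : Fin N} (hi : (i : ℕ) + 1 = N)
include hi

/-- The kernel of the restriction to `B` is generated by double derivations of negative weight, and
`ν_N` vanishes on 1-forms of weight less than `N`. -/
theorem nu_iota_eq_zero [∀ i, IsScalarTower k (Env k B) (E i)]
    [∀ i, Module.Finite (Env k B) (E i)] [∀ i, Module.Projective (Env k B) (E i)]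
    {Θ : ⨁ d : ℤ, DDerGr (weight k B E) ((base k B E).comp ρ) d}
    (hΘ : restrict ρ (base k B E) (weight k B E) Θ = 0) :
    nu E ρ i (iota ((base k B E).comp ρ) (weight k B E) ω Θ) = 0 := by
  classical
  have h : ∀ d, DirectSum.lof k ℤ (fun d => DDerGr (weight k B E) ((base k B E).comp ρ) d) d (Θ d) ∈
      LinearMap.ker (nu E ρ i ∘ₗ iota ((base k B E).comp ρ) (weight k B E) ω) := fun d => by
    refine lof_mem_of_vanishing _ (fun n hn Ξ p q a b ha hb => ?_) (Θ d)
      (component_map_base_eq_zero hΘ d)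
    rw [LinearMap.mem_ker, LinearMap.comp_apply, iota_act hω.mem_part, map_smul, nu_smul,
      nu_eq_zero_of_mem_part i (by omega) (iota_lof_mem hω.mem_part n Ξ), smul_zero, smul_zero]
  rw [← LinearMap.comp_apply, ← LinearMap.mem_ker, ← DirectSum.sum_support_of Θ]
  exact Submodule.sum_mem _ fun d _ => h d

/-- The kernel of `ν_N` is generated by 1-forms of weight less than `N`. They are contractions of `ω`
with double derivations of negative weight, which vanish on `B`. -/
theorem restrict_eq_zero {Θ : ⨁ d : ℤ, DDerGr (weight k B E) ((base k B E).comp ρ) d}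
    (hΘ : nu E ρ i (iota ((base k B E).comp ρ) (weight k B E) ω Θ) = 0) :
    restrict ρ (base k B E) (weight k B E) Θ = 0 := by
  -- `W` is a sub-bimodule of the 1-forms; it is shown to contain the generators of the kernel of `ν_N`.
  set W := (LinearMap.ker (restrict ρ (base k B E) (weight k B E))).map
    (iota ((base k B E).comp ρ) (weight k B E) ω)
  have hsmul : ∀ (e : Env k (TAlg k B E)), ∀ ξ ∈ W, e • ξ ∈ W := by
    rintro e _ ⟨Ξ, hΞ, rfl⟩
    induction e using env_homogeneous_induction (weight k B E) with
    | hadd x y hx hy => rw [add_smul]; exact Submodule.add_mem _ hx hy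
    | h p q a ha b hb =>
      have e1 : iota ((base k B E).comp ρ) (weight k B E) ω (actSum ha hb Ξ) ∈ W := by
        refine ⟨_, ?_, rfl⟩
        refine LinearMap.mem_ker.2 (LinearMap.ext fun c => ?_)
        rw [restrict_actSum, LinearMap.mem_ker.1 hΞ]
        simp
      have e2 := Submodule.smul_mem W (sgn k (N * q)) e1
      rwa [iota_actSum hω.mem_part, smul_smul, sgn_sq, one_smul] at e2
  have hmem := mem_span_of_nu_eq_zero (fun j => Fin.le_def.2 (by omega)) hΘ
  have hW : iota ((base k B E).comp ρ) (weight k B E) ω Θ ∈ W := by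
    generalize iota ((base k B E).comp ρ) (weight k B E) ω Θ = ξ at hmem
    induction hmem using Submodule.span_induction with
    | zero => exact Submodule.zero_mem _
    | add x y _ _ hx hy => exact Submodule.add_mem _ hx hy
    | smul e x _ hx => exact hsmul e x hx
    | mem x hx =>
      obtain ⟨r, hr, c, hc, rfl⟩ := hx
      obtain ⟨Ξ, hΞ⟩ := exists_iota_eq_D hω hc
      refine ⟨_, LinearMap.mem_ker.2 (LinearMap.ext fun b => ?_), hΞ⟩
      rw [restrict_lof]
      exact map_base_eq_zero_of_neg (by omega) Ξ b
  obtain ⟨Ξ, hΞ, e⟩ := hW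
  rw [← hω.bijective.1 e]
  exact hΞ

end TAlg

end RestrictionTheorem
end NCG

set_option maxHeartbeats 400000 in
open NCG in
theorem mainTheorem3 {k : Type*} [Field k] [CharZero k]
    {R : Type*} [Ring R] [Algebra k R] [FiniteDimensional k R] [IsSemisimpleRing R]
    {B : Type*} [Ring B] [Algebra k B] (ρ : R →ₐ[k] B) (hB : IsSmooth ρ)
    (N : ℕ) (hN : 0 < N) (E : Fin N → Type*) [∀ i, AddCommGroup (E i)] [∀ i, Module k (E i)]
    [∀ i, Module (Env k B) (E i)] [∀ i, IsScalarTower k (Env k B) (E i)]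
    [∀ i, Module.Finite (Env k B) (E i)] [∀ i, Module.Projective (Env k B) (E i)]
    (ω : DR ((TAlg.base k B E).comp ρ) (TAlg.weight k B E))
    (hω : IsBiSymplectic ((TAlg.base k B E).comp ρ) (TAlg.weight k B E) N ω) :
    Function.Injective (can ρ (TAlg.base k B E) (TAlg.weight k B E)) ∧
    ∃ ε : (⨁ d : ℤ, DDerGr (TAlg.weight k B E) ((TAlg.base k B E).comp ρ) d) →ₗ[k]
        BiTensor (TAlg.base k B E) (DDer ρ),
      Function.Surjective ε ∧
      (∀ Θ, can ρ (TAlg.base k B E) (TAlg.weight k B E) (ε Θ) =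
        restrict ρ (TAlg.base k B E) (TAlg.weight k B E) Θ) ∧
      ∃ ι : BiTensor (TAlg.base k B E) (DDer ρ) ≃ₗ[k]
          BiTensor (TAlg.base k B E) (E ⟨N - 1, Nat.sub_lt hN one_pos⟩),
        (∀ Θ, ι (ε Θ) = TAlg.nu E ρ ⟨N - 1, Nat.sub_lt hN one_pos⟩
          (iota ((TAlg.base k B E).comp ρ) (TAlg.weight k B E) ω Θ)) ∧
        (∀ (a : TAlg k B E) t, ι (env k a 1 • t) = env k a 1 • ι t) ∧
        (∀ (j : ℕ), ∀ a ∈ TAlg.weight k B E j, ∀ t,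
          ι (env k 1 a • t) = sgn k (N * j) • env k 1 a • ι t) ∧
        (∀ n, (BiTensor.part (TAlg.base k B E) (DDer ρ) (TAlg.weight k B E) n).map ι.toLinearMap =
          BiTensor.part (TAlg.base k B E) (E ⟨N - 1, Nat.sub_lt hN one_pos⟩)
            (TAlg.weight k B E) n) ∧
        ∃ j : DDer ρ ≃ₗ[Env k B] E ⟨N - 1, Nat.sub_lt hN one_pos⟩,
          ∀ θ, ι (BiTensor.tmul (TAlg.base k B E) 1 θ 1) =
            BiTensor.tmul (TAlg.base k B E) 1 (j θ) 1 := by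
  obtain ⟨s, f, hf⟩ := hB.exists_dual_basis
  have hcan := canInv_can (TAlg.base k B E) (TAlg.weight k B E) hf
  have hε := TAlg.canInv_restrict_surjective (E := E) hf
  refine ⟨Function.LeftInverse.injective hcan, _, hε, fun Θ => can_canInv _ _ hf
    (restrict_base ρ _ _ Θ) (restrict_mul ρ _ _ Θ), ?_⟩
  have hi : N - 1 + 1 = N := by omega
  -- The indices of `E` start at `0`, so that `E_N` is `E i` for `i = N - 1`.
  generalize hlast : (⟨N - 1, Nat.sub_lt hN one_pos⟩ : Fin N) = i
  replace hi : (i : ℕ) + 1 = N := by rw [← hlast]; exact hi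
  set ε := canInv (TAlg.base k B E) (TAlg.weight k B E) f ∘ₗ
    restrict ρ (TAlg.base k B E) (TAlg.weight k B E) with hε_def
  set F := TAlg.nu E ρ i ∘ₗ iota ((TAlg.base k B E).comp ρ) (TAlg.weight k B E) ω with hF_def
  have hF : Function.Surjective F := by
    rw [hF_def, LinearMap.coe_comp]
    exact (TAlg.nu_surjective i).comp hω.bijective.2
  have hker : LinearMap.ker ε = LinearMap.ker F := by
    refine Submodule.ext fun Θ => ?_
    rw [LinearMap.mem_ker, LinearMap.mem_ker]
    refine ⟨fun h => TAlg.nu_iota_eq_zero hω hi ?_, fun h => ?_⟩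
    · rw [← can_canInv (TAlg.base k B E) (TAlg.weight k B E) hf (restrict_base ρ _ _ Θ)
        (restrict_mul ρ _ _ Θ)]
      exact (congrArg _ h).trans (map_zero _)
    · rw [hε_def, LinearMap.comp_apply, TAlg.restrict_eq_zero hω hi h, map_zero]
  obtain ⟨ι, hι⟩ := exists_equiv_of_ker_eq ε F hε hF hker
  -- As `ε` is surjective and a map of bimodules, the twist of `ι(ω)` passes to `ι`.
  have hact : ∀ (p q : ℕ), ∀ a ∈ TAlg.weight k B E p, ∀ b ∈ TAlg.weight k B E q, ∀ t,
      ι (env k a b • t) = sgn k (N * q) • env k a b • ι t := by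
    intro p q a ha b hb t
    obtain ⟨Θ, rfl⟩ := hε t
    have e1 : env k a b • ε Θ = ε (actSum ha hb Θ) :=
      (canInv_restrict_actSum f ha hb Θ).symm
    rw [e1, hι, hι, LinearMap.comp_apply, LinearMap.comp_apply, iota_actSum hω.mem_part, map_smul,
      TAlg.nu_smul]
  have h1 := one_mem_weight_zero (TAlg.weight k B E)
  -- A lift of `1 ⊗ θ ⊗ 1` of weight zero is sent to weight `N` by `ι(ω)`, hence to weight zero by `ν_N`.
  have hincl : ∀ θ : DDer ρ, ι (BiTensor.incl (TAlg.base k B E) θ) ∈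
      BiTensor.part (TAlg.base k B E) (E i) (TAlg.weight k B E) 0 := by
    intro θ
    obtain ⟨Θ, hΘ⟩ := TAlg.exists_canInv_restrict_eq hf h1 h1 θ
    rw [env_one, one_smul] at hΘ
    rw [← hΘ]
    refine (hι _).symm ▸ TAlg.nu_mem_part_zero i ?_
    have := iota_lof_mem hω.mem_part _ Θ
    rwa [show (N : ℤ) + ((0 : ℕ) + (0 : ℕ)) = i + 1 by omega] at this
  -- For `e` in `E_N`, the form `d e` of weight `N` is `ι(ω)` of a double derivation of weight zero.
  have hsurj : ∀ e : E i, ∃ t ∈ BiTensor.part (TAlg.base k B E) (DDer ρ) (TAlg.weight k B E) 0,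
      ι.toLinearMap t = BiTensor.incl (TAlg.base k B E) e := by
    intro e
    obtain ⟨Θ, hΘ⟩ := TAlg.exists_iota_eq_D hω (TAlg.gen_mem E i e)
    refine ⟨_, TAlg.canInv_restrict_mem_part f (n := 0) (by push_cast; omega) Θ, (hι _).trans ?_⟩
    rw [hF_def, LinearMap.comp_apply, hΘ, TAlg.nu_D_gen, Pi.single_eq_same]
  have hpart := BiTensor.map_part_eq ι.toLinearMap hact hincl hsurj
  obtain ⟨j, hj⟩ := TAlg.exists_linearEquiv_of_map_part_zero ι
    (fun b b' t => by
      rw [hact 0 0 _ (TAlg.base_mem E b) _ (TAlg.base_mem E b'), Nat.cast_zero, mul_zero, sgn_zero,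
        one_smul]) (hpart 0)
  exact ⟨ι, hι, BiTensor.map_left_smul ι.toLinearMap hact, fun q a ha => hact 0 q 1 h1 a ha, hpart, j,
    hj⟩
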